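/- Let $K$ be a field, let $n\ge 2$, and let $\mathrm{Sp}(2n,K)$ be the group of matrices $P\in K^{2n\times 2n}$ with $PGP^{\mathsf T}=G$, where $G=\begin{pmatrix}0&I_n\\-I_n&0\end{pmatrix}$. Let $\Omega$ be a conjugacy class of $\mathrm{Sp}(2n,K)$ that does not consist of a scalar matrix, and let $\mathrm{PC}(\Omega)$ be the set of all upper left $n\times n$ corners of elements of $\Omega$. Let $i_1(\Omega)\mid i_2(\Omega)\mid\dots\mid i_{2n}(\Omega)$ be the (monic) invariant factors of the elements of $\Omega$, in ascending order: $i_k=d_k/d_{k-1}$, where $d_k$ is the monic greatest common divisor of the $k\times k$ minors of $xI-P$, $P\in\Omega$. A transvection is a matrix $A$ with $\operatorname{rank}(A-I)=1$ and $(A-I)^2=0$; a matrix is primary if its minimal polynomial is a power of an irreducible polynomial; $\Omega$ is involutory if $P^2=I$ for $P\in\Omega$. 1. Let $\operatorname{char}K=2$. Then $\mathrm{PC}(\Omega)$ contains (a) the identity matrix $I_n$; (b) a transvection, or a diagonal matrix $I_{n-2}\oplus\operatorname{diag}(\varepsilon,\varepsilon^{-1})$ for some $\varepsilon\in K\setminus\{0,1\}$;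 (c) for every $\delta\in K\setminus\{0\}$, the diagonal matrix $\delta I_1\oplus I_{n-1}$ or a matrix $Q\oplus I_{n-2}$, where $Q$ is a $2\times2$ matrix with minimal polynomial $x^2+\delta$. 2. Let $\operatorname{char}K\ne2$ and $i_2(\Omega)=x-1$. Then $\mathrm{PC}(\Omega)$ contains a transvection and all diagonal matrices $I_{n-1}\oplus\delta I_1$, $\delta\in K$. 3. Let $\operatorname{char}K\ne2$ and $i_2(\Omega)=1$, and let $\delta\in K\setminus\{0\}$. Then $\mathrm{PC}(\Omega)$ contains a matrix of determinant $\delta$ that is not primary, if (a) $2n\ge6$, or (b) $\Omega$ is not involutory and $K\ne\mathrm{GF}(3)$, or (c) $\Omega$ is not involutory and $\delta\ne1$. -/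

import Mathlib

open Matrix Polynomial

namespace SympCorner

noncomputable section

/-- The monic greatest common divisor of all `k × k` minors of the characteristic matrix
`x I - A` (a `k × k` minor with a repeated row or column index is zero, so all pairs of index
functions may be used); it is `1` for `k = 0`. -/
def detDivisor {ι K : Type*} [Fintype ι] [DecidableEq ι] [Field K]
    (A : Matrix ι ι K) (k : ℕ) : K[X] :=
  let d : K[X] := Submodule.IsPrincipal.generator
    (Ideal.span (Set.range fun rc : (Fin k → ι) × (Fin k → ι) =>
      (A.charmatrix.submatrix rc.1 rc.2).det))
  d * C d.leadingCoeff⁻¹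

/-- The `k`-th invariant factor `i_k(A)`, `1 ≤ k ≤ size of A`, of a square matrix over a field,
in ascending order: `i_1(A) ∣ i_2(A) ∣ ⋯`, the last one being the minimal polynomial. -/
def invFactor {ι K : Type*} [Fintype ι] [DecidableEq ι] [Field K]
    (A : Matrix ι ι K) (k : ℕ) : K[X] :=
  detDivisor A k / detDivisor A (k - 1)

/-- `PC(Ω)`: the matrices occurring as upper left `n × n` corner of some element of the conjugacy
class `Ω` of the symplectic group. -/
def PC {n : ℕ} {K : Type*} [Field K] (Ω : ConjClasses (symplecticGroup (Fin n) K)) :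
    Set (Matrix (Fin n) (Fin n) K) :=
  {A | ∃ P ∈ Ω.carrier, (P : Matrix (Fin n ⊕ Fin n) (Fin n ⊕ Fin n) K).toBlocks₁₁ = A}

/-- A matrix is scalar if it is `c I` for some `c`. -/
def IsScalarMat {ι K : Type*} [Fintype ι] [DecidableEq ι] [Field K] (A : Matrix ι ι K) : Prop :=
  ∃ c : K, A = c • (1 : Matrix ι ι K)

/-- A transvection: `A - I` has rank one and square zero. -/
def IsTransvection {ι K : Type*} [Fintype ι] [DecidableEq ι] [Field K] (A : Matrix ι ι K) : Prop :=
  (A - 1).rank = 1 ∧ (A - 1) * (A - 1) = 0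

/-- A matrix is primary if its minimal polynomial is a power of an irreducible polynomial. -/
def IsPrimary {ι K : Type*} [Fintype ι] [DecidableEq ι] [Field K] (A : Matrix ι ι K) : Prop :=
  ∃ (p : K[X]) (m : ℕ), Irreducible p ∧ minpoly K A = p ^ m

/-- The direct sum `A ⊕ B` (block diagonal matrix) of a `p × p` and a `q × q` matrix, as an
`n × n` matrix where `p + q = n`. -/
def dsum {K : Type*} [Field K] {p q n : ℕ} (h : p + q = n)
    (A : Matrix (Fin p) (Fin p) K) (B : Matrix (Fin q) (Fin q) K) : Matrix (Fin n) (Fin n) K :=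
  Matrix.reindex (finSumFinEquiv.trans (finCongr h)) (finSumFinEquiv.trans (finCongr h))
    (Matrix.fromBlocks A 0 0 B)

end

end SympCorner

/-!
A symplectic matrix with blocks `A, B, C, D` shows its corner `A` in a symplectic basis whose
first half spans a Lagrangian subspace `U`. The idea is to choose `U` so that the corner becomes
flexible.

Keeping `U` and changing its complement, one may replace `A` by every `X` that agrees with `A` on
the kernel of `C` and for which `Cᵀ X` is symmetric (`exists_sympConj_corner`). This is most
useful if `C` is symmetric and `A` is simple on its kernel. In terms of the isometry `P` on the
symplectic space, `C` is the Gram matrix of the form `w x (P y)` on `U`, and its kernel is `U ∩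
P⁻¹ U`. Hence the following structure theorem, over an arbitrary field, is the heart of the proof
(`SympIsom.exists_isAdapted_top`): there is an *adapted* Lagrangian subspace `U`, i.e. `w x (P y)`
is symmetric on `U`, the subspace `U ∩ P⁻¹ U` is a sum of eigenspaces for `1` and `-1`, and `P` is
an involution if `U` is invariant. For its proof, a nondegenerate invariant subspace `Z` is split
off. The symmetry of the form means that `U` is isotropic for `w x ((P + P⁻¹) y)`, which holds for
all subspaces `K[P + P⁻¹] z`. These are adapted in `Z = K[P] z` if the latter is nondegenerate,
and such a vector `z` exists in general. The exception are primary components for the eigenvalues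
`1` and `-1` on which `w x ((P - c) ^ (k - 1) x)` vanishes identically; there, `Z` is the sum of
two cyclic subspaces in duality, and `U` is the sum of two subspaces which are cyclic for `P +
P⁻¹` (`SympIsom.exists_isAdapted_exceptional`).

If `A` is the identity on the kernel of `C`, then all `X` with symmetric `C X` that fix the kernel
are corners; `C` is called `Flexible`. When `C = 0`, the upper right block takes its role, so that
`C ≠ 0` may be assumed. In characteristic two this applies to every class, and the corners are
read off from a vector, or a pair of vectors, with invertible Gram matrix, or from an isotropic
vector (`Flexible.corners_of_two_eq_zero`). In characteristic not two, a second invariant factor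
`x - 1` means that `P - 1` has rank one; then `-1` is not an eigenvalue and `C` has rank one
(`Flexible.corners_of_degenerate`).

If the second invariant factor is `1`, then `P - η` has rank at least two for all `η`. With `C`
diagonal (`exists_sympConj_diagonal`), all diagonal matrices with prescribed entries `± 1` at the
zeros of `C` are corners. Under the hypotheses on `n`, `K` and `δ`, this gives nonprimary matrices
of determinant `δ` except when `C = 0` or when `C` has rank one and the prescribed entries are
equal. These cases need a different Lagrangian subspace, on which the corner and `C` are computed
explicitly (`exists_corner_of_involution`, `exists_corner_of_scalar`).
-/

/-! ### Isometries of an alternating form and adapted subspaces -/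

/-- `P` is an isometry, with inverse `R`, of the nondegenerate alternating form `w`.  Carrying the
inverse along avoids units of the endomorphism ring; `adj` expresses that `P` is an isometry. -/
structure SympIsom {K V : Type*} [Field K] [AddCommGroup V] [Module K V]
    (w : LinearMap.BilinForm K V) (P R : Module.End K V) : Prop where
  alt : ∀ x, w x x = 0
  nondeg : ∀ x, (∀ y, w x y = 0) → x = 0
  mul_inv : P * R = 1
  inv_mul : R * P = 1
  adj : ∀ x y, w (P x) y = w x (R y)

/-- `U` is a maximal totally isotropic subspace of `Z` on which the form `w x (P y)` is symmetric
and whose largest `P`-invariant subspace is a sum of eigenspaces for `1` and `-1`.  Moreover, if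
`U` itself is `P`-invariant, then `P` is an involution on `Z`. -/
structure IsAdapted {K V : Type*} [Field K] [AddCommGroup V] [Module K V]
    (w : LinearMap.BilinForm K V) (P : Module.End K V) (Z U : Submodule K V) : Prop where
  le : U ≤ Z
  iso : ∀ x ∈ U, ∀ y ∈ U, w x y = 0
  maxl : ∀ z ∈ Z, (∀ u ∈ U, w u z = 0) → z ∈ U
  symm : ∀ x ∈ U, ∀ y ∈ U, w x (P y) = w y (P x)
  fix : ∀ u ∈ U, P u ∈ U → ∃ a ∈ U, ∃ b ∈ U, u = a + b ∧ P a = a ∧ P b = -b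
  inv : (∀ u ∈ U, P u ∈ U) → ∀ z ∈ Z, P (P z) = z

namespace SympIsom

variable {K V : Type*} [Field K] [AddCommGroup V] [Module K V]
  {w : LinearMap.BilinForm K V} {P R : Module.End K V}

lemma apply_inv (h : SympIsom w P R) (x : V) : P (R x) = x :=
  LinearMap.congr_fun h.mul_inv x

lemma inv_apply (h : SympIsom w P R) (x : V) : R (P x) = x :=
  LinearMap.congr_fun h.inv_mul x

lemma skew (h : SympIsom w P R) (x y : V) : w x y = -w y x := by
  have := h.alt (x + y)
  simp only [map_add, LinearMap.add_apply, h.alt] at this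
  linear_combination this

lemma adj' (h : SympIsom w P R) (x y : V) : w (R x) y = w x (P y) := by
  rw [h.skew, h.skew x, h.adj]

lemma apply_apply (h : SympIsom w P R) (x y : V) : w (P x) (P y) = w x y := by
  rw [h.adj, h.inv_apply]

lemma nondeg_right (h : SympIsom w P R) (y : V) (hy : ∀ x, w x y = 0) : y = 0 :=
  h.nondeg y fun x => by rw [h.skew, hy, neg_zero]

lemma aeval_adj {A B : Module.End K V} (hAB : ∀ x y, w (A x) y = w x (B y)) (f : K[X]) (x y : V) :
    w (aeval A f x) y = w x (aeval B f y) := by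
  have hpow : ∀ (n : ℕ) (x y : V), w ((A ^ n) x) y = w x ((B ^ n) y) := by
    intro n
    induction n with
    | zero => intro x y; simp
    | succ n ih => intro x y; rw [pow_succ, pow_succ', Module.End.mul_apply, Module.End.mul_apply,
        ih, hAB]
  induction f using Polynomial.induction_on' with
  | add p q hp hq => simp only [map_add, LinearMap.add_apply, hp, hq]
  | monomial n a => simp [aeval_monomial, hpow, Module.End.mul_apply, Module.algebraMap_end_apply]

lemma adj_poly (h : SympIsom w P R) (f : K[X]) (x y : V) :
    w (aeval P f x) y = w x (aeval R f y) := aeval_adj h.adj f x y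

lemma adj_poly' (h : SympIsom w P R) (f : K[X]) (x y : V) :
    w (aeval R f x) y = w x (aeval P f y) := aeval_adj h.adj' f x y

/-- The sum `P + P⁻¹` is self-adjoint. -/
lemma adj_sum (h : SympIsom w P R) (f : K[X]) (x y : V) :
    w (aeval (P + R) f x) y = w x (aeval (P + R) f y) :=
  aeval_adj (fun x y => by simp only [LinearMap.add_apply, map_add, h.adj, h.adj', add_comm]) f x y

/-- Every vector is isotropic for all forms `w x (f (P + P⁻¹) y)`. -/
lemma sum_isotropic (h : SympIsom w P R) (f : K[X]) (z : V) : w z (aeval (P + R) f z) = 0 := by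
  have hT : ∀ x y, w ((P + R) x) y = w x ((P + R) y) := fun x y => by
    simpa using h.adj_sum X x y
  have hpow : ∀ (n : ℕ) (x y : V), w (((P + R) ^ n) x) y = w x (((P + R) ^ n) y) :=
    fun n x y => by simpa using h.adj_sum (X ^ n) x y
  have h1 : ∀ y, w y ((P + R) y) = 0 := fun y => by
    rw [LinearMap.add_apply, map_add, ← h.adj, h.skew y, neg_add_cancel]
  induction f using Polynomial.induction_on' with
  | add p q hp hq => simp only [map_add, LinearMap.add_apply, hp, hq, add_zero]
  | monomial n a =>
    simp only [aeval_monomial, Module.End.mul_apply, Module.algebraMap_end_apply, map_smul]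
    obtain ⟨m, rfl | rfl⟩ := Nat.even_or_odd' n
    · rw [two_mul, pow_add, Module.End.mul_apply, ← hpow, h.alt, smul_zero]
    · rw [two_mul, add_assoc, pow_add, Module.End.mul_apply, ← hpow, pow_succ',
        Module.End.mul_apply, h1, smul_zero]

lemma symm_of_isotropic (h : SympIsom w P R) {x y : V} (hT : w x ((P + R) y) = 0) :
    w x (P y) = w y (P x) := by
  rw [LinearMap.add_apply, map_add, ← h.adj, h.skew (P x)] at hT
  linear_combination hT

lemma inv_mem [FiniteDimensional K V] (h : SympIsom w P R) {Z : Submodule K V}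
    (hZ : ∀ z ∈ Z, P z ∈ Z) {z : V} (hz : z ∈ Z) : R z ∈ Z := by
  have hinj : Function.Injective P := fun x y hxy => by
    rw [← h.inv_apply x, hxy, h.inv_apply]
  have h1 : Z.map P = Z := by
    apply Submodule.eq_of_le_of_finrank_eq
    · rintro _ ⟨x, hx, rfl⟩
      exact hZ x hx
    · exact (Submodule.equivMapOfInjective P hinj Z).finrank_eq.symm
  rw [← h1] at hz
  obtain ⟨y, hy, rfl⟩ := hz
  rwa [h.inv_apply]

lemma exists_inv_eq_aeval [FiniteDimensional K V] (h : SympIsom w P R) :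
    ∃ g : K[X], R = aeval P g := by
  have h0 : P.charpoly.coeff 0 ≠ 0 := by
    intro h0
    have h1 := LinearMap.det_eq_sign_charpoly_coeff P
    rw [h0, mul_zero] at h1
    have h2 := congrArg LinearMap.det h.mul_inv
    rw [map_mul, h1, zero_mul, map_one] at h2
    exact zero_ne_one h2
  refine ⟨-C (P.charpoly.coeff 0)⁻¹ * P.charpoly.divX, ?_⟩
  have h1 : aeval P (P.charpoly.divX * X + C (P.charpoly.coeff 0)) = 0 := by
    rw [divX_mul_X_add, LinearMap.aeval_self_charpoly]
  have h2 : aeval P (-C (P.charpoly.coeff 0)⁻¹ * P.charpoly.divX * X) = 1 := by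
    have h3 : -C (P.charpoly.coeff 0)⁻¹ * P.charpoly.divX * X =
        -C (P.charpoly.coeff 0)⁻¹ * (P.charpoly.divX * X + C (P.charpoly.coeff 0)) + 1 := by
      have : C (P.charpoly.coeff 0)⁻¹ * C (P.charpoly.coeff 0) = 1 := by
        rw [← C_mul, inv_mul_cancel₀ h0, C_1]
      linear_combination this
    rw [h3, map_add, map_mul, h1, mul_zero, zero_add, map_one]
  rw [map_mul, aeval_X] at h2
  calc R = aeval P (-C (P.charpoly.coeff 0)⁻¹ * P.charpoly.divX) * P * R := by rw [h2, one_mul]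
    _ = _ := by rw [mul_assoc, h.mul_inv, mul_one]

end SympIsom

/-- The cyclic subspace `K[A] z`. -/
noncomputable def cyclicSub {K V : Type*} [Field K] [AddCommGroup V] [Module K V]
    (A : Module.End K V) (z : V) : Submodule K V :=
  LinearMap.range ((LinearMap.applyₗ z : Module.End K V →ₗ[K] V) ∘ₗ (aeval A).toLinearMap)

section Cyclic

variable {K V : Type*} [Field K] [AddCommGroup V] [Module K V] (A : Module.End K V)

lemma mem_cyclicSub {z x : V} : x ∈ cyclicSub A z ↔ ∃ f : K[X], aeval A f z = x := by
  simp [cyclicSub]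

lemma aeval_mem_cyclicSub (f : K[X]) (z : V) : aeval A f z ∈ cyclicSub A z :=
  (mem_cyclicSub A).2 ⟨f, rfl⟩

lemma self_mem_cyclicSub (z : V) : z ∈ cyclicSub A z := (mem_cyclicSub A).2 ⟨1, by simp⟩

lemma aeval_apply_mem {Z : Submodule K V} {A : Module.End K V} (hZ : ∀ z ∈ Z, A z ∈ Z) (f : K[X])
    {z : V} (hz : z ∈ Z) : aeval A f z ∈ Z := by
  have hpow : ∀ (n : ℕ), (A ^ n) z ∈ Z := by
    intro n
    induction n with
    | zero => simpa
    | succ n ih => rw [pow_succ', Module.End.mul_apply]; exact hZ _ ih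
  induction f using Polynomial.induction_on' with
  | add p q hp hq => simpa using Z.add_mem hp hq
  | monomial n a =>
    simpa [aeval_monomial, Module.End.mul_apply, Module.algebraMap_end_apply] using
      Z.smul_mem a (hpow n)

lemma apply_mem_cyclicSub {z x : V} (hx : x ∈ cyclicSub A z) : A x ∈ cyclicSub A z := by
  obtain ⟨f, rfl⟩ := (mem_cyclicSub A).1 hx
  exact (mem_cyclicSub A).2 ⟨X * f, by simp [Module.End.mul_apply]⟩

lemma cyclicSub_le {Z : Submodule K V} {A : Module.End K V} (hZ : ∀ z ∈ Z, A z ∈ Z)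
    {z : V} (hz : z ∈ Z) : cyclicSub A z ≤ Z := by
  intro x hx
  obtain ⟨f, rfl⟩ := (mem_cyclicSub A).1 hx
  exact aeval_apply_mem hZ f hz

lemma aeval_mul_apply (f g : K[X]) (x : V) : aeval A (f * g) x = aeval A f (aeval A g x) := by
  rw [map_mul, Module.End.mul_apply]

lemma aeval_comm_apply (f g : K[X]) (x : V) :
    aeval A f (aeval A g x) = aeval A g (aeval A f x) := by
  rw [← aeval_mul_apply, mul_comm, aeval_mul_apply]

end Cyclic

namespace SympIsom

variable {K V : Type*} [Field K] [AddCommGroup V] [Module K V]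
  {w : LinearMap.BilinForm K V} {P R : Module.End K V}

/-- If `U` is invariant under `P + P⁻¹`, then `U + P U` is invariant under `P`. -/
lemma apply_mem_sup (h : SympIsom w P R) {U : Submodule K V}
    (hT : ∀ u ∈ U, (P + R) u ∈ U) {x : V} (hx : x ∈ U ⊔ U.map P) : P x ∈ U ⊔ U.map P := by
  obtain ⟨u, hu, _, ⟨u', hu', rfl⟩, rfl⟩ := Submodule.mem_sup.1 hx
  have h1 : P (u + P u') = -u' + P (u + (P + R) u') := by
    simp only [map_add, LinearMap.add_apply, h.apply_inv]
    abel
  rw [h1]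
  exact Submodule.add_mem_sup (U.neg_mem hu') ⟨_, U.add_mem hu (hT _ hu'), rfl⟩

/-- A criterion for adapted subspaces: `Z = U + P U + K v`, where either `v = 0` or `v` is not
orthogonal to a vector `a` of `U` with `P a = c a`, `c = ± 1`.  The largest `P`-invariant subspace
of `U` lies in the radical of `U + P U`, and hence in `K a`. -/
lemma isAdapted_of_span (h : SympIsom w P R) {Z U : Submodule K V}
    (hZP : ∀ z ∈ Z, P z ∈ Z)
    (hZ : ∀ z ∈ Z, (∀ y ∈ Z, w z y = 0) → z = 0)
    (hUZ : U ≤ Z) (hiso : ∀ x ∈ U, ∀ y ∈ U, w x y = 0)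
    (hT : ∀ u ∈ U, (P + R) u ∈ U) {c : K} (hc : c * c = 1) {a v : V} (ha : a ∈ U)
    (hPa : P a = c • a) (hspan : Z ≤ (U ⊔ U.map P) ⊔ Submodule.span K {v})
    (hv : w a v = 0 → v = 0)
    (hinv : (∀ u ∈ U, P u ∈ U) → (∀ u ∈ U, ∃ t : K, u = t • a) → ∀ z ∈ Z, P (P z) = z) :
    IsAdapted w P Z U := by
  have hRa : R a = c • a := by
    have := congrArg (fun x => c • R x) hPa
    simp only [h.inv_apply, map_smul, smul_smul, hc, one_smul] at this
    exact this.symm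
  have hiso' : ∀ x ∈ U, ∀ y ∈ U, w (P x) (P y) = 0 := fun x hx y hy => by
    rw [h.apply_apply, hiso x hx y hy]
  have haP : ∀ u ∈ U, w a (P u) = 0 := fun u hu => by
    rw [← h.adj', hRa, map_smul, LinearMap.smul_apply, hiso a ha u hu, smul_zero]
  -- the radical of `U + P U` is spanned by `a`
  have key : ∀ y ∈ Z, (∀ u ∈ U, w u y = 0) → (∀ u ∈ U, w (P u) y = 0) → ∃ t : K, y = t • a := by
    intro y hy h1 h2
    refine ⟨(w a v)⁻¹ * w y v, ?_⟩
    rw [← sub_eq_zero]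
    apply hZ _ (Z.sub_mem hy (Z.smul_mem _ (hUZ ha)))
    intro x hx
    obtain ⟨s, hs, r, hr, rfl⟩ := Submodule.mem_sup.1 (hspan hx)
    obtain ⟨u, hu, _, ⟨u', hu', rfl⟩, rfl⟩ := Submodule.mem_sup.1 hs
    obtain ⟨t, rfl⟩ := Submodule.mem_span_singleton.1 hr
    have e1 : w y u = 0 := by rw [h.skew, h1 u hu, neg_zero]
    have e2 : w y (P u') = 0 := by rw [h.skew, h2 u' hu', neg_zero]
    simp only [map_add, map_sub, map_smul, LinearMap.sub_apply, LinearMap.smul_apply, e1, e2,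
      hiso a ha u hu, haP u' hu', smul_eq_mul, mul_zero, sub_zero, zero_add]
    by_cases h0 : w a v = 0
    · simp [hv h0]
    · field_simp
      ring
  have hN : ∀ u ∈ U, P u ∈ U → ∃ t : K, u = t • a := by
    intro u hu hPu
    obtain ⟨t, ht⟩ := key (P u) (hUZ hPu) (fun x hx => hiso x hx _ hPu)
      (fun x hx => hiso' x hx u hu)
    refine ⟨t * c, ?_⟩
    rw [← h.inv_apply u, ht, map_smul, hRa, smul_smul]
  refine ⟨hUZ, hiso, ?_, ?_, ?_, ?_⟩
  · intro z hz hzU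
    obtain ⟨s, hs, r, hr, rfl⟩ := Submodule.mem_sup.1 (hspan hz)
    obtain ⟨u, hu, _, ⟨u', hu', rfl⟩, rfl⟩ := Submodule.mem_sup.1 hs
    obtain ⟨t, rfl⟩ := Submodule.mem_span_singleton.1 hr
    -- a vector of `Z` orthogonal to `a` has no component along `v`
    have h0 : t • v = 0 := by
      have h1 := hzU a ha
      simp only [map_add, map_smul, hiso a ha u hu, haP u' hu', zero_add, smul_eq_mul,
        mul_eq_zero] at h1
      rcases h1 with h1 | h1
      · rw [h1, zero_smul]
      · rw [hv h1, smul_zero]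
    rw [h0, add_zero] at hzU ⊢
    obtain ⟨t, ht⟩ := key (P u') (hZP _ (hUZ hu'))
      (fun x hx => by have := hzU x hx; rwa [map_add, hiso x hx u hu, zero_add] at this)
      (fun x hx => hiso' x hx u' hu')
    rw [ht]
    exact U.add_mem hu (U.smul_mem _ ha)
  · intro x hx y hy
    exact h.symm_of_isotropic (hiso x hx _ (hT y hy))
  · intro u hu hPu
    obtain ⟨t, rfl⟩ := hN u hu hPu
    have hcc : (c - 1) * (c + 1) = 0 := by linear_combination hc
    rcases mul_eq_zero.1 hcc with h1 | h1
    · refine ⟨t • a, hu, 0, U.zero_mem, by simp, ?_, by simp⟩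
      rw [map_smul, hPa, sub_eq_zero.1 h1, one_smul]
    · refine ⟨0, U.zero_mem, t • a, hu, by simp, by simp, ?_⟩
      rw [map_smul, hPa, eq_neg_of_add_eq_zero_left h1]
      simp
  · intro hU
    exact hinv hU fun u hu => hN u hu (hU u hu)

/-- A nondegenerate cyclic subspace `K[P] z` has the adapted subspace `K[P + P⁻¹] z`. -/
lemma isAdapted_cyclic [FiniteDimensional K V] (h : SympIsom w P R) (z : V)
    (hZ : ∀ x ∈ cyclicSub P z, (∀ y ∈ cyclicSub P z, w x y = 0) → x = 0) :
    IsAdapted w P (cyclicSub P z) (cyclicSub (P + R) z) := by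
  have hP : ∀ x ∈ cyclicSub P z, P x ∈ cyclicSub P z := fun x hx => apply_mem_cyclicSub P hx
  have hspan : cyclicSub P z ≤ cyclicSub (P + R) z ⊔ (cyclicSub (P + R) z).map P :=
    cyclicSub_le (fun x hx => h.apply_mem_sup (fun u hu => apply_mem_cyclicSub _ hu) hx)
      (Submodule.mem_sup_left (self_mem_cyclicSub _ z))
  refine h.isAdapted_of_span hP hZ (cyclicSub_le (fun x hx => ?_) (self_mem_cyclicSub P z)) ?_
    (fun u hu => apply_mem_cyclicSub _ hu) (c := 1) (one_mul 1) (a := 0) (v := 0)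
    (Submodule.zero_mem _) (by simp) (hspan.trans le_sup_left) (fun _ => rfl) ?_
  · exact Submodule.add_mem _ (hP x hx) (h.inv_mem hP hx)
  · intro x hx y hy
    obtain ⟨f, rfl⟩ := (mem_cyclicSub _).1 hx
    obtain ⟨g, rfl⟩ := (mem_cyclicSub _).1 hy
    rw [h.adj_sum, ← aeval_mul_apply, h.sum_isotropic]
  · intro _ hu0
    have hz : z = 0 := by
      obtain ⟨t, ht⟩ := hu0 z (self_mem_cyclicSub _ z)
      rw [ht, smul_zero]
    intro x hx
    obtain ⟨f, rfl⟩ := (mem_cyclicSub _).1 hx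
    simp [hz]

end SympIsom

/-! ### Splitting off an adapted subspace -/

lemma exists_mul_add_mul_eq_pow_pred {K : Type*} [Field K] {p : K[X]} (hp : Irreducible p) {k : ℕ}
    {f : K[X]} (hf : ¬ p ^ k ∣ f) : ∃ g q : K[X], g * f + q * p ^ k = p ^ (k - 1) := by
  classical
  obtain ⟨i, hi, hai⟩ := (dvd_prime_pow hp.prime k).1 (EuclideanDomain.gcd_dvd_right f (p ^ k))
  have hik : i ≠ k := by
    rintro rfl
    exact hf (hai.symm.dvd.trans (EuclideanDomain.gcd_dvd_left f (p ^ i)))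
  obtain ⟨r, hr⟩ : EuclideanDomain.gcd f (p ^ k) ∣ p ^ (k - 1) :=
    hai.dvd.trans (pow_dvd_pow p (by omega))
  refine ⟨r * EuclideanDomain.gcdA f (p ^ k), r * EuclideanDomain.gcdB f (p ^ k), ?_⟩
  rw [hr, EuclideanDomain.gcd_eq_gcd_ab]
  ring

namespace SympIsom

variable {K V : Type*} [Field K] [AddCommGroup V] [Module K V]
  {w : LinearMap.BilinForm K V} {P R : Module.End K V}

/-- If `p ^ k` annihilates `x` and `f(P) x ≠ 0`, then `p(P) ^ (k - 1) x` is a multiple of `f(P) x`: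
the submodule it generates is the socle of the cyclic module `K[P] x`. -/
lemma exists_socle_eq {p : K[X]} (hp : Irreducible p) {k : ℕ} {x : V}
    (hx : aeval P (p ^ k) x = 0) {f : K[X]} (hf : aeval P f x ≠ 0) :
    ∃ g : K[X], aeval P (p ^ (k - 1)) x = aeval P g (aeval P f x) := by
  have hnd : ¬ p ^ k ∣ f := by
    rintro ⟨q, rfl⟩
    exact hf (by rw [mul_comm, aeval_mul_apply, hx, map_zero])
  obtain ⟨g, q, hgq⟩ := exists_mul_add_mul_eq_pow_pred hp hnd
  refine ⟨g, ?_⟩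
  rw [← hgq, map_add, LinearMap.add_apply, aeval_mul_apply, aeval_mul_apply, hx, map_zero,
    add_zero]

/-- The case of two different primary components in duality.  With `P⁻¹ = g₀(P)`, the component of
`p` is paired with the component of `p.comp g₀`; if these are different, then the sum of two vectors
that are dual in the socle generates a nondegenerate cyclic subspace. -/
lemma exists_isAdapted_of_isCoprime [FiniteDimensional K V] (h : SympIsom w P R)
    {g₀ : K[X]} (hg₀ : R = aeval P g₀)
    {p : K[X]} (hp : Irreducible p) {k : ℕ} (hcop : IsCoprime p (p.comp g₀)) {v y : V}
    (hv : aeval P (p ^ k) v = 0)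
    (hy : aeval R (p ^ k) y = 0) (hvy : w (aeval P (p ^ (k - 1)) v) y ≠ 0) :
    ∃ z : V, z ≠ 0 ∧ ∀ x ∈ cyclicSub P z, (∀ y ∈ cyclicSub P z, w x y = 0) → x = 0 := by
  have hcomp : ∀ f : K[X], aeval P (f.comp g₀) = aeval R f := fun f => by
    rw [aeval_comp, ← hg₀]
  obtain ⟨a, b, hab⟩ : IsCoprime (p ^ k) ((p.comp g₀) ^ k) := hcop.pow
  have hy' : aeval P ((p.comp g₀) ^ k) y = 0 := by rw [← pow_comp, hcomp, hy]
  -- both `v` and `y` belong to `K[P] (v + y)`, because their annihilators are coprime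
  have hev : aeval P (b * (p.comp g₀) ^ k) (v + y) = v := by
    have h1 : aeval P (b * (p.comp g₀) ^ k) y = 0 := by rw [aeval_mul_apply, hy', map_zero]
    have h2 : aeval P (a * p ^ k) v = 0 := by rw [aeval_mul_apply, hv, map_zero]
    have h3 := congrArg (fun f => aeval P f v) hab
    simp only [map_add, LinearMap.add_apply, h2, zero_add, map_one, Module.End.one_apply] at h3
    rw [map_add, h1, h3, add_zero]
  have hvZ : v ∈ cyclicSub P (v + y) := (mem_cyclicSub P).2 ⟨_, hev⟩
  have hyZ : y ∈ cyclicSub P (v + y) := by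
    simpa using Submodule.sub_mem _ (self_mem_cyclicSub P (v + y)) hvZ
  have hPZ : ∀ x ∈ cyclicSub P (v + y), P x ∈ cyclicSub P (v + y) :=
    fun x hx => apply_mem_cyclicSub P hx
  have hRZ : ∀ x ∈ cyclicSub P (v + y), R x ∈ cyclicSub P (v + y) := fun x hx => h.inv_mem hPZ hx
  have hv0 : v ≠ 0 := by
    rintro rfl
    simp at hvy
  refine ⟨v + y, ?_, ?_⟩
  · intro h0
    rw [h0, map_zero] at hev
    exact hv0 hev.symm
  intro x hx hrad
  obtain ⟨f, rfl⟩ := (mem_cyclicSub P).1 hx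
  have hfv : aeval P f v = 0 := by
    by_contra hne
    obtain ⟨g, hg⟩ := exists_socle_eq hp hv hne
    apply hvy
    rw [hg, ← hev, aeval_comm_apply P f, h.adj_poly, h.adj_poly]
    exact hrad _ (aeval_apply_mem hRZ _ (aeval_apply_mem hRZ _ hyZ))
  have hfy : aeval P f y = 0 := by
    -- the adjoint `f(P⁻¹)` kills `v`, thus `p ^ k` divides `f.comp g₀`, and `f(P)` kills `y`
    have h1 : aeval P (f.comp g₀) v = 0 := by
      by_contra hne
      obtain ⟨g, hg⟩ := exists_socle_eq hp hv hne
      apply hvy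
      rw [hg, aeval_comm_apply, hcomp, h.adj_poly', h.skew]
      rw [map_add, hfv, zero_add] at hrad
      rw [hrad _ (aeval_apply_mem hPZ _ hvZ), neg_zero]
    have h2 : p ^ k ∣ f.comp g₀ := by
      by_contra hnd
      obtain ⟨g, q, hgq⟩ := exists_mul_add_mul_eq_pow_pred hp hnd
      apply hvy
      rw [← hgq, map_add, LinearMap.add_apply, aeval_mul_apply, aeval_mul_apply, hv, h1]
      simp
    obtain ⟨q, hq⟩ := h2
    have h3 : ∀ x, aeval P f x = aeval R (q * p ^ k) x := by
      intro x
      rw [← sub_eq_zero]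
      apply h.nondeg_right
      intro t
      rw [map_sub, ← h.adj_poly', ← h.adj_poly, ← hcomp, hq, mul_comm, sub_self]
    rw [h3, aeval_mul_apply, hy, map_zero]
  rw [map_add, hfv, hfy, add_zero]

/-- A primary cyclic subspace is nondegenerate as soon as its socle is not in its radical. -/
lemma cyclic_nondeg [FiniteDimensional K V] (h : SympIsom w P R) {p : K[X]} (hp : Irreducible p)
    {k : ℕ} {z y : V}
    (hz : aeval P (p ^ k) z = 0) (hy : y ∈ cyclicSub P z)
    (hzy : w (aeval P (p ^ (k - 1)) z) y ≠ 0) :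
    ∀ x ∈ cyclicSub P z, (∀ y ∈ cyclicSub P z, w x y = 0) → x = 0 := by
  intro x hx hrad
  obtain ⟨f, rfl⟩ := (mem_cyclicSub P).1 hx
  by_contra hne
  obtain ⟨g, hg⟩ := exists_socle_eq hp hz hne
  apply hzy
  rw [hg, h.adj_poly]
  exact hrad _ (aeval_apply_mem (fun x hx => h.inv_mem (fun x hx => apply_mem_cyclicSub P hx) hx)
    _ hy)

/-- If the socle of every cyclic subspace of a primary component lies in its radical, then the
component belongs to the eigenvalue `1` or `-1`. -/
lemma dvd_X_sq_sub_one (h : SympIsom w P R) {p : K[X]} (hp : Irreducible p) {k : ℕ} (hk : k ≠ 0)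
    (halt : ∀ z, aeval P (p ^ k) z = 0 → ∀ y ∈ cyclicSub P z, w (aeval P (p ^ (k - 1)) z) y = 0)
    {v y : V} (hR : ∀ (f : K[X]) (x : V), aeval P (p ^ k) x = 0 →
      aeval P (p ^ k) (aeval R f x) = 0)
    (hv : aeval P (p ^ k) v = 0) (hy : aeval P (p ^ k) y = 0)
    (hvy : w (aeval P (p ^ (k - 1)) v) y ≠ 0) : p ∣ X ^ 2 - 1 := by
  set s := aeval P (p ^ (k - 1)) with hs
  have hP : ∀ x, aeval P (p ^ k) x = 0 → aeval P (p ^ k) (P x) = 0 := fun x hx => by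
    have := aeval_comm_apply P (p ^ k) X x
    rwa [hx, map_zero, aeval_X] at this
  have hsP : ∀ x, s (P x) = P (s x) := fun x => by
    have := aeval_comm_apply P (p ^ (k - 1)) X x
    rwa [aeval_X] at this
  have hadd : ∀ x y, aeval P (p ^ k) x = 0 → aeval P (p ^ k) y = 0 →
      aeval P (p ^ k) (x + y) = 0 := fun x y hx hy => by rw [map_add, hx, hy, add_zero]
  -- polarize the vanishing of `w (s x) x` and of `w (s x) (P x)`
  have a1 : ∀ x y, aeval P (p ^ k) x = 0 → aeval P (p ^ k) y = 0 → w (s x) y = -w (s y) x := by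
    intro x y hx hy
    have h0 := halt (x + y) (hadd x y hx hy) _ (self_mem_cyclicSub P _)
    have hx0 := halt x hx _ (self_mem_cyclicSub P _)
    have hy0 := halt y hy _ (self_mem_cyclicSub P _)
    simp only [map_add, LinearMap.add_apply] at h0
    linear_combination h0 - hx0 - hy0
  have a2 : ∀ x y, aeval P (p ^ k) x = 0 → aeval P (p ^ k) y = 0 →
      w (s x) (P y) = w (s (P x)) y := by
    intro x y hx hy
    have h0 := halt (x + y) (hadd x y hx hy) _ (apply_mem_cyclicSub P (self_mem_cyclicSub P _))
    have hx0 := halt x hx _ (apply_mem_cyclicSub P (self_mem_cyclicSub P _))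
    have hy0 := halt y hy _ (apply_mem_cyclicSub P (self_mem_cyclicSub P _))
    simp only [map_add, LinearMap.add_apply] at h0
    linear_combination h0 - hx0 - hy0 - a1 (P x) y (hP x hx) hy
  have a3 : ∀ x y, aeval P (p ^ k) x = 0 → aeval P (p ^ k) y = 0 →
      w (s (P (P x))) y = w (s x) y := by
    intro x y hx hy
    rw [← a2 _ _ (hP x hx) hy, hsP, h.apply_apply]
  -- hence `p ^ (k - 1) (X ^ 2 - 1)` annihilates `v`
  have h1 : aeval P ((X ^ 2 - 1) * p ^ (k - 1)) v = 0 := by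
    by_contra hne
    obtain ⟨g, hg⟩ := exists_socle_eq hp hv hne
    apply hvy
    rw [hs, hg, h.adj_poly]
    have h2 : aeval P ((X ^ 2 - 1) * p ^ (k - 1)) v = s (P (P v)) - s v := by
      rw [aeval_mul_apply, ← hs, hsP, hsP]
      simp [pow_two, Module.End.mul_apply]
    rw [h2, map_sub, LinearMap.sub_apply, a3 _ _ hv (hR g y hy), sub_self]
  by_contra hnd
  obtain ⟨a, b, hab⟩ := (hp.coprime_iff_not_dvd.2 hnd : IsCoprime p (X ^ 2 - 1))
  apply hvy
  have h3 : p ^ (k - 1) = a * p ^ k + b * ((X ^ 2 - 1) * p ^ (k - 1)) := by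
    conv_lhs => rw [← one_mul (p ^ (k - 1)), ← hab]
    obtain ⟨j, rfl⟩ := Nat.exists_eq_succ_of_ne_zero hk
    simp only [Nat.succ_eq_add_one, Nat.add_sub_cancel]
    ring
  rw [hs, h3, map_add, LinearMap.add_apply, aeval_mul_apply, hv, aeval_mul_apply P b, h1]
  simp

end SympIsom

/-! ### The exceptional eigenvalues `1` and `-1` -/

namespace SympIsom

variable {K V : Type*} [Field K] [AddCommGroup V] [Module K V]
  {w : LinearMap.BilinForm K V} {P R : Module.End K V}

/-- In the `c`-primary component, `c = ± 1`, a socle vector `(P - c) ^ (k - 1) v` is not of the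
form `f(D) (P⁻¹ - c) ^ ε v`, where `D = P + P⁻¹ - 2 c = P⁻¹ (P - c) ^ 2`, when `k` and `ε` have the
same parity: such vectors have `(P - c)`-adic order of the wrong parity.  Here `P⁻¹ = g₀(P)`, so
`P⁻¹ - c = -c P⁻¹ (P - c)`. -/
lemma socle_ne (h : SympIsom w P R) {g₀ : K[X]} (hg₀ : R = aeval P g₀) {c : K} (hc : c * c = 1)
    {k j ε : ℕ} (hk : k = 2 * j + ε)
    {v : V} (hv : aeval P ((X - C c) ^ k) v = 0) (hv' : aeval P ((X - C c) ^ (k - 1)) v ≠ 0)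
    (f : K[X]) :
    aeval P (f.comp (g₀ * (X - C c) ^ 2) * (C (-c) * g₀ * (X - C c)) ^ ε) v ≠
      aeval P ((X - C c) ^ (k - 1)) v := by
  intro heq
  set l : K[X] := X - C c with hl
  have hkill : ∀ m, k ≤ m → ∀ q : K[X], aeval P (q * l ^ m) v = 0 := by
    intro m hm q
    obtain ⟨d, rfl⟩ := Nat.exists_eq_add_of_le hm
    rw [pow_add, mul_comm (l ^ k), ← mul_assoc, aeval_mul_apply, hv, map_zero]
  have hR : ∀ (m : ℕ) (a : K), a ≠ 0 → ∀ x, x ≠ 0 → aeval P (C a * g₀ ^ m) x ≠ 0 := by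
    intro m a ha x hx h0
    rw [aeval_mul_apply, aeval_C, Module.algebraMap_end_apply, smul_eq_zero] at h0
    have h1 := h0.resolve_left ha
    clear h0
    induction m with
    | zero => exact hx (by simpa using h1)
    | succ m ih =>
      apply ih
      rw [pow_succ', aeval_mul_apply, ← hg₀] at h1
      rw [← h.apply_inv (aeval P (g₀ ^ m) x), h1, map_zero]
  have hc0 : c ≠ 0 := by
    rintro rfl
    simp at hc
  -- the polynomial `f` is divisible by every power of `X`
  have claim : ∀ i, ∃ q : K[X], aeval P (q.comp (g₀ * l ^ 2) * (g₀ * l ^ 2) ^ i *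
      (C (-c) * g₀ * l) ^ ε) v = aeval P (l ^ (k - 1)) v := by
    intro i
    induction i with
    | zero => exact ⟨f, by simpa using heq⟩
    | succ i ih =>
      obtain ⟨q, hq⟩ := ih
      by_cases hlt : k ≤ 2 * i + ε
      · exfalso
        apply hv'
        rw [← hq]
        have : q.comp (g₀ * l ^ 2) * (g₀ * l ^ 2) ^ i * (C (-c) * g₀ * l) ^ ε =
            (q.comp (g₀ * l ^ 2) * g₀ ^ i * (C (-c) * g₀) ^ ε) * l ^ (2 * i + ε) := by
          rw [mul_pow, mul_pow _ l, pow_add, pow_mul]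
          ring
        rw [this]
        exact hkill _ hlt _
      · refine ⟨q.divX, ?_⟩
        have h0 : q.coeff 0 = 0 := by
          by_contra hne
          -- multiply by the power of `P - c` that moves the left side into the socle
          obtain ⟨d, hd⟩ : ∃ d, k - 1 = 2 * i + ε + d := Nat.exists_eq_add_of_le (by omega)
          have h1 := congrArg (aeval P (l ^ d)) hq
          rw [← aeval_mul_apply, ← aeval_mul_apply, ← pow_add] at h1
          have h2 := hkill (d + (k - 1)) (by omega) 1
          rw [one_mul] at h2
          rw [h2] at h1
          have e : l ^ d * (q.comp (g₀ * l ^ 2) * (g₀ * l ^ 2) ^ i * (C (-c) * g₀ * l) ^ ε) =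
              (q.divX.comp (g₀ * l ^ 2) * g₀ ^ (i + 1) * (C (-c) * g₀) ^ ε * l) * l ^ (k - 1 + 1) +
                C (q.coeff 0 * (-c) ^ ε) * g₀ ^ (i + ε) * l ^ (k - 1) := by
            conv_lhs => rw [← divX_mul_X_add q]
            rw [hd]
            simp only [add_comp, mul_comp, X_comp, C_comp, mul_pow, C_mul, C_pow]
            ring_nf
          rw [e, map_add, LinearMap.add_apply, hkill _ (by omega), zero_add,
            aeval_mul_apply] at h1
          exact hR _ _ (mul_ne_zero hne (pow_ne_zero _ (neg_ne_zero.2 hc0))) _ hv' h1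
        rw [← hq]
        conv_rhs => rw [← divX_mul_X_add q, h0]
        congr 2
        simp only [add_comp, mul_comp, X_comp, C_0, zero_comp]
        ring
  obtain ⟨q, hq⟩ := claim k
  apply hv'
  rw [← hq]
  have : q.comp (g₀ * l ^ 2) * (g₀ * l ^ 2) ^ k * (C (-c) * g₀ * l) ^ ε =
      (q.comp (g₀ * l ^ 2) * g₀ ^ k * (C (-c) * g₀) ^ ε) * l ^ (2 * k + ε) := by
    rw [mul_pow, mul_pow _ l, pow_add, pow_mul]
    ring
  rw [this]
  exact hkill _ (by omega) _

/-- The exceptional components: `P` has the eigenvalue `c = ± 1`, and no cyclic subspace of the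
`c`-primary component is nondegenerate.  Then two cyclic subspaces in duality split off:
`Z = K[P] v + K[P] y` contains the adapted subspace `U = K[D] v + K[D] (P - c) ^ ε y`, where
`D = P + P⁻¹ - 2 c` and `ε` is the parity of `k`. -/
lemma exists_isAdapted_exceptional [FiniteDimensional K V] (h : SympIsom w P R)
    {c : K} (hc : c * c = 1) {k : ℕ} (hk0 : k ≠ 0)
    {v : V} (hv : aeval P ((X - C c) ^ k) v = 0) (hv' : aeval P ((X - C c) ^ (k - 1)) v ≠ 0)
    (halt : ∀ z, aeval P ((X - C c) ^ k) z = 0 → w (aeval P ((X - C c) ^ (k - 1)) z) z = 0)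
    (hproj : ∀ y, ∃ y', aeval P ((X - C c) ^ k) y' = 0 ∧
      ∀ x, aeval P ((X - C c) ^ k) x = 0 → w x y' = w x y) :
    ∃ Z U : Submodule K V, Z ≠ ⊥ ∧ (∀ z ∈ Z, P z ∈ Z) ∧
      (∀ x ∈ Z, (∀ y ∈ Z, w x y = 0) → x = 0) ∧ IsAdapted w P Z U := by
  obtain ⟨g₀, hg₀⟩ := h.exists_inv_eq_aeval
  obtain ⟨j, ε, hk, hε⟩ : ∃ j ε, k = 2 * j + ε ∧ ε ≤ 1 := ⟨k / 2, k % 2, by omega, by omega⟩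
  set l : K[X] := X - C c with hl
  have hlP : ∀ x, aeval P l x = P x - c • x := fun x => by simp [hl]
  have hlR : ∀ x, aeval R l x = R x - c • x := fun x => by simp [hl]
  -- `D = P + P⁻¹ - 2 c`
  set D : Module.End K V := aeval P (g₀ * l ^ 2) with hD
  have hDT : ∀ x, D x = (P + R) x - (2 * c) • x := by
    intro x
    rw [hD, aeval_mul_apply, ← hg₀, pow_two, aeval_mul_apply, hlP, hlP]
    simp only [map_sub, map_smul, h.inv_apply, LinearMap.add_apply, two_mul, add_smul, smul_sub,
      smul_smul, hc, one_smul]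
    abel
  have hDadj : ∀ x y, w (D x) y = w x (D y) := by
    intro x y
    simp only [hDT, map_sub, map_smul, LinearMap.add_apply, LinearMap.sub_apply, map_add,
      LinearMap.smul_apply, h.adj, h.adj']
    ring
  have hDT' : D = aeval (P + R) (X - C (2 * c)) := by
    ext x
    rw [hDT]
    simp only [map_sub, aeval_X, aeval_C, LinearMap.sub_apply, Module.algebraMap_end_apply]
  have hDcomp : ∀ f : K[X], aeval D f = aeval (P + R) (f.comp (X - C (2 * c))) := fun f => by
    rw [aeval_comp, ← hDT']
  have hDcompP : ∀ f : K[X], aeval D f = aeval P (f.comp (g₀ * l ^ 2)) := fun f => by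
    rw [aeval_comp, ← hD]
  have hlstar : aeval R l = aeval P (C (-c) * g₀ * l) := by
    ext x
    rw [hlR, aeval_mul_apply, aeval_mul_apply, ← hg₀, hlP]
    rw [aeval_C, Module.algebraMap_end_apply, map_sub, map_smul, h.inv_apply, smul_sub, smul_smul,
      neg_mul, hc, neg_smul, neg_smul, one_smul]
    abel
  have hlstar' : aeval R (l ^ ε) = aeval P ((C (-c) * g₀ * l) ^ ε) := by
    rw [map_pow, hlstar, map_pow]
  -- a vector `y` dual to the socle of `K[P] v` and orthogonal to `K[D] (P⁻¹ - c) ^ ε v`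
  obtain ⟨y, hy, hyY, hvy⟩ : ∃ y, aeval P (l ^ k) y = 0 ∧
      (∀ f, w (aeval D f v) (aeval P (l ^ ε) y) = 0) ∧ w (aeval P (l ^ (k - 1)) v) y ≠ 0 := by
    have hnot : aeval P (l ^ (k - 1)) v ∉ cyclicSub D (aeval R (l ^ ε) v) := by
      intro hmem
      obtain ⟨f, hf⟩ := (mem_cyclicSub D).1 hmem
      refine h.socle_ne hg₀ hc hk hv hv' f ?_
      rw [← hf, hDcompP, hlstar', aeval_mul_apply]
    have hnd : w.Nondegenerate :=
      ⟨fun x hx => h.nondeg x hx, fun y hy => h.nondeg_right y hy⟩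
    have hrefl : w.IsRefl := fun x y hxy => by rw [h.skew, hxy, neg_zero]
    rw [← LinearMap.BilinForm.orthogonal_orthogonal hnd hrefl
      (cyclicSub D (aeval R (l ^ ε) v)), LinearMap.BilinForm.mem_orthogonal_iff] at hnot
    push Not at hnot
    obtain ⟨y₀, hy₀, hne⟩ := hnot
    rw [LinearMap.BilinForm.mem_orthogonal_iff] at hy₀
    obtain ⟨y, hy, hyy⟩ := hproj y₀
    refine ⟨y, hy, ?_, ?_⟩
    · intro f
      rw [← h.adj_poly', hlstar', hDcompP, aeval_comm_apply, hyy, ← hDcompP, ← hlstar']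
      · exact hy₀ _ (aeval_mem_cyclicSub D f _)
      · rw [aeval_comm_apply, aeval_comm_apply P (l ^ k), hv, map_zero, map_zero]
    · rw [hyy, h.skew]
      · exact neg_ne_zero.2 hne
      · rw [aeval_comm_apply, hv, map_zero]
  have hyv : w (aeval P (l ^ (k - 1)) y) v ≠ 0 := by
    have h0 := halt (v + y) (by rw [map_add, hv, hy, add_zero])
    have h1 := halt v hv
    have h2 := halt y hy
    simp only [map_add, LinearMap.add_apply, h1, h2, zero_add, add_zero] at h0
    intro h3
    rw [h3, zero_add] at h0
    exact hvy h0
  set Z := cyclicSub P v ⊔ cyclicSub P y with hZdef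
  have hvZ : v ∈ Z := Submodule.mem_sup_left (self_mem_cyclicSub P v)
  have hyZ : y ∈ Z := Submodule.mem_sup_right (self_mem_cyclicSub P y)
  have hZmem : ∀ z, z ∈ Z ↔ ∃ f g : K[X], z = aeval P f v + aeval P g y := by
    intro z
    rw [hZdef, Submodule.mem_sup]
    constructor
    · rintro ⟨a, ha, b, hb, rfl⟩
      obtain ⟨f, rfl⟩ := (mem_cyclicSub P).1 ha
      obtain ⟨g, rfl⟩ := (mem_cyclicSub P).1 hb
      exact ⟨f, g, rfl⟩
    · rintro ⟨f, g, rfl⟩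
      exact ⟨_, aeval_mem_cyclicSub P f v, _, aeval_mem_cyclicSub P g y, rfl⟩
  have hZP : ∀ z ∈ Z, P z ∈ Z := by
    intro z hz
    obtain ⟨f, g, rfl⟩ := (hZmem z).1 hz
    exact (hZmem _).2 ⟨X * f, X * g, by simp [Module.End.mul_apply]⟩
  have hZR : ∀ z ∈ Z, R z ∈ Z := fun z hz => h.inv_mem hZP hz
  have hZkill : ∀ z ∈ Z, aeval P (l ^ k) z = 0 := by
    intro z hz
    obtain ⟨f, g, rfl⟩ := (hZmem z).1 hz
    rw [map_add, aeval_comm_apply, hv, aeval_comm_apply P (l ^ k), hy, map_zero, map_zero,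
      add_zero]
  have hZnd : ∀ x ∈ Z, (∀ y ∈ Z, w x y = 0) → x = 0 := by
    intro x hx hrad
    -- peel off the coefficients of the expansion of `x` in powers of `P - c`
    have claim : ∀ i ≤ k, ∃ f g : K[X], x = aeval P (f * l ^ i) v + aeval P (g * l ^ i) y := by
      intro i
      induction i with
      | zero => intro _; simpa using (hZmem x).1 hx
      | succ i ih =>
        intro hi
        obtain ⟨f, g, hfg⟩ := ih (by omega)
        obtain ⟨f₁, hf₁⟩ : ∃ f₁, f = f₁ * l + C (f.eval c) := by
          obtain ⟨q, hq⟩ := X_sub_C_dvd_sub_C_eval (a := c) (p := f)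
          exact ⟨q, by rw [hl]; linear_combination hq⟩
        obtain ⟨g₁, hg₁⟩ : ∃ g₁, g = g₁ * l + C (g.eval c) := by
          obtain ⟨q, hq⟩ := X_sub_C_dvd_sub_C_eval (a := c) (p := g)
          exact ⟨q, by rw [hl]; linear_combination hq⟩
        have e1 : ∀ (q q₁ : K[X]) (a : K), q = q₁ * l + C a → ∀ u, aeval P (l ^ k) u = 0 →
            aeval P (l ^ (k - 1 - i)) (aeval P (q * l ^ i) u) = a • aeval P (l ^ (k - 1)) u := by
          intro q q₁ a hq u hu
          have : l ^ (k - 1 - i) * (q * l ^ i) = q₁ * l ^ k + C a * l ^ (k - 1) := by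
            obtain ⟨d, hd⟩ := Nat.exists_eq_add_of_le hi
            have h1 : k - 1 - i = d := by omega
            have h2 : k - 1 = i + d := by omega
            rw [h1, h2, hq, hd]
            ring
          rw [← aeval_mul_apply, this, map_add, LinearMap.add_apply, aeval_mul_apply, hu,
            map_zero, zero_add, aeval_mul_apply, aeval_C, Module.algebraMap_end_apply]
        have e2 : ∀ u ∈ Z, f.eval c * w (aeval P (l ^ (k - 1)) v) u +
            g.eval c * w (aeval P (l ^ (k - 1)) y) u = 0 := by
          intro u hu
          have := hrad _ (aeval_apply_mem hZR (l ^ (k - 1 - i)) hu)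
          rw [← h.adj_poly, hfg, map_add, e1 f f₁ _ hf₁ v hv, e1 g g₁ _ hg₁ y hy] at this
          simpa using this
        have hg0 : g.eval c = 0 := by
          have := e2 v hvZ
          rw [halt v hv, mul_zero, zero_add] at this
          exact (mul_eq_zero.1 this).resolve_right hyv
        have hf0 : f.eval c = 0 := by
          have := e2 y hyZ
          rw [halt y hy, mul_zero, add_zero] at this
          exact (mul_eq_zero.1 this).resolve_right hvy
        refine ⟨f₁, g₁, ?_⟩
        rw [hfg, hf₁, hg₁, hf0, hg0, C_0, add_zero, add_zero, pow_succ', mul_assoc, mul_assoc]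
    obtain ⟨f, g, hfg⟩ := claim k le_rfl
    rw [hfg, aeval_mul_apply, aeval_mul_apply, hv, hy, map_zero, map_zero, add_zero]
  have hDZ : ∀ z ∈ Z, D z ∈ Z := fun z hz => aeval_apply_mem hZP _ hz
  set U := cyclicSub D v ⊔ cyclicSub D (aeval P (l ^ ε) y) with hUdef
  have hDU : ∀ u ∈ U, D u ∈ U := by
    intro u hu
    obtain ⟨a, ha, b, hb, rfl⟩ := Submodule.mem_sup.1 hu
    rw [map_add]
    exact Submodule.add_mem_sup (apply_mem_cyclicSub D ha) (apply_mem_cyclicSub D hb)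
  have hTU : ∀ u ∈ U, (P + R) u ∈ U := by
    intro u hu
    have := U.add_mem (hDU u hu) (U.smul_mem (2 * c) hu)
    rwa [hDT, sub_add_cancel] at this
  have hself : ∀ (z : V) (f g : K[X]), w (aeval D f z) (aeval D g z) = 0 := by
    intro z f g
    rw [aeval_adj hDadj, ← aeval_mul_apply, hDcomp, h.sum_isotropic]
  have hiso : ∀ x ∈ U, ∀ y ∈ U, w x y = 0 := by
    have cross : ∀ f g : K[X], w (aeval D f v) (aeval D g (aeval P (l ^ ε) y)) = 0 := by
      intro f g
      rw [← aeval_adj hDadj, ← aeval_mul_apply, hyY]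
    intro x hx x' hx'
    obtain ⟨a, ha, b, hb, rfl⟩ := Submodule.mem_sup.1 hx
    obtain ⟨a', ha', b', hb', rfl⟩ := Submodule.mem_sup.1 hx'
    obtain ⟨f, rfl⟩ := (mem_cyclicSub D).1 ha
    obtain ⟨g, rfl⟩ := (mem_cyclicSub D).1 hb
    obtain ⟨f', rfl⟩ := (mem_cyclicSub D).1 ha'
    obtain ⟨g', rfl⟩ := (mem_cyclicSub D).1 hb'
    simp only [map_add, LinearMap.add_apply, hself, cross,
      h.skew (aeval D g (aeval P (l ^ ε) y)) (aeval D f' v), neg_zero, add_zero]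
  have hvU : v ∈ U := Submodule.mem_sup_left (self_mem_cyclicSub D v)
  have hyU : aeval P (l ^ ε) y ∈ U := Submodule.mem_sup_right (self_mem_cyclicSub D _)
  have hS : ∀ x ∈ U ⊔ U.map P, P x ∈ U ⊔ U.map P := fun x hx => h.apply_mem_sup hTU hx
  have hv0 : v ≠ 0 := by
    rintro rfl
    simp at hv'
  have hRl : ∀ x, aeval P l x = 0 → R x = c • x := by
    intro x hx
    rw [hlP, sub_eq_zero] at hx
    have := congrArg (fun x => c • R x) hx
    simp only [h.inv_apply, map_smul, smul_smul, hc, one_smul] at this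
    exact this.symm
  have hinv : ∀ a : V, P a = c • a → (∀ u ∈ U, P u ∈ U) → (∀ u ∈ U, ∃ t : K, u = t • a) →
      ∀ z ∈ Z, P (P z) = z := by
    intro a hPa _ hua z hz
    have h1 : ∀ u ∈ U, aeval P l u = 0 := by
      intro u hu
      obtain ⟨t, rfl⟩ := hua u hu
      rw [hlP, map_smul, hPa, smul_comm, sub_self]
    have h2 : k = 1 := by
      by_contra hk1
      apply hv'
      obtain ⟨d, hd⟩ : ∃ d, k - 1 = d + 1 := ⟨k - 2, by omega⟩
      rw [hd, pow_succ, aeval_mul_apply, h1 v hvU, map_zero]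
    have h3 := hZkill z hz
    rw [h2, pow_one, hlP, sub_eq_zero] at h3
    rw [h3, map_smul, h3, smul_smul, hc, one_smul]
  refine ⟨Z, U, fun hbot => hv0 ?_, hZP, hZnd, ?_⟩
  · rw [hbot] at hvZ
    simpa using hvZ
  have hUZ : U ≤ Z := sup_le (cyclicSub_le hDZ hvZ)
    (cyclicSub_le hDZ (aeval_apply_mem hZP _ hyZ))
  -- for even `k` already `Z = U + P U`; for odd `k` the vector `y` itself is missing in `U + P U`,
  -- and it is detected by the socle vector `D ^ j v`
  rcases Nat.le_one_iff_eq_zero_or_eq_one.1 hε with rfl | rfl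
  · rw [pow_zero, map_one, Module.End.one_apply] at hyU
    refine h.isAdapted_of_span hZP hZnd hUZ hiso hTU (c := c) hc (a := 0) (v := 0)
      U.zero_mem (by simp) ?_ (fun _ => rfl) (hinv 0 (by simp))
    exact (sup_le (cyclicSub_le hS (Submodule.mem_sup_left hvU))
      (cyclicSub_le hS (Submodule.mem_sup_left hyU))).trans le_sup_left
  · rw [pow_one] at hyU
    -- the socle vector of `K[D] v`
    have ha : ∀ m : ℕ, aeval D (X ^ m : K[X]) v = aeval P (g₀ ^ m) (aeval P (l ^ (2 * m)) v) := by
      intro m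
      rw [hDcompP, ← aeval_mul_apply, X_pow_comp, mul_pow, ← pow_mul]
    have hk1 : k - 1 = 2 * j := by omega
    have hPa : aeval P l (aeval D (X ^ j : K[X]) v) = 0 := by
      rw [ha, aeval_comm_apply, ← aeval_mul_apply P l, ← pow_succ', ← hk, hv, map_zero]
    have hRs : ∀ m : ℕ, aeval P (g₀ ^ m) (aeval P (l ^ (k - 1)) v) =
        c ^ m • aeval P (l ^ (k - 1)) v := by
      intro m
      have h1 : aeval P l (aeval P (l ^ (k - 1)) v) = 0 := by
        rw [← aeval_mul_apply, ← pow_succ', Nat.sub_add_cancel (by omega), hv]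
      induction m with
      | zero => simp
      | succ m ih => rw [pow_succ', aeval_mul_apply, ih, ← hg₀, map_smul, hRl _ h1, smul_smul,
          ← pow_succ]
    have hc0 : c ≠ 0 := by
      rintro rfl
      simp at hc
    have hPa' : P (aeval D (X ^ j : K[X]) v) = c • aeval D (X ^ j : K[X]) v := by
      rwa [hlP, sub_eq_zero] at hPa
    refine h.isAdapted_of_span hZP hZnd hUZ hiso hTU (c := c) hc
      (a := aeval D (X ^ j : K[X]) v) (v := y) (aeval_apply_mem hDU _ hvU) hPa' ?_ ?_ (hinv _ hPa')
    · refine sup_le ((cyclicSub_le hS (Submodule.mem_sup_left hvU)).trans le_sup_left) ?_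
      intro x hx
      obtain ⟨f, rfl⟩ := (mem_cyclicSub P).1 hx
      obtain ⟨q, hq⟩ := X_sub_C_dvd_sub_C_eval (a := c) (p := f)
      have h1 : f = q * l + C (f.eval c) := by rw [hl]; linear_combination hq
      rw [h1, map_add, LinearMap.add_apply, aeval_mul_apply, aeval_C,
        Module.algebraMap_end_apply]
      exact Submodule.add_mem_sup (aeval_apply_mem hS _ (Submodule.mem_sup_left hyU))
        (Submodule.smul_mem _ _ (Submodule.mem_span_singleton_self y))
    · intro h0
      rw [ha, ← hk1, hRs, map_smul, LinearMap.smul_apply, smul_eq_mul, mul_eq_zero] at h0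
      exact absurd (h0.resolve_left (pow_ne_zero _ hc0)) hvy

end SympIsom

/-! ### Existence of adapted Lagrangian subspaces -/

namespace SympIsom

variable {K V : Type*} [Field K] [AddCommGroup V] [Module K V]
  {w : LinearMap.BilinForm K V} {P R : Module.End K V}

/-- Every isometry of a nonzero symplectic space has a nonzero invariant nondegenerate subspace
that contains an adapted subspace. -/
lemma exists_isAdapted_summand [FiniteDimensional K V] [Nontrivial V] (h : SympIsom w P R) :
    ∃ Z U : Submodule K V, Z ≠ ⊥ ∧ (∀ z ∈ Z, P z ∈ Z) ∧
      (∀ x ∈ Z, (∀ y ∈ Z, w x y = 0) → x = 0) ∧ IsAdapted w P Z U := by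
  obtain ⟨g₀, hg₀⟩ := h.exists_inv_eq_aeval
  have hcomp : ∀ f : K[X], aeval P (f.comp g₀) = aeval R f := fun f => by
    rw [aeval_comp, ← hg₀]
  have hint : IsIntegral K P := Algebra.IsIntegral.isIntegral P
  obtain ⟨p, hp, hpm⟩ := WfDvdMonoid.exists_irreducible_factor (minpoly.not_isUnit K P)
    (minpoly.ne_zero hint)
  obtain ⟨k, q, hpq, hm⟩ := WfDvdMonoid.max_power_factor (minpoly.ne_zero hint) hp
  have hk0 : k ≠ 0 := by
    rintro rfl
    rw [pow_zero, one_mul] at hm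
    exact hpq (hm ▸ hpm)
  have hmP : aeval P (p ^ k * q) = 0 := by rw [← hm, minpoly.aeval]
  have hmR : aeval R (p ^ k * q) = 0 := by
    ext y
    exact h.nondeg_right _ fun x => by rw [← h.adj_poly, hmP, LinearMap.zero_apply, map_zero,
      LinearMap.zero_apply]
  -- a vector of full order in the `p`-primary component
  obtain ⟨v, hv, hv'⟩ : ∃ v, aeval P (p ^ k) v = 0 ∧ aeval P (p ^ (k - 1)) v ≠ 0 := by
    have h1 : aeval P (p ^ (k - 1) * q) ≠ 0 := by
      intro h0
      obtain ⟨r, hr⟩ := minpoly.dvd K P h0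
      have hq0 : q ≠ 0 := by
        rintro rfl
        exact hpq (dvd_zero p)
      obtain ⟨j, rfl⟩ := Nat.exists_eq_succ_of_ne_zero hk0
      rw [hm, Nat.succ_sub_one, Nat.succ_eq_add_one, pow_succ] at hr
      have h2 : p ^ j * q * (p * r) = p ^ j * q * 1 := by linear_combination -hr
      exact hp.not_isUnit (IsUnit.of_mul_eq_one _
        (mul_left_cancel₀ (mul_ne_zero (pow_ne_zero _ hp.ne_zero) hq0) h2))
    obtain ⟨y, hy⟩ : ∃ y, aeval P (p ^ (k - 1) * q) y ≠ 0 := by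
      by_contra hcon
      push Not at hcon
      exact h1 (LinearMap.ext hcon)
    refine ⟨aeval P q y, ?_, ?_⟩
    · rw [← aeval_mul_apply, hmP, LinearMap.zero_apply]
    · rwa [← aeval_mul_apply]
  obtain ⟨a, b, hab⟩ : IsCoprime (p ^ k) q := IsCoprime.pow_left (hp.coprime_iff_not_dvd.2 hpq)
  -- projection to the dual primary component
  have hproj : ∀ y, ∃ y', aeval R (p ^ k) y' = 0 ∧
      ∀ x, aeval P (p ^ k) x = 0 → w x y' = w x y := by
    intro y
    refine ⟨aeval R (b * q) y, ?_, ?_⟩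
    · rw [← aeval_mul_apply, show p ^ k * (b * q) = b * (p ^ k * q) by ring, aeval_mul_apply,
        hmR, LinearMap.zero_apply, map_zero]
    · intro x hx
      have h1 : aeval R (a * p ^ k) y + aeval R (b * q) y = y := by
        rw [← LinearMap.add_apply, ← map_add, hab, map_one, Module.End.one_apply]
      have h2 : w x (aeval R (a * p ^ k) y) = 0 := by
        rw [← h.adj_poly, aeval_mul_apply, hx, map_zero, map_zero, LinearMap.zero_apply]
      conv_rhs => rw [← h1, map_add, h2, zero_add]
  obtain ⟨y, hy, hvy⟩ : ∃ y, aeval R (p ^ k) y = 0 ∧ w (aeval P (p ^ (k - 1)) v) y ≠ 0 := by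
    obtain ⟨y, hy⟩ : ∃ y, w (aeval P (p ^ (k - 1)) v) y ≠ 0 := by
      by_contra hcon
      push Not at hcon
      exact hv' (h.nondeg _ hcon)
    obtain ⟨y', hy', hyy⟩ := hproj y
    refine ⟨y', hy', ?_⟩
    rwa [hyy]
    rw [aeval_comm_apply, hv, map_zero]
  -- it suffices to find a nondegenerate cyclic subspace
  have hcyc : ∀ z, z ≠ 0 → (∀ x ∈ cyclicSub P z, (∀ y ∈ cyclicSub P z, w x y = 0) → x = 0) →
      ∃ Z U : Submodule K V, Z ≠ ⊥ ∧ (∀ z ∈ Z, P z ∈ Z) ∧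
      (∀ x ∈ Z, (∀ y ∈ Z, w x y = 0) → x = 0) ∧ IsAdapted w P Z U := by
    intro z hz0 hz
    refine ⟨_, _, fun hbot => hz0 ?_, fun x hx => apply_mem_cyclicSub P hx, hz,
      h.isAdapted_cyclic z hz⟩
    have := self_mem_cyclicSub P z
    rwa [hbot, Submodule.mem_bot] at this
  by_cases hdvd : p ∣ p.comp g₀
  swap
  · obtain ⟨z, hz0, hz⟩ := h.exists_isAdapted_of_isCoprime hg₀ hp
      (hp.coprime_iff_not_dvd.2 hdvd) hv hy hvy
    exact hcyc z hz0 hz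
  -- now the primary component is self-dual
  obtain ⟨r, hr⟩ := hdvd
  have hself : ∀ x, aeval R (p ^ k) x = 0 → aeval P (p ^ k) x = 0 := by
    have h1 : ∀ x, aeval P p x = aeval R (r * p) x := by
      intro x
      rw [← sub_eq_zero]
      apply h.nondeg_right
      intro t
      rw [map_sub, ← h.adj_poly', ← h.adj_poly, ← hcomp, hr, mul_comm, sub_self]
    have h2 : aeval P p = aeval R (r * p) := LinearMap.ext h1
    intro x hx
    rw [map_pow, h2, ← map_pow, mul_pow, aeval_mul_apply, hx, map_zero]
  -- if no primary cyclic subspace is nondegenerate, then `p` divides `X - 1` or `X + 1`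
  by_cases hex : ∃ z, aeval P (p ^ k) z = 0 ∧ ∃ u ∈ cyclicSub P z,
      w (aeval P (p ^ (k - 1)) z) u ≠ 0
  · obtain ⟨z, hz, u, hu, hzu⟩ := hex
    refine hcyc z ?_ (h.cyclic_nondeg hp hz hu hzu)
    rintro rfl
    simp at hzu
  push Not at hex
  have hRstab : ∀ (f : K[X]) (x : V), aeval P (p ^ k) x = 0 →
      aeval P (p ^ k) (aeval R f x) = 0 := by
    intro f x hx
    rw [← hcomp, aeval_comm_apply, hx, map_zero]
  have hX : p ∣ X ^ 2 - 1 := h.dvd_X_sq_sub_one hp hk0 hex hRstab hv (hself y hy) hvy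
  obtain ⟨c, hc, hpc⟩ : ∃ c : K, c * c = 1 ∧ p ∣ X - C c := by
    rw [show (X ^ 2 - 1 : K[X]) = (X - C 1) * (X - C (-1)) by
      simp only [C_neg, C_1]; ring] at hX
    rcases hp.prime.dvd_or_dvd hX with h1 | h1
    · exact ⟨1, one_mul 1, h1⟩
    · exact ⟨-1, by ring, h1⟩
  have hass : Associated p (X - C c) := hp.associated_of_dvd (irreducible_X_sub_C c) hpc
  have hpow : ∀ m x, aeval P ((X - C c) ^ m) x = 0 ↔ aeval P (p ^ m) x = 0 := by
    intro m x
    constructor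
    · intro h0
      obtain ⟨t, ht⟩ := (hass.pow_pow (n := m)).symm.dvd
      rw [ht, mul_comm, aeval_mul_apply, h0, map_zero]
    · intro h0
      obtain ⟨t, ht⟩ := (hass.pow_pow (n := m)).dvd
      rw [ht, mul_comm, aeval_mul_apply, h0, map_zero]
  refine h.exists_isAdapted_exceptional hc hk0 ((hpow _ _).2 hv)
    (fun h0 => hv' ((hpow _ _).1 h0)) ?_ ?_
  · intro z hz
    obtain ⟨t, ht⟩ := (hass.pow_pow (n := k - 1)).dvd
    rw [ht, mul_comm, aeval_mul_apply, h.adj_poly]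
    refine hex z ((hpow _ _).1 hz) _ ?_
    rw [← hcomp]
    exact aeval_mem_cyclicSub P _ z
  · intro y
    obtain ⟨y', hy', hyy⟩ := hproj y
    exact ⟨y', (hpow _ _).2 (hself y' hy'), fun x hx => hyy x ((hpow _ _).1 hx)⟩

/-- Every isometry of a symplectic space has an adapted Lagrangian subspace: split off a
nondegenerate invariant subspace with an adapted subspace, and continue in its orthogonal
complement. -/
theorem exists_isAdapted_top {K : Type*} [Field K] (n : ℕ) :
    ∀ {V : Type*} [AddCommGroup V] [Module K V] [FiniteDimensional K V]
      {w : LinearMap.BilinForm K V} {P R : Module.End K V}, Module.finrank K V = n →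
      SympIsom w P R → ∃ U : Submodule K V, IsAdapted w P ⊤ U := by
  induction n using Nat.strong_induction_on with
  | _ n ih =>
  intro V _ _ _ w P R hn h
  rcases subsingleton_or_nontrivial V with hV | hV
  · exact ⟨⊤, le_rfl, fun x _ y _ => by rw [Subsingleton.elim x 0]; simp, fun _ _ _ => trivial,
      fun x _ y _ => by rw [Subsingleton.elim x y], fun u _ _ => ⟨0, trivial, 0, trivial,
      Subsingleton.elim _ _, Subsingleton.elim _ _, Subsingleton.elim _ _⟩,
      fun _ z _ => Subsingleton.elim _ _⟩
  obtain ⟨Z, U, hZ0, hZP, hZnd, hU⟩ := h.exists_isAdapted_summand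
  have hrefl : w.IsRefl := fun x y hxy => by rw [h.skew, hxy, neg_zero]
  have hZR : ∀ z ∈ Z, R z ∈ Z := fun z hz => h.inv_mem hZP hz
  set Y := w.orthogonal Z with hY
  have hYmem : ∀ y, y ∈ Y ↔ ∀ z ∈ Z, w z y = 0 := fun y =>
    LinearMap.BilinForm.mem_orthogonal_iff
  have hcompl : IsCompl Z Y := by
    apply LinearMap.BilinForm.isCompl_orthogonal_of_restrict_nondegenerate hrefl
    have h1 : ∀ x ∈ Z, (∀ y ∈ Z, w y x = 0) → x = 0 := fun x hx hxy =>
      hZnd x hx fun y hy => by rw [h.skew, hxy y hy, neg_zero]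
    exact ⟨fun x hx => Subtype.ext (hZnd x x.2 fun y hy => hx ⟨y, hy⟩),
      fun x hx => Subtype.ext (h1 x x.2 fun y hy => hx ⟨y, hy⟩)⟩
  have hYP : ∀ y ∈ Y, P y ∈ Y := fun y hy => (hYmem _).2 fun z hz => by
    rw [← h.adj']; exact (hYmem y).1 hy _ (hZR z hz)
  have hYR : ∀ y ∈ Y, R y ∈ Y := fun y hy => h.inv_mem hYP hy
  have hsum : ∀ v : V, ∃ z ∈ Z, ∃ y ∈ Y, z + y = v := fun v =>
    Submodule.mem_sup.1 (hcompl.sup_eq_top ▸ Submodule.mem_top (x := v))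
  have hZY : ∀ z ∈ Z, ∀ y ∈ Y, w z y = 0 := fun z hz y hy => (hYmem y).1 hy z hz
  have hYZ : ∀ z ∈ Z, ∀ y ∈ Y, w y z = 0 := fun z hz y hy => by rw [h.skew, hZY z hz y hy, neg_zero]
  have huniq : ∀ z ∈ Z, ∀ y ∈ Y, ∀ z' ∈ Z, ∀ y' ∈ Y, z + y = z' + y' → z = z' ∧ y = y' := by
    intro z hz y hy z' hz' y' hy' heq
    have h1 : z - z' = y' - y := by
      rw [sub_eq_sub_iff_add_eq_add, heq, add_comm]
    have h2 : z - z' = 0 := by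
      have : z - z' ∈ Z ⊓ Y := ⟨Z.sub_mem hz hz', h1 ▸ Y.sub_mem hy' hy⟩
      rwa [hcompl.inf_eq_bot, Submodule.mem_bot] at this
    exact ⟨sub_eq_zero.1 h2, (sub_eq_zero.1 (h1 ▸ h2)).symm⟩
  have hY' : SympIsom (w.restrict Y) (P.restrict hYP) (R.restrict hYR) := by
    refine ⟨fun x => h.alt x, ?_, ?_, ?_, fun x y => h.adj x y⟩
    · intro x hx
      apply Subtype.ext
      apply h.nondeg
      intro v
      obtain ⟨z, hz, y, hy, rfl⟩ := hsum v
      rw [map_add, hYZ z hz x x.2, zero_add]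
      exact hx ⟨y, hy⟩
    · ext x
      exact h.apply_inv x
    · ext x
      exact h.inv_apply x
  have hlt : Module.finrank K Y < n := by
    rw [← hn, ← Submodule.finrank_add_eq_of_isCompl hcompl]
    have : 0 < Module.finrank K Z := Module.finrank_pos_iff.2
      (Submodule.nontrivial_iff_ne_bot.2 hZ0)
    omega
  obtain ⟨U', hU'⟩ := ih _ hlt rfl hY'
  have hmem : ∀ x, x ∈ U ⊔ U'.map Y.subtype ↔ ∃ z ∈ U, ∃ y : Y, y ∈ U' ∧ x = z + y := by
    intro x
    rw [Submodule.mem_sup]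
    constructor
    · rintro ⟨z, hz, _, ⟨y, hy, rfl⟩, rfl⟩
      exact ⟨z, hz, y, hy, rfl⟩
    · rintro ⟨z, hz, y, hy, rfl⟩
      exact ⟨z, hz, y, ⟨y, hy, rfl⟩, rfl⟩
  -- invariance passes to the two summands
  have hsplit : ∀ z ∈ U, ∀ y : Y, y ∈ U' → P (z + y) ∈ U ⊔ U'.map Y.subtype →
      P z ∈ U ∧ P.restrict hYP y ∈ U' := by
    intro z hz y hy hPx
    obtain ⟨z', hz', y', hy', heq⟩ := (hmem _).1 hPx
    rw [map_add] at heq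
    obtain ⟨h1, h2⟩ := huniq _ (hZP _ (hU.le hz)) _ (hYP _ y.2) _ (hU.le hz') _ y'.2 heq
    refine ⟨h1 ▸ hz', ?_⟩
    have h3 : P.restrict hYP y = y' := Subtype.ext h2
    rwa [h3]
  refine ⟨U ⊔ U'.map Y.subtype, le_top, ?_, ?_, ?_, ?_, ?_⟩
  · intro x hx x' hx'
    obtain ⟨z, hz, y, hy, rfl⟩ := (hmem x).1 hx
    obtain ⟨z', hz', y', hy', rfl⟩ := (hmem x').1 hx'
    have h1 : w (y : V) y' = 0 := hU'.iso y hy y' hy'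
    simp only [map_add, LinearMap.add_apply, hU.iso z hz z' hz', h1,
      hZY z (hU.le hz) y' y'.2, hYZ z' (hU.le hz') y y.2, add_zero]
  · intro v _ hv
    obtain ⟨z, hz, y, hy, rfl⟩ := hsum v
    refine (hmem _).2 ⟨z, ?_, ⟨y, hy⟩, ?_, rfl⟩
    · refine hU.maxl z hz fun u hu => ?_
      have := hv u ((hmem u).2 ⟨u, hu, 0, U'.zero_mem, by simp⟩)
      rwa [map_add, hZY u (hU.le hu) y hy, add_zero] at this
    · refine hU'.maxl _ trivial fun u hu => ?_
      have := hv u ((hmem u).2 ⟨0, U.zero_mem, u, hu, by simp⟩)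
      rwa [map_add, hYZ z hz u u.2, zero_add] at this
  · intro x hx x' hx'
    obtain ⟨z, hz, y, hy, rfl⟩ := (hmem x).1 hx
    obtain ⟨z', hz', y', hy', rfl⟩ := (hmem x').1 hx'
    have h1 : w (y : V) (P y') = w (y' : V) (P y) := hU'.symm y hy y' hy'
    simp only [map_add, LinearMap.add_apply, hU.symm z hz z' hz', h1,
      hZY z (hU.le hz) _ (hYP _ y'.2), hYZ _ (hZP _ (hU.le hz')) y y.2,
      hZY z' (hU.le hz') _ (hYP _ y.2), hYZ _ (hZP _ (hU.le hz)) y' y'.2, add_zero]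
  · intro x hx hPx
    obtain ⟨z, hz, y, hy, rfl⟩ := (hmem x).1 hx
    obtain ⟨h1, h2⟩ := hsplit z hz y hy hPx
    obtain ⟨a, ha, b, hb, e1, e2, e3⟩ := hU.fix z hz h1
    obtain ⟨a', ha', b', hb', e1', e2', e3'⟩ := hU'.fix y hy h2
    refine ⟨a + a', (hmem _).2 ⟨a, ha, a', ha', rfl⟩, b + b', (hmem _).2 ⟨b, hb, b', hb', rfl⟩,
      ?_, ?_, ?_⟩
    · rw [e1, e1', Submodule.coe_add]
      abel
    · have : P a' = a' := congrArg Subtype.val e2'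
      rw [map_add, e2, this]
    · have : P b' = -b' := congrArg Subtype.val e3'
      rw [map_add, e3, this]
      abel
  · intro hinv v _
    obtain ⟨z, hz, y, hy, rfl⟩ := hsum v
    have h1 : P (P z) = z := hU.inv (fun u hu => (hsplit u hu 0 U'.zero_mem
      (hinv _ ((hmem _).2 ⟨u, hu, 0, U'.zero_mem, rfl⟩))).1) z hz
    have h2 : P (P y) = y := congrArg Subtype.val (hU'.inv (fun u hu => (hsplit 0 U.zero_mem u hu
      (hinv _ ((hmem _).2 ⟨0, U.zero_mem, u, hu, rfl⟩))).2) ⟨y, hy⟩ trivial)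
    rw [map_add, map_add, h1, h2]

end SympIsom

/-! ### Symplectic matrices in block form -/

/-- The matrices `M` and `N` are conjugate by a symplectic matrix. -/
def SympConj {ι K : Type*} [Fintype ι] [DecidableEq ι] [Field K]
    (M N : Matrix (ι ⊕ ι) (ι ⊕ ι) K) : Prop :=
  ∃ Q ∈ symplecticGroup ι K, M * Q = Q * N

namespace SympConj

variable {ι K : Type*} [Fintype ι] [DecidableEq ι] [Field K]

lemma trans {M N O : Matrix (ι ⊕ ι) (ι ⊕ ι) K} (h₁ : SympConj M N) (h₂ : SympConj N O) :
    SympConj M O := by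
  obtain ⟨Q, hQ, e₁⟩ := h₁
  obtain ⟨S, hS, e₂⟩ := h₂
  exact ⟨Q * S, mul_mem hQ hS, by rw [← mul_assoc, e₁, mul_assoc, e₂, mul_assoc]⟩

lemma symm {M N : Matrix (ι ⊕ ι) (ι ⊕ ι) K} (h : SympConj M N) :
    SympConj N M := by
  obtain ⟨Q, hQ, e⟩ := h
  set q : symplecticGroup ι K := ⟨Q, hQ⟩
  have h1 : Q * (q⁻¹ : symplecticGroup ι K) = 1 := by
    have := congrArg Subtype.val (mul_inv_cancel q)
    rwa [Submonoid.coe_mul] at this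
  refine ⟨(q⁻¹ : symplecticGroup ι K), (q⁻¹).2, ?_⟩
  calc N * (q⁻¹ : symplecticGroup ι K)
      = (q⁻¹ : symplecticGroup ι K) * (Q * N) * (q⁻¹ : symplecticGroup ι K) := by
        rw [← mul_assoc _ Q, mul_eq_one_comm.1 h1, one_mul]
    _ = (q⁻¹ : symplecticGroup ι K) * M := by
        rw [← e, mul_assoc, mul_assoc, h1, mul_one]

lemma mem {M N : Matrix (ι ⊕ ι) (ι ⊕ ι) K} (h : SympConj M N) (hM : M ∈ symplecticGroup ι K) :
    N ∈ symplecticGroup ι K := by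
  obtain ⟨Q, hQ, e⟩ := h
  have h1 : ((⟨Q, hQ⟩⁻¹ * ⟨M, hM⟩ * ⟨Q, hQ⟩ : symplecticGroup ι K) :
      Matrix (ι ⊕ ι) (ι ⊕ ι) K) = N := by
    have h2 : ((⟨Q, hQ⟩⁻¹ * ⟨Q, hQ⟩ : symplecticGroup ι K) : Matrix (ι ⊕ ι) (ι ⊕ ι) K) = 1 := by
      rw [inv_mul_cancel]; rfl
    rw [Submonoid.coe_mul] at h2
    rw [Submonoid.coe_mul, Submonoid.coe_mul, mul_assoc, e, ← mul_assoc, h2, one_mul]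
  rw [← h1]
  exact Subtype.property _

/-- Change of the complement of the first Lagrangian subspace. -/
lemma upper (A B C D : Matrix ι ι K) {S : Matrix ι ι K} (hS : Sᵀ = S) :
    SympConj (fromBlocks A B C D)
      (fromBlocks (A + S * C) (B + S * D - (A + S * C) * S) C (D - C * S)) := by
  refine ⟨fromBlocks 1 (-S) 0 1, ?_, ?_⟩
  · rw [SymplecticGroup.mem_iff]
    simp [J, fromBlocks_multiply, fromBlocks_transpose, hS]
  · simp only [fromBlocks_multiply, fromBlocks_inj]
    refine ⟨?_, ?_, ?_, ?_⟩ <;> noncomm_ring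

/-- Change of the first Lagrangian subspace, with its complement fixed. -/
lemma lower (A B C D : Matrix ι ι K) {S : Matrix ι ι K} (hS : Sᵀ = S) :
    SympConj (fromBlocks A B C D)
      (fromBlocks (A + B * S) B (C + D * S - S * (A + B * S)) (D - S * B)) := by
  refine ⟨fromBlocks 1 0 S 1, ?_, ?_⟩
  · rw [SymplecticGroup.mem_iff]
    simp [J, fromBlocks_multiply, fromBlocks_transpose, hS]
  · simp only [fromBlocks_multiply, fromBlocks_inj]
    refine ⟨?_, ?_, ?_, ?_⟩ <;> noncomm_ring

/-- Exchange of the two Lagrangian subspaces. -/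
lemma swap (A B C D : Matrix ι ι K) :
    SympConj (fromBlocks A B C D) (fromBlocks D (-C) (-B) A) := by
  refine ⟨J ι K, SymplecticGroup.J_mem ι K, ?_⟩
  simp [J, fromBlocks_multiply]

/-- Change of the basis of the first Lagrangian subspace, and dually of the second one. -/
lemma levi (A B C D : Matrix ι ι K) {g g' : Matrix ι ι K} (hg : g' * g = 1) :
    SympConj (fromBlocks A B C D)
      (fromBlocks (g' * A * g) (g' * B * g'ᵀ) (gᵀ * C * g) (gᵀ * D * g'ᵀ)) := by
  have hg' : g * g' = 1 := mul_eq_one_comm.1 hg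
  have hgt : g'ᵀ * gᵀ = 1 := by rw [← transpose_mul, hg', transpose_one]
  refine ⟨fromBlocks g 0 0 g'ᵀ, ?_, ?_⟩
  · rw [SymplecticGroup.mem_iff]
    simp only [J, fromBlocks_multiply, fromBlocks_transpose, transpose_zero, transpose_transpose]
    simp [hg', hgt]
  · simp only [fromBlocks_multiply, Matrix.zero_mul, Matrix.mul_zero, add_zero, zero_add,
      ← mul_assoc, hg', hgt, one_mul]

end SympConj

lemma exists_generalized_inverse {m n K : Type*} [Fintype m] [Fintype n] [DecidableEq m]
    [DecidableEq n] [Field K] (C : Matrix m n K) : ∃ G : Matrix n m K, C * G * C = C := by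
  obtain ⟨r, hr⟩ := (toLin' C).rangeRestrict.exists_rightInverse_of_surjective
    (LinearMap.range_rangeRestrict _)
  obtain ⟨q, hq⟩ := (LinearMap.range (toLin' C)).subtype.exists_leftInverse_of_injective
    (Submodule.ker_subtype _)
  refine ⟨LinearMap.toMatrix' (r ∘ₗ q), ?_⟩
  apply toLin'.injective
  ext1 x
  rw [toLin'_mul, toLin'_mul, toLin'_toMatrix']
  ext1
  have h1 : ∀ y, q (toLin' C y) = (toLin' C).rangeRestrict y := fun y =>
    LinearMap.congr_fun hq ((toLin' C).rangeRestrict y)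
  have h2 : ∀ y, toLin' C (r y) = y := fun y =>
    congrArg Subtype.val (LinearMap.congr_fun hr y)
  simp only [LinearMap.comp_apply]
  rw [h1, h2]
  rfl

/-- The flexibility of corners: with the lower left block `C` fixed, the upper left block `A` can
be replaced by every `X` that agrees with `A` on the kernel of `C` and for which `Cᵀ X` is
symmetric.  Indeed `X - A = Y C` for some `Y`, and `Y` can be modified to a symmetric matrix without
changing `Y C`. -/
lemma exists_sympConj_corner {ι K : Type*} [Fintype ι] [DecidableEq ι] [Field K]
    {A B C D : Matrix ι ι K} (hM : fromBlocks A B C D ∈ symplecticGroup ι K) {X : Matrix ι ι K}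
    (hX : Cᵀ * X = Xᵀ * C) (hker : ∀ x, C *ᵥ x = 0 → X *ᵥ x = A *ᵥ x) :
    ∃ B' D', SympConj (fromBlocks A B C D) (fromBlocks X B' C D') := by
  obtain ⟨G, hG⟩ := exists_generalized_inverse C
  have hA : Cᵀ * A = Aᵀ * C := by
    have := SymplecticGroup.mem_iff'.1 hM
    simp only [J, fromBlocks_transpose, fromBlocks_multiply, fromBlocks_inj] at this
    have := this.1
    simp only [Matrix.mul_zero, Matrix.mul_one, zero_add, Matrix.mul_neg, add_zero,
      Matrix.neg_mul] at this
    exact eq_of_sub_eq_zero (by rw [← this]; abel)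
  set Y := (X - A) * G with hY
  have hYC : Y * C = X - A := by
    have h1 : (X - A) * (1 - G * C) = 0 := by
      apply toLin'.injective
      ext1 x
      ext1
      have h2 : C *ᵥ ((1 - G * C) *ᵥ Pi.single x 1) = 0 := by
        rw [mulVec_mulVec, Matrix.mul_sub, ← mul_assoc, hG, mul_one, sub_self, zero_mulVec]
      have h3 := hker _ h2
      simp only [LinearMap.comp_apply, toLin'_apply, map_zero, LinearMap.zero_apply,
        LinearMap.single_apply, ← mulVec_mulVec, Matrix.sub_mulVec (A := X), h3, sub_self]
    rw [Matrix.mul_sub, mul_one, sub_eq_zero, ← mul_assoc] at h1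
    exact h1.symm
  clear_value Y
  have hsym : (C * G)ᵀ * Y * (C * G) = (C * G)ᵀ * Yᵀ * (C * G) := by
    have h1 : Cᵀ * (Y * C) = (Y * C)ᵀ * C := by
      rw [hYC, Matrix.mul_sub, transpose_sub, Matrix.sub_mul, hX, hA]
    rw [transpose_mul] at h1
    calc (C * G)ᵀ * Y * (C * G) = Gᵀ * (Cᵀ * (Y * C)) * G := by
          rw [transpose_mul]; simp only [mul_assoc]
      _ = (C * G)ᵀ * Yᵀ * (C * G) := by rw [h1, transpose_mul]; simp only [mul_assoc]
  set S := Y * (C * G) + (C * G)ᵀ * Yᵀ - (C * G)ᵀ * Yᵀ * (C * G) with hSdef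
  have hS : Sᵀ = S := by
    have h1 : ((C * G)ᵀ * Yᵀ * (C * G))ᵀ = (C * G)ᵀ * Yᵀ * (C * G) := by
      rw [transpose_mul _ (C * G), transpose_mul _ Yᵀ, transpose_transpose, transpose_transpose,
        ← mul_assoc, hsym]
    have h2 : (Y * (C * G))ᵀ = (C * G)ᵀ * Yᵀ := transpose_mul _ _
    have h3 : ((C * G)ᵀ * Yᵀ)ᵀ = Y * (C * G) := by
      rw [transpose_mul, transpose_transpose, transpose_transpose]
    rw [hSdef, transpose_sub, h1, transpose_add, h2, h3, add_comm (Y * (C * G))]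
  have hSC : A + S * C = X := by
    rw [hSdef, Matrix.sub_mul, Matrix.add_mul, mul_assoc Y, hG, mul_assoc _ (C * G) C, hG, hYC]
    abel
  refine ⟨B + S * D - (A + S * C) * S, D - C * S, ?_⟩
  have := SympConj.upper A B C D hS
  rwa [hSC] at this ⊢

/-- An element of the class of `M` contributes its corner. -/
lemma SympConj.mem_PC {n : ℕ} {K : Type*} [Field K] {Ω : ConjClasses (symplecticGroup (Fin n) K)}
    {M : symplecticGroup (Fin n) K} (hM : M ∈ Ω.carrier)
    {A B C D : Matrix (Fin n) (Fin n) K}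
    (h : SympConj (M : Matrix (Fin n ⊕ Fin n) (Fin n ⊕ Fin n) K) (fromBlocks A B C D)) :
    A ∈ SympCorner.PC Ω := by
  have hN := h.mem M.2
  obtain ⟨Q, hQ, e⟩ := h
  refine ⟨⟨_, hN⟩, ?_, toBlocks_fromBlocks₁₁ A B C D⟩
  rw [ConjClasses.mem_carrier_iff_mk_eq] at hM ⊢
  rw [← hM, ConjClasses.mk_eq_mk_iff_isConj, isConj_iff]
  refine ⟨⟨Q, hQ⟩, ?_⟩
  rw [mul_inv_eq_iff_eq_mul]
  exact Subtype.ext e.symm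

/-! ### Symplectic bases -/

/-- The standard symplectic form `x ⬝ᵥ J y`. -/
noncomputable def sympForm (ι K : Type*) [Fintype ι] [DecidableEq ι] [Field K] :
    LinearMap.BilinForm K (ι ⊕ ι → K) :=
  Matrix.toBilin' (J ι K)

section sympForm

variable {ι K : Type*} [Fintype ι] [DecidableEq ι] [Field K]

lemma sympForm_apply (x y : ι ⊕ ι → K) : sympForm ι K x y = x ⬝ᵥ (J ι K *ᵥ y) :=
  Matrix.toBilin'_apply' _ _ _

lemma J_mulVec (y : ι ⊕ ι → K) : J ι K *ᵥ y = Sum.elim (-(y ∘ Sum.inr)) (y ∘ Sum.inl) := by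
  rw [J, fromBlocks_mulVec]
  simp [neg_mulVec]

lemma sympForm_self (x : ι ⊕ ι → K) : sympForm ι K x x = 0 := by
  rw [sympForm_apply, J_mulVec]
  simp only [dotProduct, Fintype.sum_sum_type, Sum.elim_inl, Sum.elim_inr, Pi.neg_apply,
    Function.comp, mul_neg, Finset.sum_neg_distrib]
  rw [neg_add_eq_zero]
  exact Finset.sum_congr rfl fun i _ => mul_comm _ _

lemma sympForm_mulVec {Q : Matrix (ι ⊕ ι) (ι ⊕ ι) K} (hQ : Q ∈ symplecticGroup ι K)
    (x y : ι ⊕ ι → K) : sympForm ι K (Q *ᵥ x) (Q *ᵥ y) = sympForm ι K x y := by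
  have h1 : J ι K *ᵥ y = Qᵀ *ᵥ (J ι K *ᵥ (Q *ᵥ y)) := by
    rw [mulVec_mulVec, mulVec_mulVec, SymplecticGroup.mem_iff'.1 hQ]
  rw [sympForm_apply, sympForm_apply, h1, dotProduct_mulVec x, vecMul_transpose]

lemma sympForm_single_inl (i : ι) (y : ι ⊕ ι → K) :
    sympForm ι K (Pi.single (Sum.inl i) 1) y = -y (Sum.inr i) := by
  rw [sympForm_apply, J_mulVec]
  simp

lemma sympIsom_toLin' (M : symplecticGroup ι K) :
    SympIsom (sympForm ι K) (toLin' (M : Matrix (ι ⊕ ι) (ι ⊕ ι) K))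
      (toLin' ((M⁻¹ : symplecticGroup ι K) : Matrix (ι ⊕ ι) (ι ⊕ ι) K)) := by
  have h1 : ((M * M⁻¹ : symplecticGroup ι K) : Matrix (ι ⊕ ι) (ι ⊕ ι) K) = 1 := by
    rw [mul_inv_cancel]; rfl
  have h2 : ((M⁻¹ * M : symplecticGroup ι K) : Matrix (ι ⊕ ι) (ι ⊕ ι) K) = 1 := by
    rw [inv_mul_cancel]; rfl
  rw [Submonoid.coe_mul] at h1 h2
  refine ⟨sympForm_self, ?_, ?_, ?_, ?_⟩
  · intro x hx
    have h3 : J ι K *ᵥ x = 0 := by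
      funext i
      have h4 := hx (Pi.single i 1)
      have h5 := sympForm_self (x + Pi.single i 1)
      simp only [map_add, LinearMap.add_apply, sympForm_self, h4, zero_add, add_zero] at h5
      rw [sympForm_apply] at h5
      simpa using h5
    have h6 : (-J ι K) *ᵥ (J ι K *ᵥ x) = x := by
      rw [mulVec_mulVec, Matrix.neg_mul, J_squared, neg_neg, one_mulVec]
    rw [← h6, h3, mulVec_zero]
  · rw [Module.End.mul_eq_comp, ← toLin'_mul, h1, toLin'_one]; rfl
  · rw [Module.End.mul_eq_comp, ← toLin'_mul, h2, toLin'_one]; rfl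
  · intro x y
    rw [toLin'_apply, toLin'_apply]
    conv_rhs => rw [← sympForm_mulVec M.2]
    rw [mulVec_mulVec, h1, one_mulVec]

end sympForm

/-- Linearly independent, pairwise orthogonal vectors are the first half of the columns of a
symplectic matrix. -/
lemma exists_symplectic_of_isotropic {n : ℕ} {K : Type*} [Field K]
    {e : Fin n → Fin n ⊕ Fin n → K} (he : LinearIndependent K e)
    (hiso : ∀ i j, sympForm (Fin n) K (e i) (e j) = 0) :
    ∃ Q ∈ symplecticGroup (Fin n) K, ∀ j, Q *ᵥ Pi.single (Sum.inl j) 1 = e j := by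
  set E : Matrix (Fin n) (Fin n ⊕ Fin n) K := Matrix.of e with hE
  have hinj : LinearMap.ker E.vecMulLinear = ⊥ := by
    rw [LinearMap.ker_eq_bot]
    exact vecMul_injective_iff.2 he
  obtain ⟨r, hr⟩ := E.vecMulLinear.exists_leftInverse_of_injective hinj
  set H : Matrix (Fin n ⊕ Fin n) (Fin n) K := (LinearMap.toMatrix' r)ᵀ with hH
  have hEH : E * H = 1 := by
    have h1 : ∀ x, x ᵥ* E ᵥ* H = x := by
      intro x
      have := LinearMap.congr_fun hr x
      rw [LinearMap.comp_apply, vecMulLinear_apply, ← LinearMap.toMatrix'_mulVec] at this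
      rwa [hH, vecMul_transpose]
    apply Matrix.ext_iff_vecMul.2
    intro x
    rw [← vecMul_vecMul, h1, vecMul_one]
  clear_value H
  have hEJE : E * J (Fin n) K * Eᵀ = 0 := by
    ext i j
    have := hiso i j
    rw [sympForm_apply, dotProduct_mulVec] at this
    rw [Matrix.mul_apply']
    exact this
  set G := Hᵀ * J (Fin n) K * H with hG
  have hGskew : ∀ i j, G i j = -G j i := by
    have h1 : Gᵀ = -G := by
      rw [hG, transpose_mul, transpose_mul, transpose_transpose, J_transpose, ← Matrix.mul_assoc]
      simp
    intro i j
    rw [← transpose_apply G, h1, Matrix.neg_apply]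
  have hGdiag : ∀ i, G i i = 0 := by
    intro i
    have := sympForm_self (ι := Fin n) (K := K) (fun k => H k i)
    rw [sympForm_apply, dotProduct_mulVec] at this
    rw [hG, Matrix.mul_apply']
    exact this
  -- correct a dual family to an isotropic one
  obtain ⟨s, hsG⟩ : ∃ s : Matrix (Fin n) (Fin n) K, G + s - sᵀ = 0 := by
    refine ⟨Matrix.of fun i j => if i < j then -G i j else 0, ?_⟩
    ext i j
    simp only [Matrix.sub_apply, Matrix.add_apply, transpose_apply, of_apply, Matrix.zero_apply]
    rcases lt_trichotomy i j with h | rfl | h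
    · rw [if_pos h, if_neg h.not_gt]; ring
    · rw [hGdiag]; simp
    · rw [if_pos h, if_neg h.not_gt, hGskew i j]; ring
  have hJJ : J (Fin n) K * J (Fin n) K = -1 := J_squared _ _
  set F := J (Fin n) K * H + Eᵀ * s with hF
  have hEJF : E * J (Fin n) K * F = -1 := by
    rw [hF, Matrix.mul_add, ← Matrix.mul_assoc, Matrix.mul_assoc E, hJJ, ← Matrix.mul_assoc, hEJE]
    simp [hEH]
  have hFt : Fᵀ = sᵀ * E - Hᵀ * J (Fin n) K := by
    rw [hF, transpose_add, transpose_mul, transpose_mul, transpose_transpose, J_transpose]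
    simp [sub_eq_add_neg, add_comm]
  have hFJE : Fᵀ * J (Fin n) K * Eᵀ = 1 := by
    have := congrArg transpose hEJF
    rw [transpose_mul, transpose_mul, J_transpose, transpose_neg, transpose_one, Matrix.neg_mul,
      Matrix.mul_neg, neg_inj, ← Matrix.mul_assoc] at this
    exact this
  have hFJF : Fᵀ * J (Fin n) K * F = 0 := by
    have hHE : Hᵀ * Eᵀ = 1 := by rw [← transpose_mul, hEH, transpose_one]
    have h1 : Fᵀ * J (Fin n) K * F =
        Fᵀ * J (Fin n) K * (J (Fin n) K * H) + Fᵀ * J (Fin n) K * Eᵀ * s := by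
      conv_lhs => rw [hF]
      rw [Matrix.mul_add, ← Matrix.mul_assoc _ Eᵀ]
    rw [h1, hFJE, Matrix.one_mul, Matrix.mul_assoc, ← Matrix.mul_assoc (J (Fin n) K), hJJ, hFt,
      ← hsG, hG]
    simp only [Matrix.neg_mul, Matrix.mul_neg, Matrix.one_mul, Matrix.sub_mul, Matrix.mul_assoc,
      hEH, Matrix.mul_one]
    abel
  refine ⟨fromCols Eᵀ F, ?_, ?_⟩
  · rw [SymplecticGroup.mem_iff', transpose_fromCols, transpose_transpose, fromRows_mul,
      fromRows_mul_fromCols, hEJE, hEJF, hFJE, hFJF]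
    rfl
  · intro j
    funext i
    simp [hE]

/-- The block form of the existence of adapted subspaces: the first half of a symplectic basis
spans an adapted Lagrangian subspace `U`, `C` is up to sign the Gram matrix of the form `w x (P y)`
on `U`, and the kernel of `C` consists of the vectors of `U` whose image lies in `U`. -/
theorem exists_sympConj_adapted {n : ℕ} {K : Type*} [Field K] (M : symplecticGroup (Fin n) K) :
    ∃ A B C D : Matrix (Fin n) (Fin n) K,
      SympConj (M : Matrix (Fin n ⊕ Fin n) (Fin n ⊕ Fin n) K) (fromBlocks A B C D) ∧
      Cᵀ = C ∧
      (∀ x, C *ᵥ x = 0 → ∃ a b, x = a + b ∧ C *ᵥ a = 0 ∧ C *ᵥ b = 0 ∧ A *ᵥ a = a ∧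
        A *ᵥ b = -b) ∧
      (C = 0 → M * M = 1) := by
  have h := sympIsom_toLin' M
  obtain ⟨U, hU⟩ := SympIsom.exists_isAdapted_top _ rfl h
  have hrefl : (sympForm (Fin n) K).IsRefl := fun x y hxy => by rw [h.skew, hxy, neg_zero]
  have hnd : (sympForm (Fin n) K).Nondegenerate :=
    ⟨fun x hx => h.nondeg x hx, fun y hy => h.nondeg_right y hy⟩
  have hUU : (sympForm (Fin n) K).orthogonal U = U := by
    ext x
    rw [LinearMap.BilinForm.mem_orthogonal_iff]
    exact ⟨fun hx => hU.maxl x trivial hx, fun hx u hu => hU.iso u hu x hx⟩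
  have hdim : Module.finrank K U = n := by
    have h1 := LinearMap.BilinForm.finrank_orthogonal hnd U
    rw [hUU, Module.finrank_fintype_fun_eq_card, Fintype.card_sum, Fintype.card_fin] at h1
    have h2 := Submodule.finrank_le U
    rw [Module.finrank_fintype_fun_eq_card, Fintype.card_sum, Fintype.card_fin] at h2
    omega
  let b := Module.finBasisOfFinrankEq K U hdim
  obtain ⟨Q, hQ, hQe⟩ := exists_symplectic_of_isotropic (e := fun i => (b i : Fin n ⊕ Fin n → K))
    (b.linearIndependent.map' U.subtype (Submodule.ker_subtype U))
    (fun i j => hU.iso _ (b i).2 _ (b j).2)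
  set q : symplecticGroup (Fin n) K := ⟨Q, hQ⟩ with hq
  set N : symplecticGroup (Fin n) K := q⁻¹ * M * q with hN
  have hMN : (M : Matrix (Fin n ⊕ Fin n) (Fin n ⊕ Fin n) K) * Q = Q * N := by
    have : M * q = q * N := by rw [hN]; group
    exact congrArg Subtype.val this
  set A := (N : Matrix (Fin n ⊕ Fin n) (Fin n ⊕ Fin n) K).toBlocks₁₁ with hA
  set B := (N : Matrix (Fin n ⊕ Fin n) (Fin n ⊕ Fin n) K).toBlocks₁₂ with hB
  set C := (N : Matrix (Fin n ⊕ Fin n) (Fin n ⊕ Fin n) K).toBlocks₂₁ with hC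
  set D := (N : Matrix (Fin n ⊕ Fin n) (Fin n ⊕ Fin n) K).toBlocks₂₂ with hD
  have hNb : (N : Matrix (Fin n ⊕ Fin n) (Fin n ⊕ Fin n) K) = fromBlocks A B C D :=
    (fromBlocks_toBlocks _).symm
  have hQinj : Function.Injective (Q *ᵥ ·) := by
    intro x y hxy
    have h2 : ((q⁻¹ * q : symplecticGroup (Fin n) K) :
        Matrix (Fin n ⊕ Fin n) (Fin n ⊕ Fin n) K) = 1 := by
      rw [inv_mul_cancel]; rfl
    rw [Submonoid.coe_mul] at h2
    replace h2 : ((q⁻¹ : symplecticGroup (Fin n) K) :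
        Matrix (Fin n ⊕ Fin n) (Fin n ⊕ Fin n) K) * Q = 1 := h2
    have h3 := congrArg (((q⁻¹ : symplecticGroup (Fin n) K) :
      Matrix (Fin n ⊕ Fin n) (Fin n ⊕ Fin n) K) *ᵥ ·) hxy
    simpa only [mulVec_mulVec, h2, one_mulVec] using h3
  -- the coordinate description of `U`
  have hQx : ∀ x : Fin n → K, Q *ᵥ Sum.elim x 0 = ∑ i, x i • (b i : Fin n ⊕ Fin n → K) := by
    intro x
    have : (Sum.elim x 0 : Fin n ⊕ Fin n → K) = ∑ i, x i • Pi.single (Sum.inl i) 1 := by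
      funext k
      rcases k with k | k <;> simp [Finset.sum_apply, Pi.single_apply]
    rw [this, mulVec_sum]
    simp only [mulVec_smul, hQe]
  have hQmem : ∀ x : Fin n → K, Q *ᵥ Sum.elim x 0 ∈ U := by
    intro x
    rw [hQx]
    exact Submodule.sum_mem _ fun i _ => U.smul_mem _ (b i).2
  have hQsurj : ∀ u ∈ U, ∃ x : Fin n → K, Q *ᵥ Sum.elim x 0 = u := by
    intro u hu
    refine ⟨fun i => b.repr ⟨u, hu⟩ i, ?_⟩
    rw [hQx]
    have := congrArg U.subtype (b.sum_repr ⟨u, hu⟩)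
    rw [map_sum] at this
    simpa only [map_smul, Submodule.subtype_apply] using this
  have hMQ : ∀ x : Fin n → K, (M : Matrix (Fin n ⊕ Fin n) (Fin n ⊕ Fin n) K) *ᵥ
      (Q *ᵥ Sum.elim x 0) = Q *ᵥ Sum.elim (A *ᵥ x) (C *ᵥ x) := by
    intro x
    rw [mulVec_mulVec, hMN, ← mulVec_mulVec, hNb, fromBlocks_mulVec]
    simp
  have heig : ∀ (x : Fin n → K) (c : K), (M : Matrix (Fin n ⊕ Fin n) (Fin n ⊕ Fin n) K) *ᵥ
      (Q *ᵥ Sum.elim x 0) = c • (Q *ᵥ Sum.elim x 0) → C *ᵥ x = 0 ∧ A *ᵥ x = c • x := by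
    intro x c hx
    rw [hMQ, ← mulVec_smul] at hx
    have h1 := hQinj hx
    constructor
    · funext i
      simpa using congrFun h1 (Sum.inr i)
    · funext i
      simpa using congrFun h1 (Sum.inl i)
  refine ⟨A, B, C, D, ⟨Q, hQ, by rw [hMN, hNb]⟩, ?_, ?_, ?_⟩
  · have hCij : ∀ i j, C i j = -sympForm (Fin n) K (b i)
        (toLin' (M : Matrix (Fin n ⊕ Fin n) (Fin n ⊕ Fin n) K) (b j)) := by
      intro i j
      rw [← hQe, ← hQe, toLin'_apply, mulVec_mulVec, hMN, ← mulVec_mulVec, sympForm_mulVec hQ,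
        sympForm_single_inl, neg_neg, mulVec_single_one]
      rfl
    ext i j
    rw [transpose_apply, hCij, hCij, hU.symm _ (b i).2 _ (b j).2]
  · intro x hx
    have h1 : toLin' (M : Matrix (Fin n ⊕ Fin n) (Fin n ⊕ Fin n) K) (Q *ᵥ Sum.elim x 0) ∈ U := by
      rw [toLin'_apply, hMQ, hx]
      exact hQmem _
    obtain ⟨a, ha, a', ha', e1, e2, e3⟩ := hU.fix _ (hQmem x) h1
    obtain ⟨y, rfl⟩ := hQsurj a ha
    obtain ⟨y', rfl⟩ := hQsurj a' ha'
    rw [toLin'_apply] at e2 e3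
    obtain ⟨h2, h3⟩ := heig y 1 (by rw [e2, one_smul])
    obtain ⟨h4, h5⟩ := heig y' (-1) (by rw [e3, neg_one_smul])
    refine ⟨y, y', ?_, h2, h4, by rw [h3, one_smul], by rw [h5, neg_one_smul]⟩
    rw [← mulVec_add] at e1
    funext i
    simpa using congrFun (hQinj e1) (Sum.inl i)
  · intro hC0
    have h1 := hU.inv (fun u hu => by
      obtain ⟨x, rfl⟩ := hQsurj u hu
      rw [toLin'_apply, hMQ, hC0, zero_mulVec]
      exact hQmem _)
    apply Subtype.ext
    rw [Submonoid.coe_mul]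
    apply Matrix.ext_iff_mulVec.2
    intro x
    have := h1 x trivial
    rw [toLin'_apply, toLin'_apply, mulVec_mulVec] at this
    rw [this]
    exact (one_mulVec x).symm

/-! ### Flexible symmetric matrices -/

/-- A matrix `C` is *flexible* for the class `Ω` if all `X` that fix the kernel of `C` pointwise
and for which `Cᵀ X` is symmetric are corners of elements of `Ω`. -/
def Flexible {n : ℕ} {K : Type*} [Field K] (Ω : ConjClasses (symplecticGroup (Fin n) K))
    (C : Matrix (Fin n) (Fin n) K) : Prop :=
  ∀ X : Matrix (Fin n) (Fin n) K, Cᵀ * X = Xᵀ * C → (∀ x, C *ᵥ x = 0 → X *ᵥ x = x) →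
    X ∈ SympCorner.PC Ω

section Flexible

variable {n : ℕ} {K : Type*} [Field K] {Ω : ConjClasses (symplecticGroup (Fin n) K)}

lemma conj_mem_PC {A g g' : Matrix (Fin n) (Fin n) K} (hA : A ∈ SympCorner.PC Ω)
    (hg : g' * g = 1) : g' * A * g ∈ SympCorner.PC Ω := by
  obtain ⟨P, hP, rfl⟩ := hA
  have h := SympConj.levi (P : Matrix (Fin n ⊕ Fin n) (Fin n ⊕ Fin n) K).toBlocks₁₁
    (P : Matrix (Fin n ⊕ Fin n) (Fin n ⊕ Fin n) K).toBlocks₁₂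
    (P : Matrix (Fin n ⊕ Fin n) (Fin n ⊕ Fin n) K).toBlocks₂₁
    (P : Matrix (Fin n ⊕ Fin n) (Fin n ⊕ Fin n) K).toBlocks₂₂ hg
  rw [fromBlocks_toBlocks] at h
  exact h.mem_PC hP

/-- Flexibility depends only on the congruence class. -/
lemma Flexible.congr {C g g' : Matrix (Fin n) (Fin n) K} (h : Flexible Ω C) (hg : g' * g = 1) :
    Flexible Ω (gᵀ * C * g) := by
  intro X hX hker
  have hg' : g * g' = 1 := mul_eq_one_comm.1 hg
  have hgt : g'ᵀ * gᵀ = 1 := by rw [← transpose_mul, hg', transpose_one]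
  have h0 : g * X * g' ∈ SympCorner.PC Ω := by
    apply h
    · have h1 : g'ᵀ * ((gᵀ * C * g)ᵀ * X) * g' = g'ᵀ * (Xᵀ * (gᵀ * C * g)) * g' := by rw [hX]
      have h2 : g'ᵀ * ((gᵀ * C * g)ᵀ * X) * g' = (g'ᵀ * gᵀ) * Cᵀ * (g * X * g') := by
        rw [transpose_mul, transpose_mul, transpose_transpose]
        simp only [mul_assoc]
      have h3 : g'ᵀ * (Xᵀ * (gᵀ * C * g)) * g' = (g * X * g')ᵀ * C * (g * g') := by
        rw [transpose_mul, transpose_mul]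
        simp only [mul_assoc]
      rw [h2, h3, hgt, hg', one_mul, mul_one] at h1
      exact h1
    · intro x hx
      have h1 : (gᵀ * C * g) *ᵥ (g' *ᵥ x) = 0 := by
        rw [mulVec_mulVec, mul_assoc, hg', mul_one, ← mulVec_mulVec, hx, mulVec_zero]
      rw [mul_assoc, ← mulVec_mulVec, ← mulVec_mulVec, hker _ h1, mulVec_mulVec, hg', one_mulVec]
  have h4 : g' * (g * X * g') * g = (g' * g) * X * (g' * g) := by simp only [mul_assoc]
  have := conj_mem_PC h0 hg
  rwa [h4, hg, one_mul, mul_one] at this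

/-- If `M` fixes the largest invariant subspace of the adapted Lagrangian subspace pointwise, then
there is a nonzero flexible symmetric matrix.  When the Lagrangian subspace itself is pointwise
fixed, the roles of the two halves of the symplectic basis are exchanged. -/
lemma exists_flexible {M : symplecticGroup (Fin n) K} (hM : M ∈ Ω.carrier) (hM1 : M ≠ 1)
    {A B C D : Matrix (Fin n) (Fin n) K}
    (h : SympConj (M : Matrix (Fin n ⊕ Fin n) (Fin n ⊕ Fin n) K) (fromBlocks A B C D))
    (hC : Cᵀ = C) (hker : ∀ x, C *ᵥ x = 0 → A *ᵥ x = x) :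
    ∃ N, SympConj (M : Matrix (Fin n ⊕ Fin n) (Fin n ⊕ Fin n) K) N ∧ N.toBlocks₂₁ᵀ = N.toBlocks₂₁ ∧
      N.toBlocks₂₁ ≠ 0 ∧ Flexible Ω N.toBlocks₂₁ := by
  have main : ∀ {A B C D : Matrix (Fin n) (Fin n) K},
      SympConj (M : Matrix (Fin n ⊕ Fin n) (Fin n ⊕ Fin n) K) (fromBlocks A B C D) →
      (∀ x, C *ᵥ x = 0 → A *ᵥ x = x) → Flexible Ω C := by
    intro A B C D h hker X hX hXker
    obtain ⟨B', D', h'⟩ := exists_sympConj_corner (h.mem M.2) hX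
      fun x hx => by rw [hXker x hx, hker x hx]
    exact (h.trans h').mem_PC hM
  by_cases hC0 : C = 0
  · subst hC0
    have hA : A = 1 := by
      apply Matrix.ext_iff_mulVec.2
      intro x
      rw [hker x (zero_mulVec x), one_mulVec]
    subst hA
    obtain ⟨-, h1, h2⟩ := SymplecticGroup.fromBlocks_mem_iff.1 (h.mem M.2)
    have hD : D = 1 := by simpa using h2
    subst hD
    refine ⟨_, h.trans (SympConj.swap _ _ _ _), ?_, ?_, ?_⟩
    · rw [toBlocks_fromBlocks₂₁, transpose_neg]
      congr 1
      simpa using h1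
    · rw [toBlocks_fromBlocks₂₁]
      intro hB
      rw [neg_eq_zero] at hB
      apply hM1
      obtain ⟨Q, hQ, e⟩ := h
      rw [hB, fromBlocks_one, mul_one] at e
      have h3 : M * ⟨Q, hQ⟩ = ⟨Q, hQ⟩ := Subtype.ext e
      exact mul_eq_right.1 h3
    · rw [toBlocks_fromBlocks₂₁]
      exact main (h.trans (SympConj.swap _ _ _ _)) fun x _ => one_mulVec x
  · exact ⟨_, h, by rwa [toBlocks_fromBlocks₂₁], by rwa [toBlocks_fromBlocks₂₁],
      by rw [toBlocks_fromBlocks₂₁]; exact main h hker⟩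

/-- Vectors (the rows of `E`) with invertible Gram matrix `Γ` split off an orthogonal summand of the
form `C`. -/
lemma exists_congr_fromBlocks {p q : ℕ} (σ : Fin p ⊕ Fin q ≃ Fin n)
    {C : Matrix (Fin n) (Fin n) K} (hC : Cᵀ = C) (E : Matrix (Fin p) (Fin n) K)
    {Γ Γ' : Matrix (Fin p) (Fin p) K} (hΓ : E * C * Eᵀ = Γ) (hΓ' : Γ' * Γ = 1) :
    ∃ g g' : Matrix (Fin n) (Fin n) K, g' * g = 1 ∧ ∃ C₂ : Matrix (Fin q) (Fin q) K, C₂ᵀ = C₂ ∧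
      gᵀ * C * g = reindex σ σ (fromBlocks Γ 0 0 C₂) := by
  have hn : p + q = n := by simpa using Fintype.card_congr σ
  have hΓ'' : Γ * Γ' = 1 := mul_eq_one_comm.1 hΓ'
  have hdim : Module.finrank K (LinearMap.ker (toLin' (E * C))) = q := by
    have h1 := LinearMap.finrank_range_add_finrank_ker (toLin' (E * C))
    have h2 : LinearMap.range (toLin' (E * C)) = ⊤ := by
      rw [LinearMap.range_eq_top]
      intro y
      refine ⟨(Eᵀ * Γ') *ᵥ y, ?_⟩
      rw [toLin'_apply, mulVec_mulVec, ← Matrix.mul_assoc, hΓ, hΓ'', one_mulVec]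
    rw [h2, finrank_top, Module.finrank_fintype_fun_eq_card, Module.finrank_fintype_fun_eq_card,
      Fintype.card_fin, Fintype.card_fin] at h1
    omega
  let b := Module.finBasisOfFinrankEq K _ hdim
  set F : Matrix (Fin q) (Fin n) K := Matrix.of fun i => (b i : Fin n → K) with hF
  have hECF : E * C * Fᵀ = 0 := by
    ext i j
    have := congrFun (LinearMap.mem_ker.1 (b j).2) i
    rw [toLin'_apply] at this
    rw [Matrix.mul_apply']
    exact this
  have hFCE : F * C * Eᵀ = 0 := by
    have := congrArg transpose hECF
    rwa [transpose_mul, transpose_mul, transpose_transpose, hC, transpose_zero,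
      ← Matrix.mul_assoc] at this
  have hFinj : Function.Injective (fun x => Fᵀ *ᵥ x) := by
    rw [mulVec_injective_iff]
    exact b.linearIndependent.map' (Submodule.subtype _) (Submodule.ker_subtype _)
  set g₀ : Matrix (Fin n) (Fin p ⊕ Fin q) K := fromCols Eᵀ Fᵀ with hg₀
  set g : Matrix (Fin n) (Fin n) K := g₀.submatrix id σ.symm with hg
  have hinj : LinearMap.ker g.mulVecLin = ⊥ := by
    rw [LinearMap.ker_eq_bot']
    intro x hx
    rw [mulVecLin_apply, hg, submatrix_mulVec_equiv, Equiv.symm_symm, Function.comp_id] at hx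
    set y := x ∘ σ with hy
    rw [hg₀, fromCols_mulVec] at hx
    have h1 : y ∘ Sum.inl = 0 := by
      have h2 := congrArg (fun v => Γ' *ᵥ ((E * C) *ᵥ v)) hx
      simpa only [mulVec_add, mulVec_mulVec, hΓ, hECF, zero_mulVec, mulVec_zero, add_zero, hΓ',
        one_mulVec] using h2
    rw [h1, mulVec_zero, zero_add] at hx
    have h2 : y ∘ Sum.inr = 0 := hFinj (by simpa using hx)
    have h3 : y = 0 := by
      funext i
      rcases i with i | i
      · exact congrFun h1 i
      · exact congrFun h2 i
    funext i
    have := congrFun h3 (σ.symm i)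
    simpa [hy] using this
  have hunit : IsUnit g := mulVec_injective_iff_isUnit.1 (LinearMap.ker_eq_bot.1 hinj)
  obtain ⟨g', hg'⟩ := hunit.exists_left_inv
  refine ⟨g, g', hg', F * C * Fᵀ, ?_, ?_⟩
  · rw [transpose_mul, transpose_mul, transpose_transpose, hC, Matrix.mul_assoc]
  · have h1 : gᵀ * C * g = (g₀ᵀ * C * g₀).submatrix σ.symm σ.symm := by
      rw [hg, transpose_submatrix]
      rfl
    rw [h1, reindex_apply, hg₀, transpose_fromCols, transpose_transpose, transpose_transpose,
      fromRows_mul, fromRows_mul_fromCols, hΓ, hECF, hFCE]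

/-- If `Γ` is an invertible Gram matrix of a flexible form, then a matrix `Y ⊕ 1` with symmetric
`Γ Y` is a corner. -/
lemma Flexible.reindex_mem {p q : ℕ} (σ : Fin p ⊕ Fin q ≃ Fin n)
    {C : Matrix (Fin n) (Fin n) K} (h : Flexible Ω C) (hC : Cᵀ = C)
    (E : Matrix (Fin p) (Fin n) K)
    {Γ Γ' Y : Matrix (Fin p) (Fin p) K} (hΓ : E * C * Eᵀ = Γ) (hΓ' : Γ' * Γ = 1)
    (hY : Γ * Y = Yᵀ * Γ) : reindex σ σ (fromBlocks Y 0 0 1) ∈ SympCorner.PC Ω := by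
  obtain ⟨g, g', hg, C₂, hC₂, hgC⟩ := exists_congr_fromBlocks σ hC E hΓ hΓ'
  have hΓt : Γᵀ = Γ := by
    rw [← hΓ, transpose_mul, transpose_mul, transpose_transpose, hC, Matrix.mul_assoc]
  have h1 := h.congr hg
  rw [hgC] at h1
  apply h1
  · simp only [reindex_apply, transpose_submatrix, fromBlocks_transpose, submatrix_mul_equiv,
      fromBlocks_multiply]
    simp [hΓt, hC₂, hY]
  · intro x hx
    simp only [reindex_apply] at hx ⊢
    rw [submatrix_mulVec_equiv, Equiv.symm_symm] at hx ⊢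
    have h2 : fromBlocks Γ 0 0 C₂ *ᵥ (x ∘ σ) = 0 := by
      funext i
      simpa using congrFun hx (σ i)
    rw [fromBlocks_mulVec] at h2 ⊢
    have h3 : (x ∘ σ) ∘ Sum.inl = 0 := by
      have h4 : Γ *ᵥ ((x ∘ σ) ∘ Sum.inl) = 0 := by
        funext i
        simpa using congrFun h2 (Sum.inl i)
      rw [← one_mulVec ((x ∘ σ) ∘ Sum.inl), ← hΓ', ← mulVec_mulVec, h4, mulVec_zero]
    funext i
    obtain ⟨j, rfl⟩ := σ.surjective i
    rcases j with j | j
    · have := congrFun h3 j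
      simp only [Function.comp] at this
      simp [h3, this]
    · simp

end Flexible

/-- The summands of `A ⊕ B` exchanged: the second one comes first in the block matrix. -/
lemma dsum_eq_reindex_swap {K : Type*} [Field K] {p q n : ℕ} (h : p + q = n)
    (A : Matrix (Fin p) (Fin p) K) (B : Matrix (Fin q) (Fin q) K) :
    SympCorner.dsum h A B =
      reindex ((Equiv.sumComm _ _).trans (finSumFinEquiv.trans (finCongr h)))
        ((Equiv.sumComm _ _).trans (finSumFinEquiv.trans (finCongr h))) (fromBlocks B 0 0 A) := by
  ext i j
  obtain ⟨i, rfl⟩ := (finSumFinEquiv.trans (finCongr h)).surjective i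
  obtain ⟨j, rfl⟩ := (finSumFinEquiv.trans (finCongr h)).surjective j
  simp only [SympCorner.dsum, reindex_apply, submatrix_apply, Equiv.symm_trans_apply,
    Equiv.symm_apply_apply]
  rcases i with i | i <;> rcases j with j | j <;> simp

lemma isTransvection_one_add_vecMulVec {ι K : Type*} [Fintype ι] [DecidableEq ι] [Field K]
    {a b : ι → K} (ha : a ≠ 0) (hb : b ≠ 0) (hab : b ⬝ᵥ a = 0) :
    SympCorner.IsTransvection (1 + vecMulVec a b) := by
  rw [SympCorner.IsTransvection, add_sub_cancel_left]
  constructor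
  · apply le_antisymm (rank_vecMulVec_le a b)
    rw [Nat.one_le_iff_ne_zero]
    intro h
    have h1 : (vecMulVec a b).mulVecLin = 0 :=
      LinearMap.range_eq_bot.1 (Submodule.finrank_eq_zero.1 h)
    exact vecMulVec_ne_zero ha hb (toLin'.map_eq_zero_iff.1 h1)
  · rw [vecMulVec_mul_vecMulVec, hab]
    simp

/-- A flexible form yields a transvection from an isotropic vector outside its radical, or from a
nonzero vector of its radical. -/
lemma Flexible.exists_transvection {n : ℕ} {K : Type*} [Field K]
    {Ω : ConjClasses (symplecticGroup (Fin n) K)} {C : Matrix (Fin n) (Fin n) K}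
    (h : Flexible Ω C) (hC : Cᵀ = C) {a x : Fin n → K} (ha : a ≠ 0) (hx : C *ᵥ x ≠ 0)
    (hax : C *ᵥ a = 0 ∨ a = x ∧ x ⬝ᵥ C *ᵥ x = 0) :
    ∃ A ∈ SympCorner.PC Ω, SympCorner.IsTransvection A := by
  have hsym : ∀ x y, (C *ᵥ x) ⬝ᵥ y = x ⬝ᵥ C *ᵥ y := fun x y => by
    rw [dotProduct_mulVec, ← mulVec_transpose, hC]
  refine ⟨1 + vecMulVec a (C *ᵥ x), ?_, isTransvection_one_add_vecMulVec ha hx ?_⟩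
  · apply h
    · rw [hC, Matrix.mul_add, mul_vecMulVec, transpose_add, transpose_vecMulVec, Matrix.add_mul,
        vecMulVec_mul, transpose_one, mul_one, one_mul, ← mulVec_transpose, hC]
      rcases hax with h0 | ⟨rfl, -⟩
      · rw [h0]
        simp
      · rfl
    · intro z hz
      rw [add_mulVec, one_mulVec, vecMulVec_mulVec, hsym, hz]
      simp
  · rw [hsym]
    rcases hax with h0 | ⟨rfl, h0⟩
    · rw [h0, dotProduct_zero]
    · exact h0

/-! ### Corners obtained from a flexible matrix -/

section SymmetricForms

variable {n : ℕ} {K : Type*} [Field K]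

lemma single_one_ne_zero {ι K : Type*} [DecidableEq ι] [Field K] (i : ι) :
    (Pi.single i 1 : ι → K) ≠ 0 := fun h =>
  one_ne_zero (α := K) (by simpa using congrFun h i)

lemma exists_dotProduct_eq_zero (hn : 2 ≤ n) (w : Fin n → K) : ∃ y, y ≠ 0 ∧ w ⬝ᵥ y = 0 := by
  have : Nontrivial (Fin n) := Fin.nontrivial_iff_two_le.2 hn
  obtain ⟨i, j, hij⟩ := exists_pair_ne (Fin n)
  by_cases hi : w i = 0
  · exact ⟨Pi.single i 1, single_one_ne_zero i, by rw [dotProduct_single_one, hi]⟩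
  · refine ⟨w j • Pi.single i 1 - w i • Pi.single j 1, fun h0 => hi ?_, ?_⟩
    · have := congrFun h0 j
      simpa [hij.symm] using this
    · rw [dotProduct_sub, dotProduct_smul, dotProduct_smul, dotProduct_single_one,
        dotProduct_single_one, smul_eq_mul, smul_eq_mul, mul_comm, sub_self]

lemma of_mul_mul_transpose_apply {p : ℕ} (C : Matrix (Fin n) (Fin n) K)
    (f : Fin p → Fin n → K) (i j : Fin p) :
    (Matrix.of f * C * (Matrix.of f)ᵀ) i j = f i ⬝ᵥ C *ᵥ f j := by
  rw [Matrix.mul_assoc, Matrix.mul_apply']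
  rfl

lemma dotProduct_mulVec_comm {C : Matrix (Fin n) (Fin n) K} (hC : Cᵀ = C) (x y : Fin n → K) :
    x ⬝ᵥ C *ᵥ y = y ⬝ᵥ C *ᵥ x := by
  rw [dotProduct_mulVec, ← mulVec_transpose, hC, dotProduct_comm]

lemma single_dotProduct_mulVec_single (C : Matrix (Fin n) (Fin n) K) (i j : Fin n) :
    Pi.single i 1 ⬝ᵥ C *ᵥ Pi.single j 1 = C i j := by
  simp

/-- A nonzero symmetric matrix has an anisotropic vector in characteristic not two. -/
lemma exists_anisotropic (h2 : (2 : K) ≠ 0) {C : Matrix (Fin n) (Fin n) K} (hC : Cᵀ = C)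
    (hC0 : C ≠ 0) : ∃ x, x ⬝ᵥ C *ᵥ x ≠ 0 := by
  by_contra hcon
  push Not at hcon
  apply hC0
  ext i j
  have h := hcon (Pi.single i 1 + Pi.single j 1)
  rw [mulVec_add, dotProduct_add, add_dotProduct, add_dotProduct, hcon, hcon,
    dotProduct_mulVec_comm hC (Pi.single j 1) (Pi.single i 1), single_dotProduct_mulVec_single,
    zero_add, add_zero, ← two_mul] at h
  exact (mul_eq_zero.1 h).resolve_left h2

end SymmetricForms

section Corners

variable {n : ℕ} {K : Type*} [Field K] {Ω : ConjClasses (symplecticGroup (Fin n) K)}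

/-- An anisotropic vector of a flexible form yields the corners `δ ⊕ 1`. -/
lemma Flexible.reindex_diag_mem {q : ℕ} (σ : Fin 1 ⊕ Fin q ≃ Fin n)
    {C : Matrix (Fin n) (Fin n) K} (h : Flexible Ω C) (hC : Cᵀ = C) {x : Fin n → K}
    (hx : x ⬝ᵥ C *ᵥ x ≠ 0) (δ : K) :
    reindex σ σ (fromBlocks !![δ] 0 0 1) ∈ SympCorner.PC Ω := by
  refine h.reindex_mem σ hC (Matrix.of ![x]) (Γ := !![x ⬝ᵥ C *ᵥ x])
    (Γ' := !![(x ⬝ᵥ C *ᵥ x)⁻¹]) ?_ ?_ ?_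
  · ext i j
    rw [of_mul_mul_transpose_apply]
    fin_cases i; fin_cases j
    rfl
  · ext i j
    fin_cases i; fin_cases j
    simp [hx]
  · ext i j
    fin_cases i; fin_cases j
    simp [Matrix.mul_apply, mul_comm]

lemma minpoly_companion_two (δ : K) : minpoly K !![0, δ; 1, 0] = X ^ 2 - C δ := by
  symm
  apply minpoly.unique
  · exact monic_X_pow_sub_C δ two_ne_zero
  · rw [map_sub, map_pow, aeval_X, aeval_C]
    ext i j
    fin_cases i <;> fin_cases j <;> simp [pow_two, algebraMap_matrix_apply]
  · intro q hq hq0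
    rw [degree_X_pow_sub_C two_pos]
    by_contra hlt
    push Not at hlt
    have h1 : q.natDegree ≤ 1 := by
      have := natDegree_lt_iff_degree_lt hq.ne_zero |>.2 hlt
      omega
    obtain ⟨a, b, rfl⟩ := exists_eq_X_add_C_of_natDegree_le_one h1
    have ha : a = 0 := by
      have := congrFun (congrFun hq0 1) 0
      simpa [algebraMap_matrix_apply, Matrix.mul_apply] using this
    have hb : b = 0 := by
      have := congrFun (congrFun hq0 0) 0
      simpa [algebraMap_matrix_apply, Matrix.mul_apply] using this
    subst ha hb
    simp at hq

/-- The corners obtained from a flexible form in characteristic two.  A transvection exists unless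
the form is anisotropic; in that case two orthogonal vectors give `1 ⊕ diag(ε, ε⁻¹)`, whatever their
values, and `K` has more than two elements.  An alternating form has a hyperbolic pair, which
provides a corner `Q ⊕ 1` with the companion matrix `Q` of `x² + δ`. -/
theorem Flexible.corners_of_two_eq_zero (h2 : (2 : K) = 0) (hn : 2 ≤ n)
    (e₁ : (n - 2) + 2 = n) (e₂ : 1 + (n - 1) = n) (e₃ : 2 + (n - 2) = n)
    {B : Matrix (Fin n) (Fin n) K} (h : Flexible Ω B) (hB : Bᵀ = B) (hB0 : B ≠ 0) :
    (1 : Matrix (Fin n) (Fin n) K) ∈ SympCorner.PC Ω ∧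
      ((∃ A ∈ SympCorner.PC Ω, SympCorner.IsTransvection A) ∨
        ∃ ε : K, ε ≠ 0 ∧ ε ≠ 1 ∧
          SympCorner.dsum e₁ 1 !![ε, 0; 0, ε⁻¹] ∈
            SympCorner.PC Ω) ∧
      ∀ δ : K, δ ≠ 0 →
        SympCorner.dsum e₂ !![δ] 1 ∈ SympCorner.PC Ω ∨
        ∃ Q : Matrix (Fin 2) (Fin 2) K, minpoly K Q = Polynomial.X ^ 2 + Polynomial.C δ ∧
          SympCorner.dsum e₃ Q 1 ∈ SympCorner.PC Ω := by
  have hneg : ∀ a : K, -a = a := fun a => by linear_combination -a * h2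
  obtain ⟨i₀, j₀, hij⟩ : ∃ i j, B i j ≠ 0 := by
    by_contra hcon
    push Not at hcon
    exact hB0 (Matrix.ext hcon)
  refine ⟨h 1 (by simp [hB]) fun x _ => one_mulVec x, ?_, ?_⟩
  · by_cases ht : ∃ A ∈ SympCorner.PC Ω, SympCorner.IsTransvection A
    · exact Or.inl ht
    right
    -- without a transvection, the form is anisotropic and the field has more than two elements
    have hj : B *ᵥ Pi.single j₀ 1 ≠ 0 := by
      intro h0
      have := congrFun h0 i₀
      rw [mulVec_single_one] at this
      exact hij this
    have hker : ∀ a, B *ᵥ a = 0 → a = 0 := by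
      intro a ha
      by_contra ha0
      exact ht (h.exists_transvection hB ha0 hj (Or.inl ha))
    have haniso : ∀ x, x ≠ 0 → x ⬝ᵥ B *ᵥ x ≠ 0 := by
      intro x hx h0
      exact ht (h.exists_transvection hB hx (fun h1 => hx (hker x h1)) (Or.inr ⟨rfl, h0⟩))
    obtain ⟨x, hx⟩ : ∃ x : Fin n → K, x ≠ 0 := ⟨Pi.single i₀ 1, single_one_ne_zero i₀⟩
    obtain ⟨y, hy, hxy⟩ := exists_dotProduct_eq_zero hn (B *ᵥ x)
    have hyx : y ⬝ᵥ B *ᵥ x = 0 := by rw [dotProduct_comm, hxy]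
    have hxy' : x ⬝ᵥ B *ᵥ y = 0 := by rw [dotProduct_mulVec_comm hB, hyx]
    have hε : ∃ ε : K, ε ≠ 0 ∧ ε ≠ 1 := by
      by_contra hcon
      push Not at hcon
      have e1 : x ⬝ᵥ B *ᵥ x = 1 := hcon _ (haniso x hx)
      have e2 : y ⬝ᵥ B *ᵥ y = 1 := hcon _ (haniso y hy)
      have e3 : x + y ≠ 0 := by
        intro h0
        have : (B *ᵥ x) ⬝ᵥ (x + y) = 0 := by rw [h0, dotProduct_zero]
        rw [dotProduct_add, hxy, add_zero, dotProduct_comm, e1] at this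
        exact one_ne_zero this
      apply haniso _ e3
      rw [mulVec_add, dotProduct_add, add_dotProduct, add_dotProduct, e1, e2, hyx, hxy']
      linear_combination h2
    obtain ⟨ε, hε0, hε1⟩ := hε
    refine ⟨ε, hε0, hε1, ?_⟩
    have hx' := haniso x hx
    have hy' := haniso y hy
    rw [dsum_eq_reindex_swap]
    refine h.reindex_mem _ hB (Matrix.of ![x, y])
      (Γ := !![x ⬝ᵥ B *ᵥ x, 0; 0, y ⬝ᵥ B *ᵥ y])
      (Γ' := !![(x ⬝ᵥ B *ᵥ x)⁻¹, 0; 0, (y ⬝ᵥ B *ᵥ y)⁻¹]) ?_ ?_ ?_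
    · ext i j
      rw [of_mul_mul_transpose_apply]
      fin_cases i <;> fin_cases j <;> simp [hyx, hxy']
    · ext i j
      fin_cases i <;> fin_cases j <;> simp [hx', hy', Matrix.mul_apply]
    · ext i j
      fin_cases i <;> fin_cases j <;> simp [Matrix.mul_apply, mul_comm]
  · intro δ hδ
    by_cases hx : ∃ x, x ⬝ᵥ B *ᵥ x ≠ 0
    · obtain ⟨x, hx⟩ := hx
      exact Or.inl (h.reindex_diag_mem _ hB hx δ)
    · push Not at hx
      refine Or.inr ⟨!![0, δ; 1, 0], ?_, ?_⟩
      · rw [minpoly_companion_two, sub_eq_add_neg, ← C_neg, hneg]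
      · have hx' := hx (Pi.single i₀ 1)
        rw [single_dotProduct_mulVec_single] at hx'
        have hx'' := hx (Pi.single j₀ 1)
        rw [single_dotProduct_mulVec_single] at hx''
        have hji : B j₀ i₀ = B i₀ j₀ := by rw [← transpose_apply B, hB]
        refine h.reindex_mem (finSumFinEquiv.trans (finCongr _)) hB
          (Matrix.of ![Pi.single i₀ 1, Pi.single j₀ (B i₀ j₀)⁻¹])
          (Γ := !![0, 1; 1, 0]) (Γ' := !![0, 1; 1, 0]) ?_ ?_ ?_
        · have hs : (Pi.single j₀ (B i₀ j₀)⁻¹ : Fin n → K) = (B i₀ j₀)⁻¹ • Pi.single j₀ 1 := by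
            rw [← Pi.single_smul, smul_eq_mul, mul_one]
          ext i j
          rw [of_mul_mul_transpose_apply, hs]
          fin_cases i <;> fin_cases j <;>
            simp [mulVec_smul, hx', hx'', hij, hji]
        · ext i j
          fin_cases i <;> fin_cases j <;> simp [Matrix.mul_apply]
        · ext i j
          fin_cases i <;> fin_cases j <;> simp [Matrix.mul_apply]

/-- The corners obtained from a degenerate flexible form in characteristic not two. -/
theorem Flexible.corners_of_degenerate (h2 : (2 : K) ≠ 0) (e₁ : (n - 1) + 1 = n)
    {B : Matrix (Fin n) (Fin n) K} (h : Flexible Ω B) (hB : Bᵀ = B) (hB0 : B ≠ 0)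
    {y : Fin n → K} (hy : y ≠ 0) (hBy : B *ᵥ y = 0) :
    (∃ A ∈ SympCorner.PC Ω, SympCorner.IsTransvection A) ∧
      ∀ δ : K, SympCorner.dsum e₁ 1 !![δ] ∈ SympCorner.PC Ω := by
  obtain ⟨x, hx⟩ := exists_anisotropic h2 hB hB0
  refine ⟨h.exists_transvection hB hy (x := x) ?_ (Or.inl hBy), fun δ => ?_⟩
  · intro h0
    rw [h0, dotProduct_zero] at hx
    exact hx rfl
  · rw [dsum_eq_reindex_swap]
    exact h.reindex_diag_mem _ hB hx δ

end Corners

/-! ### The second invariant factor -/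

section InvariantFactors

variable {ι K : Type*} [Fintype ι] [DecidableEq ι] [Field K]

lemma detDivisor_dvd (A : Matrix ι ι K) (k : ℕ) (r c : Fin k → ι) :
    SympCorner.detDivisor A k ∣ (A.charmatrix.submatrix r c).det := by
  set I := Ideal.span (Set.range fun rc : (Fin k → ι) × (Fin k → ι) =>
      (A.charmatrix.submatrix rc.1 rc.2).det) with hI
  have hmem : (A.charmatrix.submatrix r c).det ∈ I := Ideal.subset_span ⟨(r, c), rfl⟩
  have h1 := (Submodule.IsPrincipal.mem_iff_generator_dvd I).1 hmem
  change Submodule.IsPrincipal.generator I *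
    C (Submodule.IsPrincipal.generator I).leadingCoeff⁻¹ ∣ _
  by_cases h0 : Submodule.IsPrincipal.generator I = 0
  · rw [h0, zero_mul]
    rwa [h0] at h1
  · have hu : IsUnit (C (Submodule.IsPrincipal.generator I).leadingCoeff⁻¹) := by
      rw [isUnit_C, isUnit_iff_ne_zero]
      exact inv_ne_zero (leadingCoeff_ne_zero.2 h0)
    exact hu.mul_right_dvd.2 h1

lemma dvd_detDivisor (A : Matrix ι ι K) (k : ℕ) (p : K[X])
    (hp : ∀ r c : Fin k → ι, p ∣ (A.charmatrix.submatrix r c).det) :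
    p ∣ SympCorner.detDivisor A k := by
  set I := Ideal.span (Set.range fun rc : (Fin k → ι) × (Fin k → ι) =>
      (A.charmatrix.submatrix rc.1 rc.2).det) with hI
  change p ∣ Submodule.IsPrincipal.generator I *
    C (Submodule.IsPrincipal.generator I).leadingCoeff⁻¹
  apply Dvd.dvd.mul_right
  have h1 : I ≤ Ideal.span {p} := by
    rw [hI, Ideal.span_le]
    rintro _ ⟨rc, rfl⟩
    exact Ideal.mem_span_singleton.2 (hp _ _)
  exact Ideal.mem_span_singleton.1 (h1 (Submodule.IsPrincipal.generator_mem I))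

lemma detDivisor_one {A : Matrix ι ι K} (hA : ¬ SympCorner.IsScalarMat A) :
    SympCorner.detDivisor A 1 = 1 := by
  -- some nonzero constant is a combination of entries of `X - A`
  have hunit : IsUnit (SympCorner.detDivisor A 1) := by
    have hentry : ∀ i j, SympCorner.detDivisor A 1 ∣ A.charmatrix i j := fun i j => by
      have := detDivisor_dvd A 1 (fun _ => i) (fun _ => j)
      rwa [det_fin_one, submatrix_apply] at this
    by_cases hoff : ∃ i j, i ≠ j ∧ A i j ≠ 0
    · obtain ⟨i, j, hij, h0⟩ := hoff
      have := hentry i j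
      rw [charmatrix_apply_ne _ _ _ hij] at this
      refine isUnit_of_dvd_unit this ?_
      rw [IsUnit.neg_iff, isUnit_C]
      exact isUnit_iff_ne_zero.2 h0
    · push Not at hoff
      by_contra hnu
      apply hA
      have hdiag : ∀ i j, A i i = A j j := by
        intro i j
        by_contra hne
        have := dvd_sub (hentry i i) (hentry j j)
        rw [charmatrix_apply_eq, charmatrix_apply_eq, sub_sub_sub_cancel_left, ← C_sub] at this
        refine hnu (isUnit_of_dvd_unit this ?_)
        rw [isUnit_C]
        exact isUnit_iff_ne_zero.2 (sub_ne_zero.2 (Ne.symm hne))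
      rcases isEmpty_or_nonempty ι with he | ⟨⟨i₀⟩⟩
      · exact ⟨0, Subsingleton.elim _ _⟩
      · refine ⟨A i₀ i₀, ?_⟩
        ext i j
        by_cases hij : i = j
        · subst hij
          simp [hdiag i i₀]
        · simp [hij, hoff i j hij]
  refine Monic.eq_one_of_isUnit ?_ hunit
  obtain ⟨d, hd⟩ : ∃ d : K[X], SympCorner.detDivisor A 1 = d * C d.leadingCoeff⁻¹ := ⟨_, rfl⟩
  have h1 := hunit.ne_zero
  rw [hd] at h1 ⊢
  exact monic_mul_leadingCoeff_inv (left_ne_zero_of_mul h1)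

lemma invFactor_two {A : Matrix ι ι K} (hA : ¬ SympCorner.IsScalarMat A) :
    SympCorner.invFactor A 2 = SympCorner.detDivisor A 2 := by
  rw [SympCorner.invFactor, show 2 - 1 = 1 from rfl, detDivisor_one hA, EuclideanDomain.div_one]

lemma eval_charmatrix_minor (A : Matrix ι ι K) (a : K) (r c : Fin 2 → ι) :
    ((A.charmatrix.submatrix r c).det).eval a =
      (A - a • 1) (r 0) (c 0) * (A - a • 1) (r 1) (c 1) -
        (A - a • 1) (r 0) (c 1) * (A - a • 1) (r 1) (c 0) := by
  have h1 : ∀ i j, (A.charmatrix i j).eval a = -(A - a • 1) i j := by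
    intro i j
    by_cases hij : i = j
    · subst hij
      simp [charmatrix_apply_eq]
    · simp [hij]
  rw [det_fin_two]
  simp only [submatrix_apply, eval_sub, eval_mul, h1]
  ring

/-- If the second invariant factor vanishes at `a`, then `A - a` has rank at most one. -/
lemma exists_vecMulVec_of_dvd {A : Matrix ι ι K} (hA : ¬ SympCorner.IsScalarMat A) {a : K}
    (h : X - C a ∣ SympCorner.invFactor A 2) : ∃ u v : ι → K, A - a • 1 = vecMulVec u v := by
  rw [invFactor_two hA] at h
  obtain ⟨i₀, j₀, h0⟩ : ∃ i j, (A - a • 1) i j ≠ 0 := by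
    by_contra hcon
    push Not at hcon
    exact hA ⟨a, sub_eq_zero.1 (Matrix.ext hcon)⟩
  refine ⟨fun i => (A - a • 1) i j₀, fun j => (A - a • 1) i₀ j / (A - a • 1) i₀ j₀, ?_⟩
  ext i j
  have h1 := dvd_iff_isRoot.1 (h.trans (detDivisor_dvd A 2 ![i, i₀] ![j, j₀]))
  rw [IsRoot, eval_charmatrix_minor] at h1
  rw [vecMulVec_apply, ← mul_div_assoc, eq_div_iff h0]
  simpa [sub_eq_zero] using h1

/-- Conversely, a matrix `A` with `A - a` of rank at most one has a nontrivial second invariant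
factor. -/
lemma invFactor_two_ne_one {A : Matrix ι ι K} (hA : ¬ SympCorner.IsScalarMat A) {a : K}
    {u v : ι → K} (h : A - a • 1 = vecMulVec u v) : SympCorner.invFactor A 2 ≠ 1 := by
  intro h1
  rw [invFactor_two hA] at h1
  have h2 : X - C a ∣ SympCorner.detDivisor A 2 := by
    refine dvd_detDivisor A 2 _ fun r c => ?_
    rw [dvd_iff_isRoot, IsRoot, eval_charmatrix_minor, h]
    simp only [vecMulVec_apply]
    ring
  rw [h1] at h2
  exact not_isUnit_X_sub_C a (isUnit_of_dvd_one h2)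

end InvariantFactors

/-! ### Matrices that are not primary -/

section NotPrimary

variable {ι K : Type*} [Fintype ι] [DecidableEq ι] [Field K]

lemma aeval_mulVec_of_eigenvector {A : Matrix ι ι K} {η : K} {v : ι → K} (hv : A *ᵥ v = η • v)
    (f : K[X]) : aeval A f *ᵥ v = f.eval η • v := by
  have hpow : ∀ m : ℕ, (A ^ m) *ᵥ v = η ^ m • v := by
    intro m
    induction m with
    | zero => simp
    | succ m ih => rw [pow_succ, ← mulVec_mulVec, hv, mulVec_smul, ih, smul_smul, pow_succ']
  induction f using Polynomial.induction_on' with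
  | add p q hp hq => rw [map_add, add_mulVec, hp, hq, eval_add, add_smul]
  | monomial m a =>
    rw [aeval_monomial, ← mulVec_mulVec, hpow, eval_monomial, Algebra.algebraMap_eq_smul_one,
      smul_mulVec, one_mulVec, smul_smul]

/-- A matrix with an eigenvalue `η` is not primary if it is singular on a factor coprime to
`X - η`. -/
lemma not_isPrimary {A : Matrix ι ι K} {η : K} {v u : ι → K} (hv : v ≠ 0)
    (hAv : A *ᵥ v = η • v) (f : K[X]) (hu : u ≠ 0) (hfu : aeval A f *ᵥ u = 0)
    (hf : f.eval η ≠ 0) : ¬ SympCorner.IsPrimary A := by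
  rintro ⟨p, m, hp, hm⟩
  have h1 : aeval A (p ^ m) = 0 := by rw [← hm, minpoly.aeval]
  have h2 : p.eval η = 0 := by
    have h3 := aeval_mulVec_of_eigenvector hAv (p ^ m)
    rw [h1, zero_mulVec, eval_pow] at h3
    exact eq_zero_of_pow_eq_zero ((smul_eq_zero.1 h3.symm).resolve_right hv)
  have h4 : Associated (X - C η) p :=
    (irreducible_X_sub_C η).associated_of_dvd hp (dvd_iff_isRoot.2 h2)
  have h5 : ¬ p ∣ f := fun h => hf (dvd_iff_isRoot.1 (h4.dvd.trans h))
  obtain ⟨a, b, hab⟩ : IsCoprime (p ^ m) f := IsCoprime.pow_left (hp.coprime_iff_not_dvd.2 h5)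
  apply hu
  have h6 := congrArg (fun q => aeval A q *ᵥ u) hab
  simp only [map_add, map_mul, h1, mul_zero, zero_add, map_one, one_mulVec] at h6
  rw [← h6, ← mulVec_mulVec, hfu, mulVec_zero]

lemma not_isPrimary_of_eigenvectors {A : Matrix ι ι K} {η μ : K} {v u : ι → K} (hv : v ≠ 0)
    (hAv : A *ᵥ v = η • v) (hu : u ≠ 0) (hAu : A *ᵥ u = μ • u) (h : η ≠ μ) :
    ¬ SympCorner.IsPrimary A :=
  not_isPrimary hv hAv (X - C μ) hu
    (by rw [aeval_mulVec_of_eigenvector hAu]; simp) (by simpa [sub_eq_zero] using h)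

lemma diagonal_mulVec_single_one (d : ι → K) (i : ι) :
    diagonal d *ᵥ Pi.single i 1 = d i • Pi.single i 1 := by
  rw [diagonal_mulVec_single, mul_one, ← Pi.single_smul, smul_eq_mul, mul_one]

/-- The entries at two places of a tuple can be chosen to obtain a given product and an entry
that differs from the first one. -/
lemma exists_prod_eq {n : ℕ} (h2 : (2 : K) ≠ 0) {i j : Fin n} (hij : i ≠ j) {t : Fin n → K}
    (ht : ∀ k, t k ≠ 0) {δ : K} (hδ : δ ≠ 0) (hn : 3 ≤ n ∨ Nat.card K ≠ 3 ∨ δ ≠ 1) :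
    ∃ d : Fin n → K, (∀ k, k ≠ i → k ≠ j → d k = t k) ∧ ∏ k, d k = δ ∧ ∃ k, k ≠ i ∧ d i ≠ d k := by
  set π := ∏ k ∈ (Finset.univ.erase i).erase j, t k with hπ
  have hπ0 : π ≠ 0 := Finset.prod_ne_zero_iff.2 fun k _ => ht k
  have main : ∀ a : K, a ≠ 0 → ∃ d : Fin n → K, (∀ k, k ≠ i → k ≠ j → d k = t k) ∧
      ∏ k, d k = δ ∧ d i = a ∧ d j = δ / (a * π) := by
    intro a ha
    refine ⟨fun k => if k = i then a else if k = j then δ / (a * π) else t k, ?_, ?_, by simp,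
      by simp [hij.symm]⟩
    · intro k hki hkj
      simp [hki, hkj]
    · rw [← Finset.mul_prod_erase _ _ (Finset.mem_univ i),
        ← Finset.mul_prod_erase _ _ (Finset.mem_erase.2 ⟨hij.symm, Finset.mem_univ j⟩)]
      have h3 : ∏ k ∈ (Finset.univ.erase i).erase j,
          (if k = i then a else if k = j then δ / (a * π) else t k) = π := by
        refine Finset.prod_congr rfl fun k hk => ?_
        rw [Finset.mem_erase, Finset.mem_erase] at hk
        rw [if_neg hk.2.1, if_neg hk.1]
      rw [h3]
      simp only [if_true, if_neg hij.symm]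
      field_simp
  by_cases hk : ∃ k, k ≠ i ∧ k ≠ j
  · obtain ⟨k, hki, hkj⟩ := hk
    obtain ⟨a, ha0, ha⟩ : ∃ a : K, a ≠ 0 ∧ a ≠ t k := by
      by_cases h1 : t k = 1
      · refine ⟨-1, neg_ne_zero.2 one_ne_zero, fun h => h2 ?_⟩
        rw [h1] at h
        linear_combination -h
      · exact ⟨1, one_ne_zero, fun h => h1 h.symm⟩
    obtain ⟨d, h3, h4, h5, -⟩ := main a ha0
    exact ⟨d, h3, h4, k, hki, by rw [h5, h3 k hki hkj]; exact ha⟩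
  · push Not at hk
    have hempty : (Finset.univ.erase i).erase j = ∅ := by
      ext k
      simp only [Finset.mem_erase, Finset.mem_univ, and_true, Finset.notMem_empty, iff_false,
        not_and, not_not]
      intro hkj
      by_contra hki
      exact hkj (hk k hki)
    have hπ1 : π = 1 := by rw [hπ, hempty, Finset.prod_empty]
    have hn2 : ¬ 3 ≤ n := by
      intro h3
      have h4 := congrArg Finset.card hempty
      rw [Finset.card_erase_of_mem (Finset.mem_erase.2 ⟨hij.symm, Finset.mem_univ j⟩),
        Finset.card_erase_of_mem (Finset.mem_univ i), Finset.card_univ, Fintype.card_fin,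
        Finset.card_empty] at h4
      omega
    -- for `n = 2` the entries are `a` and `δ / a`, which are always equal only over `GF(3)` with
    -- `δ = 1`
    obtain ⟨a, ha0, ha⟩ : ∃ a : K, a ≠ 0 ∧ a * a ≠ δ := by
      by_cases h1 : δ = 1
      · by_contra hcon
        push Not at hcon
        have h3 : Nat.card K = 3 := by
          rw [← Set.ncard_univ, Set.ncard_eq_three]
          refine ⟨0, 1, -1, zero_ne_one, (neg_ne_zero.2 one_ne_zero).symm, fun h => h2 ?_, ?_⟩
          · linear_combination h
          · ext a
            simp only [Set.mem_univ, Set.mem_insert_iff, Set.mem_singleton_iff, true_iff]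
            by_cases ha : a = 0
            · exact Or.inl ha
            · right
              have h5 := hcon a ha
              rw [h1] at h5
              exact mul_self_eq_one_iff.1 h5
        rcases hn with h | h | h
        · exact hn2 h
        · exact h h3
        · exact h h1
      · exact ⟨1, one_ne_zero, by rw [one_mul]; exact Ne.symm h1⟩
    obtain ⟨d, h3, h4, h5, h6⟩ := main a ha0
    refine ⟨d, h3, h4, j, hij.symm, ?_⟩
    rw [h5, h6, hπ1, mul_one, Ne, eq_div_iff ha0]
    exact ha

end NotPrimary

/-! ### Diagonal symmetric blocks -/

section Diagonal

variable {n : ℕ} {K : Type*} [Field K]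

lemma SympConj.exists_eq {M N : Matrix (Fin n ⊕ Fin n) (Fin n ⊕ Fin n) K} (h : SympConj M N) :
    ∃ Q Q', Q * Q' = 1 ∧ Q' * Q = 1 ∧ M = Q * N * Q' := by
  obtain ⟨Q, hQ, e⟩ := h
  have h1 : ((⟨Q, hQ⟩ * ⟨Q, hQ⟩⁻¹ : symplecticGroup (Fin n) K) :
      Matrix (Fin n ⊕ Fin n) (Fin n ⊕ Fin n) K) = 1 := by rw [mul_inv_cancel]; rfl
  rw [Submonoid.coe_mul] at h1
  refine ⟨Q, _, h1, mul_eq_one_comm.1 h1, ?_⟩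
  rw [← e, mul_assoc, h1, mul_one]

/-- A symplectic matrix conjugate to `η + u vᵀ` has this form itself. -/
lemma SympConj.exists_vecMulVec {M N : Matrix (Fin n ⊕ Fin n) (Fin n ⊕ Fin n) K}
    (h : SympConj M N) {η : K} {u v : Fin n ⊕ Fin n → K} (hN : N - η • 1 = vecMulVec u v) :
    ∃ u' v', M - η • 1 = vecMulVec u' v' := by
  obtain ⟨Q, Q', h1, -, rfl⟩ := h.exists_eq
  refine ⟨Q *ᵥ u, v ᵥ* Q', ?_⟩
  rw [← vecMulVec_mul, ← mul_vecMulVec, ← hN, Matrix.mul_sub, Matrix.sub_mul, Matrix.mul_smul,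
    Matrix.smul_mul, mul_one, h1]

lemma linearIndependent_sum_of_submodules {V α β γ : Type*} [AddCommGroup V] [Module K V]
    {W E₁ E₂ : Submodule K V} {v : α → W} {b₁ : β → E₁} {b₂ : γ → E₂}
    (hv : LinearIndependent K v) (h₁ : LinearIndependent K b₁) (h₂ : LinearIndependent K b₂)
    (hW : Disjoint W (E₁ ⊔ E₂)) (hE : Disjoint E₁ E₂) :
    LinearIndependent K (Sum.elim (Sum.elim (fun i => (v i : V)) fun i => (b₁ i : V))
      fun i => (b₂ i : V)) := by
  have hspan₁ : Submodule.span K (Set.range fun i => (b₁ i : V)) ≤ E₁ := by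
    rw [Submodule.span_le]
    rintro _ ⟨i, rfl⟩
    exact (b₁ i).2
  have hspan₂ : Submodule.span K (Set.range fun i => (b₂ i : V)) ≤ E₂ := by
    rw [Submodule.span_le]
    rintro _ ⟨i, rfl⟩
    exact (b₂ i).2
  have hspan₀ : Submodule.span K (Set.range fun i => (v i : V)) ≤ W := by
    rw [Submodule.span_le]
    rintro _ ⟨i, rfl⟩
    exact (v i).2
  have hsum : Submodule.span K (Set.range
      (Sum.elim (fun i => (v i : V)) fun i => (b₁ i : V))) ≤ W ⊔ E₁ := by
    rw [Submodule.span_le]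
    rintro _ ⟨i | i, rfl⟩
    · exact Submodule.mem_sup_left (v i).2
    · exact Submodule.mem_sup_right (b₁ i).2
  have hdisj : Disjoint (W ⊔ E₁) E₂ := hE.disjoint_sup_left_of_disjoint_sup_right hW
  have hli : LinearIndependent K (Sum.elim (fun i => (v i : V)) fun i => (b₁ i : V)) :=
    LinearIndependent.sum_type (hv.map' W.subtype (Submodule.ker_subtype _))
      (h₁.map' E₁.subtype (Submodule.ker_subtype _))
      ((hW.mono_right le_sup_left).mono hspan₀ hspan₁)
  exact LinearIndependent.sum_type hli (h₂.map' E₂.subtype (Submodule.ker_subtype _))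
    (hdisj.mono hsum hspan₂)

/-- An orthogonal basis for a symmetric matrix whose kernel is decomposed into two summands
contains bases of both. -/
lemma exists_orthogonal_basis_of_ker (h2 : (2 : K) ≠ 0) {C : Matrix (Fin n) (Fin n) K}
    (hC : Cᵀ = C) {E₁ E₂ : Submodule K (Fin n → K)} (hE : Disjoint E₁ E₂)
    (hsup : E₁ ⊔ E₂ = LinearMap.ker (toLin' C)) :
    ∃ f : Fin n → Fin n → K, LinearIndependent K f ∧
      (∀ i j, i ≠ j → f i ⬝ᵥ C *ᵥ f j = 0) ∧
      ∀ i, f i ∈ E₁ ∨ f i ∈ E₂ ∨ C *ᵥ f i ≠ 0 := by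
  obtain ⟨W, hW⟩ := (LinearMap.ker (toLin' C)).exists_isCompl
  have : Invertible (2 : K) := invertibleOfNonzero h2
  have hsymm : LinearMap.IsSymm ((toBilin' C).restrict W) := ⟨fun x y => by
    simp only [LinearMap.BilinForm.restrict_apply, toBilin'_apply', RingHom.id_apply,
      LinearMap.domRestrict_apply]
    exact dotProduct_mulVec_comm hC _ _⟩
  obtain ⟨v, hv⟩ := LinearMap.BilinForm.exists_orthogonal_basis hsymm
  have hv' : ∀ k l, k ≠ l → (v k : Fin n → K) ⬝ᵥ C *ᵥ (v l : Fin n → K) = 0 := by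
    intro k l hkl
    rw [← toBilin'_apply']
    exact hv hkl
  obtain ⟨b₁⟩ : Nonempty (Module.Basis (Fin (Module.finrank K E₁)) K E₁) :=
    ⟨Module.finBasis K E₁⟩
  obtain ⟨b₂⟩ : Nonempty (Module.Basis (Fin (Module.finrank K E₂)) K E₂) :=
    ⟨Module.finBasis K E₂⟩
  have hf := linearIndependent_sum_of_submodules v.linearIndependent b₁.linearIndependent
    b₂.linearIndependent (by rw [hsup]; exact hW.disjoint.symm) hE
  have hcard : Module.finrank K W + Module.finrank K E₁ + Module.finrank K E₂ = n := by
    have h3 := Submodule.finrank_sup_add_finrank_inf_eq E₁ E₂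
    rw [hE.eq_bot, hsup, finrank_bot] at h3
    have h4 := Submodule.finrank_add_eq_of_isCompl hW
    rw [Module.finrank_fintype_fun_eq_card, Fintype.card_fin] at h4
    omega
  obtain ⟨τ⟩ : Nonempty (Fin n ≃ (Fin (Module.finrank K W) ⊕ Fin (Module.finrank K E₁)) ⊕
      Fin (Module.finrank K E₂)) :=
    ⟨Fintype.equivOfCardEq (by simp only [Fintype.card_fin, Fintype.card_sum]; omega)⟩
  have hker₁ : ∀ x ∈ E₁, C *ᵥ x = 0 := fun x hx => by
    have : x ∈ LinearMap.ker (toLin' C) := hsup ▸ Submodule.mem_sup_left hx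
    simpa using this
  have hker₂ : ∀ x ∈ E₂, C *ᵥ x = 0 := fun x hx => by
    have : x ∈ LinearMap.ker (toLin' C) := hsup ▸ Submodule.mem_sup_right hx
    simpa using this
  refine ⟨_, hf.comp τ τ.injective, ?_, ?_⟩
  · intro i j hij
    have hij' := fun h => hij (τ.injective h)
    simp only [Function.comp_apply]
    generalize τ i = p at hij' ⊢
    generalize τ j = q at hij' ⊢
    rcases q with (l | l) | l
    · rcases p with (k | k) | k
      · exact hv' k l fun h => hij' (by rw [h])
      · rw [dotProduct_mulVec_comm hC]
        simp only [Sum.elim_inl, Sum.elim_inr, hker₁ _ (b₁ k).2, dotProduct_zero]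
      · rw [dotProduct_mulVec_comm hC]
        simp only [Sum.elim_inr, hker₂ _ (b₂ k).2, dotProduct_zero]
    · simp only [Sum.elim_inl, Sum.elim_inr, hker₁ _ (b₁ l).2, dotProduct_zero]
    · simp only [Sum.elim_inr, hker₂ _ (b₂ l).2, dotProduct_zero]
  · intro i
    have h0 := hf.ne_zero (τ i)
    simp only [Function.comp_apply]
    revert h0
    rcases τ i with (k | k) | k
    · intro h0
      refine Or.inr (Or.inr fun h4 => h0 ?_)
      exact Submodule.disjoint_def.1 hW.disjoint _ (by simpa using h4) (v k).2
    · exact fun _ => Or.inl (b₁ k).2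
    · exact fun _ => Or.inr (Or.inl (b₂ k).2)

/-- The block form of adapted subspaces for bases that diagonalize the symmetric form; the basis
vectors in the radical are eigenvectors for `1` or `-1`.  The values `e i` with `c i ≠ 0` are
meaningless. -/
theorem exists_sympConj_diagonal (h2 : (2 : K) ≠ 0) (M : symplecticGroup (Fin n) K) :
    ∃ (A B D : Matrix (Fin n) (Fin n) K) (c e : Fin n → K),
      SympConj (M : Matrix (Fin n ⊕ Fin n) (Fin n ⊕ Fin n) K) (fromBlocks A B (diagonal c) D) ∧
      (∀ i, c i = 0 → (e i = 1 ∨ e i = -1) ∧ A *ᵥ Pi.single i 1 = e i • Pi.single i 1) ∧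
      (c = 0 → M * M = 1) := by
  classical
  obtain ⟨A, B, C, D, hconj, hC, hfix, hinv⟩ := exists_sympConj_adapted M
  have heig : ∀ (t : K) (x : Fin n → K),
      x ∈ LinearMap.ker (toLin' C) ⊓ LinearMap.ker (toLin' (A - t • 1)) ↔
      C *ᵥ x = 0 ∧ A *ᵥ x = t • x := by
    intro t x
    simp only [Submodule.mem_inf, LinearMap.mem_ker, toLin'_apply, sub_mulVec, smul_mulVec,
      one_mulVec, sub_eq_zero]
  obtain ⟨f, hf, horth, hmem⟩ := exists_orthogonal_basis_of_ker h2 hC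
    (E₁ := LinearMap.ker (toLin' C) ⊓ LinearMap.ker (toLin' (A - (1 : K) • 1)))
    (E₂ := LinearMap.ker (toLin' C) ⊓ LinearMap.ker (toLin' (A - (-1 : K) • 1)))
    (by
      rw [Submodule.disjoint_def]
      intro x hx hx'
      have h3 := ((heig 1 x).1 hx).2
      rw [((heig (-1) x).1 hx').2] at h3
      have h4 : (2 : K) • x = 0 := by
        rw [one_smul, neg_one_smul] at h3
        rw [two_smul]
        nth_rewrite 1 [← h3]
        rw [neg_add_cancel]
      exact (smul_eq_zero.1 h4).resolve_left h2)
    (by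
      apply le_antisymm (sup_le inf_le_left inf_le_left)
      intro x hx
      obtain ⟨a, b, rfl, h3, h4, h5, h6⟩ := hfix x (by simpa using hx)
      exact Submodule.add_mem_sup ((heig _ _).2 ⟨h3, by rw [h5, one_smul]⟩)
        ((heig _ _).2 ⟨h4, by rw [h6, neg_one_smul]⟩))
  simp only [heig] at hmem
  set g : Matrix (Fin n) (Fin n) K := (Matrix.of f)ᵀ with hg
  have hgcol : ∀ i, g *ᵥ Pi.single i 1 = f i := fun i => by
    rw [mulVec_single_one]; rfl
  have hunit : IsUnit g := by
    rw [← mulVec_injective_iff_isUnit, mulVec_injective_iff]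
    exact hf
  obtain ⟨g', hg'⟩ := hunit.exists_left_inv
  have hg'' : g * g' = 1 := mul_eq_one_comm.1 hg'
  have hgt : g'ᵀ * gᵀ = 1 := by rw [← transpose_mul, hg'', transpose_one]
  have hCf : ∀ i j, (gᵀ * C * g) i j = f i ⬝ᵥ C *ᵥ f j := fun i j =>
    of_mul_mul_transpose_apply C f i j
  have hdiag : gᵀ * C * g = diagonal fun i => (gᵀ * C * g) i i := by
    ext i j
    by_cases hij : i = j
    · subst hij
      rw [diagonal_apply_eq]
    · rw [diagonal_apply_ne _ hij, hCf, horth i j hij]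
  have hAeig : ∀ (i : Fin n) (t : K), A *ᵥ f i = t • f i →
      (g' * A * g) *ᵥ Pi.single i 1 = t • Pi.single i 1 := by
    intro i t ht
    rw [← mulVec_mulVec, hgcol, ← mulVec_mulVec, ht, mulVec_smul, ← hgcol, mulVec_mulVec, hg',
      one_mulVec]
  refine ⟨g' * A * g, g' * B * g'ᵀ, gᵀ * D * g'ᵀ, fun i => (gᵀ * C * g) i i,
    fun i => if A *ᵥ f i = (1 : K) • f i then 1 else -1, ?_, ?_, ?_⟩
  · rw [← hdiag]
    exact hconj.trans (SympConj.levi A B C D hg')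
  · intro i hi
    replace hi : (gᵀ * C * g) i i = 0 := hi
    have h4 : C *ᵥ f i = 0 := by
      have h3 : (gᵀ * C * g) *ᵥ Pi.single i 1 = 0 := by
        rw [hdiag, diagonal_mulVec_single_one, hi, zero_smul]
      have h5 := congrArg (fun x => g'ᵀ *ᵥ x) h3
      simp only [mulVec_zero] at h5
      rw [mulVec_mulVec, ← mul_assoc, ← mul_assoc, hgt, one_mul, ← mulVec_mulVec, hgcol] at h5
      exact h5
    beta_reduce
    by_cases h1 : A *ᵥ f i = (1 : K) • f i
    · rw [if_pos h1]
      exact ⟨Or.inl rfl, hAeig i 1 h1⟩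
    · rw [if_neg h1]
      refine ⟨Or.inr rfl, hAeig i (-1) ?_⟩
      rcases hmem i with h | h | h
      · exact absurd h.2 h1
      · exact h.2
      · exact absurd h4 h
  · intro hc
    apply hinv
    have h3 : gᵀ * C * g = 0 := by
      rw [hdiag, hc]
      exact diagonal_zero
    calc C = (g'ᵀ * gᵀ) * C * (g * g') := by rw [hgt, hg'', one_mul, mul_one]
      _ = g'ᵀ * (gᵀ * C * g) * g' := by simp only [mul_assoc]
      _ = 0 := by rw [h3, mul_zero, zero_mul]

end Diagonal

/-! ### Corners of classes with trivial second invariant factor -/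

section Corners

variable {n : ℕ} {K : Type*} [Field K] {Ω : ConjClasses (symplecticGroup (Fin n) K)}
  {M : symplecticGroup (Fin n) K}

lemma mulVec_eq_of_mulVec_single_eq {X A : Matrix (Fin n) (Fin n) K} {x : Fin n → K}
    (h : ∀ i, x i ≠ 0 → X *ᵥ Pi.single i 1 = A *ᵥ Pi.single i 1) : X *ᵥ x = A *ᵥ x := by
  funext i
  change ∑ j, X i j * x j = ∑ j, A i j * x j
  refine Finset.sum_congr rfl fun j _ => ?_
  by_cases hj : x j = 0
  · rw [hj, mul_zero, mul_zero]
  · have h1 := congrFun (h j hj) i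
    rw [mulVec_single_one, mulVec_single_one] at h1
    change X i j = A i j at h1
    rw [h1]

lemma SympConj.corner_mem_PC (hM : M ∈ Ω.carrier) {A B C D X : Matrix (Fin n) (Fin n) K}
    (h : SympConj (M : Matrix (Fin n ⊕ Fin n) (Fin n ⊕ Fin n) K) (fromBlocks A B C D))
    (hX : Cᵀ * X = Xᵀ * C)
    (hker : ∀ x i, C *ᵥ x = 0 → x i ≠ 0 → X *ᵥ Pi.single i 1 = A *ᵥ Pi.single i 1) :
    X ∈ SympCorner.PC Ω := by
  obtain ⟨B', D', h1⟩ := exists_sympConj_corner (h.mem M.2) hX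
    fun x hx => mulVec_eq_of_mulVec_single_eq fun i => hker x i hx
  exact SympConj.mem_PC hM (h.trans h1)

lemma diagonal_mul_transvection {i k : Fin n} (hik : i ≠ k) (c q s : K) :
    diagonal (c • Pi.single i 1 - Pi.single k q) * transvection i k s =
      vecMulVec (c • Pi.single i 1) (Pi.single i 1) +
        (s • vecMulVec (c • Pi.single i 1) (Pi.single k 1) -
          q • vecMulVec (Pi.single k 1) (Pi.single k 1)) := by
  ext a b
  rw [diagonal_mul]
  simp only [transvection, Matrix.add_apply, Matrix.sub_apply, Matrix.smul_apply, vecMulVec_apply,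
    Pi.smul_apply, smul_eq_mul, Pi.sub_apply]
  by_cases hai : a = i
  · subst hai
    simp only [Pi.single_eq_same, Pi.single_eq_of_ne hik, one_apply, Matrix.single_apply,
      Pi.single_apply, true_and, eq_comm (a := b)]
    split_ifs <;> ring
  · by_cases hak : a = k
    · subst hak
      simp only [Pi.single_eq_same, Pi.single_eq_of_ne hai, one_apply, Matrix.single_apply,
        Pi.single_apply, Ne.symm hai, false_and, if_false, eq_comm (a := b)]
      ring
    · simp only [Pi.single_eq_of_ne hai, Pi.single_eq_of_ne hak]
      ring

/-- The case that all but one of the diagonal entries of the symmetric block vanish and the corner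
is scalar.  The upper right block `B` is symmetric and not zero, and a change of the Lagrangian
subspace along an anisotropic vector `g` of `B` raises the rank of the lower left block to two. -/
lemma exists_corner_of_scalar (h2 : (2 : K) ≠ 0) (hn2 : 2 ≤ n) (hM : M ∈ Ω.carrier)
    {η δ c₀ : K} {i : Fin n} {B D : Matrix (Fin n) (Fin n) K}
    (h : SympConj (M : Matrix (Fin n ⊕ Fin n) (Fin n ⊕ Fin n) K)
      (fromBlocks (η • 1) B (diagonal (Pi.single i c₀)) D))
    (hη : η * η = 1) (hc : c₀ ≠ 0)
    (hrk : ∀ u v, (M : Matrix (Fin n ⊕ Fin n) (Fin n ⊕ Fin n) K) - η • 1 ≠ vecMulVec u v)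
    (hδ : δ ≠ 0) (hn : 3 ≤ n ∨ Nat.card K ≠ 3 ∨ δ ≠ 1) :
    ∃ A ∈ SympCorner.PC Ω, ¬ SympCorner.IsPrimary A ∧ A.det = δ := by
  have hη0 : η ≠ 0 := fun h0 => by rw [h0, zero_mul] at hη; exact zero_ne_one hη
  set C : Matrix (Fin n) (Fin n) K := diagonal (Pi.single i c₀) with hCdef
  have hCt : Cᵀ = C := diagonal_transpose _
  have hCv : C = vecMulVec (Pi.single i c₀) (Pi.single i 1) := by
    rw [hCdef]
    ext a b
    simp only [diagonal_apply, vecMulVec_apply, Pi.single_apply]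
    split_ifs <;> simp_all
  obtain ⟨-, hBD, hAD⟩ := SymplecticGroup.fromBlocks_mem_iff.1 (h.mem M.2)
  have hD : D = η • (1 + C * B) := by
    rw [hCt, transpose_smul, transpose_one, Matrix.smul_mul, one_mul, sub_eq_iff_eq_add] at hAD
    rw [← hAD, smul_smul, hη, one_smul]
  have hB : Bᵀ = B := by
    rw [hD, transpose_smul, Matrix.mul_smul, Matrix.smul_mul, transpose_add, transpose_one,
      transpose_mul, hCt, Matrix.mul_add, Matrix.add_mul, mul_one, one_mul, mul_assoc] at hBD
    exact add_right_cancel (smul_right_injective _ hη0 hBD)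
  have hB0 : B ≠ 0 := by
    rintro rfl
    obtain ⟨u, v, huv⟩ := h.exists_vecMulVec (η := η)
      (u := Sum.elim (0 : Fin n → K) (Pi.single i c₀))
      (v := Sum.elim (Pi.single i 1) (0 : Fin n → K)) (by
        rw [hD, mul_zero, add_zero, ← fromBlocks_one, fromBlocks_smul, hCv]
        ext a b
        rcases a with a | a <;> rcases b with b | b <;>
          simp [vecMulVec_apply, -Sum.elim_single_zero, -Sum.elim_zero_single])
    exact hrk u v huv
  -- an anisotropic vector outside of the line spanned by the `i`-th unit vector
  obtain ⟨g, k, hki, hgk, hq⟩ : ∃ (g : Fin n → K) (k : Fin n), k ≠ i ∧ g k ≠ 0 ∧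
      g ⬝ᵥ B *ᵥ g ≠ 0 := by
    obtain ⟨x, hx⟩ := exists_anisotropic h2 hB hB0
    by_cases hxk : ∃ k, k ≠ i ∧ x k ≠ 0
    · obtain ⟨k, hki, hk⟩ := hxk
      exact ⟨x, k, hki, hk, hx⟩
    · push Not at hxk
      have : Nontrivial (Fin n) := Fin.nontrivial_iff_two_le.2 hn2
      obtain ⟨k, hki⟩ := exists_ne i
      have hxk := hxk k hki
      set s : Fin n → K := Pi.single k 1 with hs
      -- one of `s`, `x + s`, `x - s` is anisotropic, by the parallelogram identity
      by_contra hcon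
      push Not at hcon
      have e1 := hcon s k hki (by simp [hs])
      have e2 := hcon (x + s) k hki (by simp [hs, hxk])
      have e3 := hcon (x - s) k hki (by simp [hs, hxk])
      rw [mulVec_add, add_dotProduct, dotProduct_add, dotProduct_add, e1] at e2
      rw [mulVec_sub, sub_dotProduct, dotProduct_sub, dotProduct_sub, e1] at e3
      have e4 : (2 : K) * (x ⬝ᵥ B *ᵥ x) = 0 := by linear_combination e2 + e3
      exact hx ((mul_eq_zero.1 e4).resolve_left h2)
  set q := g ⬝ᵥ B *ᵥ g with hqdef
  set κ := (B *ᵥ g) i with hκ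
  have h1 := h.trans (SympConj.lower (η • 1) B C D (S := vecMulVec g g) (transpose_vecMulVec g g))
  -- the matrix that replaces the `k`-th vector of the standard basis by `g`
  obtain ⟨p, p', hpp, hpi, hpk⟩ : ∃ p p' : Matrix (Fin n) (Fin n) K, p' * p = 1 ∧
      Pi.single i 1 ᵥ* p = Pi.single i 1 ∧ g ᵥ* p = Pi.single k 1 := by
    set p' : Matrix (Fin n) (Fin n) K := updateRow 1 k g with hp'
    have hdet : p'.det = g k := by
      have := det_updateRow_sum (1 : Matrix (Fin n) (Fin n) K) k g
      have e1 : (∑ j, g j • (1 : Matrix (Fin n) (Fin n) K) j) = g := by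
        funext b
        simp [Finset.sum_apply, one_apply]
      rwa [e1, det_one, smul_eq_mul, mul_one] at this
    have hu : IsUnit p'.det := by rw [hdet]; exact hgk.isUnit
    have hr : ∀ j, Pi.single j 1 ᵥ* p' = p' j := fun j => by rw [single_one_vecMul]; rfl
    refine ⟨p'⁻¹, p', mul_nonsing_inv _ hu, ?_, ?_⟩
    · have e1 : Pi.single i 1 ᵥ* p' = Pi.single i 1 := by
        rw [hr, hp', updateRow_ne hki.symm]
        funext b
        simp [one_apply, Pi.single_apply, eq_comm]
      conv_lhs => rw [← e1]
      rw [vecMul_vecMul, mul_nonsing_inv _ hu, vecMul_one]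
    · have e1 : Pi.single k 1 ᵥ* p' = g := by
        rw [hr, hp', updateRow_self]
      conv_lhs => rw [← e1]
      rw [vecMul_vecMul, mul_nonsing_inv _ hu, vecMul_one]
  have h3 := h1.trans (SympConj.levi _ _ _ _ hpp)
  -- the lower left block in the new basis: `p` maps `g` to the `k`-th unit vector
  have hCpp : pᵀ * (C + D * vecMulVec g g - vecMulVec g g * (η • 1 + B * vecMulVec g g)) * p =
      diagonal (Pi.single i c₀ - Pi.single k q) * transvection i k (η * κ) := by
    have e0 : D * vecMulVec g g - vecMulVec g g * (η • 1 + B * vecMulVec g g) =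
        (η * κ) • vecMulVec (Pi.single i c₀) g - q • vecMulVec g g := by
      have e1 : C *ᵥ (B *ᵥ g) = κ • Pi.single i c₀ := by
        rw [hCv, vecMulVec_mulVec, single_one_dotProduct, op_smul_eq_smul]
      rw [hD, Matrix.smul_mul, Matrix.add_mul, one_mul, Matrix.mul_add, Matrix.mul_smul, mul_one,
        mul_assoc, mul_vecMulVec, mul_vecMulVec, e1, vecMulVec_mul_vecMulVec, smul_add,
        smul_vecMulVec, vecMulVec_smul, smul_smul]
      abel
    have ep : ∀ u v : Fin n → K, pᵀ * vecMulVec u v * p = vecMulVec (u ᵥ* p) (v ᵥ* p) := by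
      intro u v
      rw [mul_vecMulVec, vecMulVec_mul, mulVec_transpose]
    have es : (Pi.single i c₀ : Fin n → K) = c₀ • Pi.single i 1 := by
      rw [← Pi.single_smul, smul_eq_mul, mul_one]
    rw [add_sub_assoc, e0, Matrix.mul_add, Matrix.add_mul, hCv, ep, Matrix.mul_sub, Matrix.sub_mul,
      Matrix.mul_smul, Matrix.smul_mul, Matrix.mul_smul, Matrix.smul_mul, ep, ep, es, smul_vecMul,
      hpi, hpk, ← diagonal_mul_transvection hki.symm]
  have hA : ∀ j, j ≠ k → (p' * (η • 1 + B * vecMulVec g g) * p) *ᵥ Pi.single j 1 =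
      η • Pi.single j 1 := by
    intro j hj
    have e1 : p' * (η • 1 + B * vecMulVec g g) * p =
        η • 1 + vecMulVec (p' *ᵥ (B *ᵥ g)) (Pi.single k 1) := by
      rw [Matrix.mul_add, Matrix.add_mul, Matrix.mul_smul, Matrix.smul_mul, mul_one, hpp,
        mul_vecMulVec, mul_vecMulVec, vecMulVec_mul, hpk]
    rw [e1, add_mulVec, smul_mulVec, one_mulVec, vecMulVec_mulVec, single_one_dotProduct,
      Pi.single_eq_of_ne hj.symm, MulOpposite.op_zero, zero_smul, add_zero]
  rw [hCpp] at h3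
  obtain ⟨d, hd, hprod, k', hk'i, hk'⟩ := exists_prod_eq h2 hki.symm (t := fun _ => η)
    (fun _ => hη0) hδ hn
  set T := transvection i k (η * κ) with hT
  have hTj : ∀ j, j ≠ k → T *ᵥ Pi.single j 1 = Pi.single j 1 := by
    intro j hj
    rw [hT, transvection, add_mulVec, one_mulVec, single_mulVec, Pi.single_eq_of_ne hj.symm]
    simp
  have hTk : T *ᵥ Pi.single k 1 = Pi.single k 1 + (η * κ) • Pi.single i 1 := by
    rw [hT, transvection, add_mulVec, one_mulVec, single_mulVec, Pi.single_eq_same,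
      ← Pi.single_smul, mul_one, smul_eq_mul, mul_one]
    rfl
  have hXj : ∀ j, j ≠ k → (diagonal d * T) *ᵥ Pi.single j 1 = d j • Pi.single j 1 := by
    intro j hj
    rw [← mulVec_mulVec, hTj j hj, diagonal_mulVec_single_one]
  refine ⟨diagonal d * T, SympConj.corner_mem_PC hM h3 ?_ ?_, ?_, ?_⟩
  · rw [transpose_mul, transpose_mul, diagonal_transpose, diagonal_transpose, mul_assoc, mul_assoc,
      ← mul_assoc (diagonal _) (diagonal d), ← mul_assoc (diagonal d) (diagonal _),
      diagonal_mul_diagonal, diagonal_mul_diagonal]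
    simp only [mul_comm]
  · intro x j hx hxj
    rw [← mulVec_mulVec] at hx
    have e1 : (T *ᵥ x) k = x k := by
      rw [hT, transvection, add_mulVec, one_mulVec, single_mulVec]
      simp [hki]
    have e2 : (T *ᵥ x) i = x i + η * κ * x k := by
      rw [hT, transvection, add_mulVec, one_mulVec, single_mulVec]
      simp
    have e3 : x k = 0 := by
      have := congrFun hx k
      rw [mulVec_diagonal, e1] at this
      simpa [hki, hq] using this
    have e4 : x i = 0 := by
      have := congrFun hx i
      rw [mulVec_diagonal, e2, e3] at this
      simpa [hki.symm, hc] using this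
    have hjk : j ≠ k := fun h => hxj (h ▸ e3)
    have hji : j ≠ i := fun h => hxj (h ▸ e4)
    rw [hXj j hjk, hA j hjk, hd j hji hjk]
  -- an eigenvector for `d k'` other than the `i`-th unit vector
  · by_cases hkk : k' = k
    · subst hkk
      have hne : d k' - d i ≠ 0 := sub_ne_zero.2 hk'.symm
      refine not_isPrimary_of_eigenvectors (u := Pi.single k' 1 +
        (η * κ * d i / (d k' - d i)) • Pi.single i 1) (μ := d k') (single_one_ne_zero i)
        (hXj i hki.symm) ?_ ?_ hk'
      · intro h0
        have := congrFun h0 k'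
        simp [hki] at this
      · rw [mulVec_add, mulVec_smul, hXj i hki.symm, ← mulVec_mulVec, hTk, mulVec_add, mulVec_smul,
          diagonal_mulVec_single_one, diagonal_mulVec_single_one, smul_add, add_assoc, smul_smul,
          smul_smul, smul_smul, ← add_smul]
        congr 2
        field_simp
        ring
    · exact not_isPrimary_of_eigenvectors (single_one_ne_zero i) (hXj i hki.symm)
        (single_one_ne_zero k') (hXj k' hkk) hk'
  · rw [det_mul, det_diagonal, hprod, hT, det_transvection_of_ne _ _ hki.symm, mul_one]

/-- A diagonal matrix is a corner if its entries are prescribed at the zeros of the diagonal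
symmetric block. -/
lemma diagonal_mem_PC (hM : M ∈ Ω.carrier) {A B D : Matrix (Fin n) (Fin n) K} {c e d : Fin n → K}
    (h : SympConj (M : Matrix (Fin n ⊕ Fin n) (Fin n ⊕ Fin n) K) (fromBlocks A B (diagonal c) D))
    (he : ∀ i, c i = 0 → A *ᵥ Pi.single i 1 = e i • Pi.single i 1)
    (hd : ∀ i, c i = 0 → d i = e i) : diagonal d ∈ SympCorner.PC Ω := by
  refine h.corner_mem_PC hM ?_ ?_
  · rw [diagonal_transpose, diagonal_transpose, diagonal_mul_diagonal, diagonal_mul_diagonal]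
    simp only [mul_comm]
  · intro x i hx hxi
    have hc : c i = 0 := by
      have := congrFun hx i
      rw [mulVec_diagonal] at this
      exact (mul_eq_zero.1 this).resolve_right hxi
    rw [diagonal_mulVec_single_one, he i hc, hd i hc]

/-- The case of non-scalar involutions, where the adapted Lagrangian subspace is invariant.  Both
eigenvalues `1` and `-1` occur on it; a different Lagrangian subspace that mixes two eigenvectors
`i` and `j` provides corners that permute these two up to arbitrary nonzero factors. -/
lemma exists_corner_of_involution (h2 : (2 : K) ≠ 0) (hn : 3 ≤ n) (hM : M ∈ Ω.carrier)
    (hMs : ¬ SympCorner.IsScalarMat (M : Matrix (Fin n ⊕ Fin n) (Fin n ⊕ Fin n) K))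
    (hMM : M * M = 1) {A B D : Matrix (Fin n) (Fin n) K} {e : Fin n → K}
    (h : SympConj (M : Matrix (Fin n ⊕ Fin n) (Fin n ⊕ Fin n) K) (fromBlocks A B 0 D))
    (he : ∀ i, (e i = 1 ∨ e i = -1) ∧ A *ᵥ Pi.single i 1 = e i • Pi.single i 1) {δ : K}
    (hδ : δ ≠ 0) : ∃ A ∈ SympCorner.PC Ω, ¬ SympCorner.IsPrimary A ∧ A.det = δ := by
  have hee : ∀ i, e i * e i = 1 := fun i => by
    rcases (he i).1 with h1 | h1 <;> rw [h1] <;> ring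
  have he0 : ∀ i, e i ≠ 0 := fun i h0 => by
    have := hee i
    rw [h0, zero_mul] at this
    exact zero_ne_one this
  have hA : A = diagonal e := by
    apply ext_of_mulVec_single
    intro i
    rw [(he i).2, diagonal_mulVec_single_one]
  set E := diagonal e with hE
  have hEE : E * E = 1 := by
    rw [hE, diagonal_mul_diagonal, ← diagonal_one]
    congr 1
    funext i
    exact hee i
  have hEt : Eᵀ = E := diagonal_transpose e
  rw [hA] at h
  obtain ⟨-, hBD, hAD⟩ := SymplecticGroup.fromBlocks_mem_iff.1 (h.mem M.2)
  have hD : D = E := by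
    rw [hEt, transpose_zero, Matrix.zero_mul, sub_zero] at hAD
    rw [← one_mul D, ← hEE, mul_assoc, hAD, mul_one]
  rw [hD] at h hBD
  rw [hEt] at hBD
  have hBE : E * B = -(B * E) := by
    obtain ⟨Q, Q', -, h1, h3⟩ := h.exists_eq
    have h4 : Q' * (M : Matrix (Fin n ⊕ Fin n) (Fin n ⊕ Fin n) K) * Q = fromBlocks E B 0 E := by
      rw [h3, ← mul_assoc, ← mul_assoc, h1, one_mul, mul_assoc, h1, mul_one]
    have h5 : (M : Matrix (Fin n ⊕ Fin n) (Fin n ⊕ Fin n) K) * M = 1 := congrArg Subtype.val hMM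
    have h6 : fromBlocks E B 0 E * fromBlocks E B 0 E = (1 : Matrix (Fin n ⊕ Fin n) _ K) := by
      have h7 : Q * Q' = 1 := mul_eq_one_comm.1 h1
      calc fromBlocks E B 0 E * fromBlocks E B 0 E
          = Q' * (M : Matrix (Fin n ⊕ Fin n) (Fin n ⊕ Fin n) K) * (Q * Q') * M * Q := by
            rw [← h4]; simp only [mul_assoc]
        _ = Q' * ((M : Matrix (Fin n ⊕ Fin n) (Fin n ⊕ Fin n) K) * M) * Q := by
            rw [h7, mul_one]; simp only [mul_assoc]
        _ = 1 := by rw [h5, mul_one, h1]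
    rw [fromBlocks_multiply, ← fromBlocks_one, fromBlocks_inj] at h6
    exact eq_neg_of_add_eq_zero_left h6.2.1
  -- the upper right block disappears, since the involution is diagonalizable
  have h3 : SympConj (M : Matrix (Fin n ⊕ Fin n) (Fin n ⊕ Fin n) K) (fromBlocks E 0 0 E) := by
    have hS : ((2⁻¹ : K) • (E * B))ᵀ = (2⁻¹ : K) • (E * B) := by
      rw [transpose_smul, transpose_mul, hEt, hBD]
    have h4 := h.trans (SympConj.upper E B 0 E hS)
    have h5 : B + (2⁻¹ : K) • (E * B) * E - (E + (2⁻¹ : K) • (E * B) * 0) *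
        ((2⁻¹ : K) • (E * B)) = 0 := by
      rw [mul_zero, add_zero, Matrix.mul_smul, ← mul_assoc, hEE, one_mul, Matrix.smul_mul, hBE,
        Matrix.neg_mul, mul_assoc, hEE, mul_one, smul_neg]
      have h6 : (2⁻¹ : K) • B + (2⁻¹ : K) • B = B := by
        rw [← two_smul K, smul_smul, mul_inv_cancel₀ h2, one_smul]
      nth_rewrite 1 [← h6]
      abel
    rwa [h5, mul_zero, add_zero, zero_mul, sub_zero] at h4
  have hscalar : ∀ t : K, ¬ ∀ i, e i = t := by
    intro t ht
    apply hMs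
    obtain ⟨Q, Q', h4, -, h5⟩ := h3.exists_eq
    refine ⟨t, ?_⟩
    have h6 : E = t • 1 := by
      rw [hE, smul_one_eq_diagonal]
      congr 1
      funext i
      exact ht i
    have h7 : fromBlocks E 0 0 E = t • (1 : Matrix (Fin n ⊕ Fin n) (Fin n ⊕ Fin n) K) := by
      rw [← fromBlocks_one, fromBlocks_smul, h6, smul_zero]
    rw [h5, h7, Matrix.mul_smul, mul_one, Matrix.smul_mul, h4]
  obtain ⟨j, hj⟩ := not_forall.1 (hscalar 1)
  obtain ⟨i, hi⟩ := not_forall.1 (hscalar (-1))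
  replace hj : e j = -1 := (he j).1.resolve_left hj
  replace hi : e i = 1 := (he i).1.resolve_right hi
  have hij : i ≠ j := by
    rintro rfl
    rw [hi] at hj
    exact h2 (by linear_combination hj)
  obtain ⟨k, hk⟩ : ∃ k, k ∉ ({i, j} : Finset (Fin n)) := by
    by_contra hcon
    push Not at hcon
    have h4 := Finset.card_le_card (fun k _ => hcon k : Finset.univ ⊆ ({i, j} : Finset (Fin n)))
    rw [Finset.card_univ, Fintype.card_fin] at h4
    have := h4.trans Finset.card_le_two
    omega
  simp only [Finset.mem_insert, Finset.mem_singleton, not_or] at hk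
  obtain ⟨hki, hkj⟩ := hk
  -- a second Lagrangian subspace is obtained from the swap `P` of the coordinates `i` and `j`
  set σ := Equiv.swap i j with hσ
  set P := σ.permMatrix K with hP
  have hPt : Pᵀ = P := by rw [hP, transpose_permMatrix, hσ, Equiv.swap_inv]
  have hPv : ∀ v, P *ᵥ v = v ∘ σ := fun v => permMatrix_mulVec σ
  have hPs : ∀ l, P *ᵥ Pi.single l 1 = Pi.single (σ l) 1 := by
    intro l
    rw [hPv]
    funext a
    simp only [Function.comp_apply, Pi.single_apply, hσ, Equiv.swap_apply_eq_iff]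
  have hPE : P * E = diagonal (e ∘ σ) * P := by
    apply ext_of_mulVec_single
    intro l
    rw [← mulVec_mulVec, ← mulVec_mulVec, hE, diagonal_mulVec_single_one, mulVec_smul, hPs,
      diagonal_mulVec_single_one, Function.comp_apply, hσ, Equiv.swap_apply_self]
  have h4 := h3.trans (SympConj.lower E 0 0 E hPt)
  have h5 : 0 + E * P - P * (E + 0 * P) = diagonal (e - e ∘ σ) * P := by
    rw [zero_mul, add_zero, zero_add, hPE, ← Matrix.sub_mul, hE, diagonal_sub]
    rfl
  rw [h5] at h4
  set π := ∏ l ∈ (Finset.univ.erase i).erase j, e l with hπ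
  have hπ0 : π ≠ 0 := Finset.prod_ne_zero_iff.2 fun l _ => he0 l
  set t := δ / π with ht
  set f : Fin n → K := fun l => if l = i then -t else if l = j then 1 else e l with hf
  have hfi : f i = -t := by simp [hf]
  have hfj : f j = 1 := by simp [hf, hij.symm]
  have hfl : ∀ l, l ≠ i → l ≠ j → f l = e l := fun l h6 h7 => by simp [hf, h6, h7]
  have hXl : ∀ l, l ≠ i → l ≠ j → (diagonal f * P) *ᵥ Pi.single l 1 = e l • Pi.single l 1 := by
    intro l h6 h7
    rw [← mulVec_mulVec, hPs, hσ, Equiv.swap_apply_of_ne_of_ne h6 h7, diagonal_mulVec_single_one,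
      hfl l h6 h7]
  have hXi : (diagonal f * P) *ᵥ Pi.single i 1 = Pi.single j 1 := by
    rw [← mulVec_mulVec, hPs, hσ, Equiv.swap_apply_left, diagonal_mulVec_single_one, hfj, one_smul]
  have hXj : (diagonal f * P) *ᵥ Pi.single j 1 = -t • Pi.single i 1 := by
    rw [← mulVec_mulVec, hPs, hσ, Equiv.swap_apply_right, diagonal_mulVec_single_one, hfi]
  refine ⟨diagonal f * P, h4.corner_mem_PC hM ?_ ?_, ?_, ?_⟩
  · rw [transpose_mul, transpose_mul, diagonal_transpose, diagonal_transpose, mul_assoc, mul_assoc,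
      ← mul_assoc (diagonal _) (diagonal f), ← mul_assoc (diagonal f) (diagonal _),
      diagonal_mul_diagonal, diagonal_mul_diagonal]
    simp only [mul_comm]
  · intro x l hx hxl
    have h6 : ∀ a, (e a - e (σ a)) * x (σ a) = 0 := by
      intro a
      have := congrFun hx a
      rwa [← mulVec_mulVec, hPv, mulVec_diagonal] at this
    have hli : l ≠ i := by
      rintro rfl
      have := h6 j
      rw [hσ, Equiv.swap_apply_right, hi, hj] at this
      exact (mul_ne_zero (fun h0 => h2 (by linear_combination -h0)) hxl) this
    have hlj : l ≠ j := by
      rintro rfl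
      have := h6 i
      rw [hσ, Equiv.swap_apply_left, hi, hj] at this
      exact (mul_ne_zero (fun h0 => h2 (by linear_combination h0)) hxl) this
    rw [hXl l hli hlj, zero_mul, add_zero, hE, diagonal_mulVec_single_one]
  -- the eigenvalue `e k = ± 1` of the corner, and its restriction to the span of the `i`-th and
  -- `j`-th unit vectors, where its square is `-t`
  · by_cases ht1 : t = -1
    · refine not_isPrimary_of_eigenvectors (η := e k) (μ := -e k)
        (u := Pi.single i 1 - e k • Pi.single j 1) (single_one_ne_zero k) (hXl k hki hkj) ?_ ?_ ?_
      · intro h0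
        have := congrFun h0 i
        simp [hij] at this
      · rw [mulVec_sub, mulVec_smul, hXi, hXj, ht1, neg_neg, one_smul, smul_sub, smul_smul,
          neg_mul, hee, neg_smul, neg_smul, one_smul]
        abel
      · intro h0
        exact mul_ne_zero h2 (he0 k) (by linear_combination h0)
    · refine not_isPrimary (single_one_ne_zero k) (hXl k hki hkj) (X ^ 2 + C t)
        (single_one_ne_zero i) ?_ ?_
      · rw [map_add, map_pow, aeval_X, aeval_C, Algebra.algebraMap_eq_smul_one, add_mulVec, sq,
          ← mulVec_mulVec, hXi, hXj, smul_mulVec, one_mulVec, neg_smul, neg_add_cancel]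
      · rw [eval_add, eval_pow, eval_X, eval_C, sq, hee]
        exact fun h0 => ht1 (by linear_combination h0)
  · rw [det_mul, det_diagonal, hP, det_permutation, hσ, Equiv.Perm.sign_swap hij,
      ← Finset.mul_prod_erase _ _ (Finset.mem_univ i),
      ← Finset.mul_prod_erase _ _ (Finset.mem_erase.2 ⟨hij.symm, Finset.mem_univ j⟩),
      Finset.prod_congr rfl (g := e), ← hπ, hfi, hfj, ht]
    · push_cast
      field_simp
    · intro l hl
      rw [Finset.mem_erase, Finset.mem_erase] at hl
      exact hfl l hl.2.1 hl.1

/-- The corners of a conjugacy class whose elements differ from every scalar matrix by a matrix of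
rank at least two. -/
theorem exists_corner_of_ne_vecMulVec (h2 : (2 : K) ≠ 0) (hn2 : 2 ≤ n) (hM : M ∈ Ω.carrier)
    (hMs : ¬ SympCorner.IsScalarMat (M : Matrix (Fin n ⊕ Fin n) (Fin n ⊕ Fin n) K))
    (hrk : ∀ (η : K) u v, (M : Matrix (Fin n ⊕ Fin n) (Fin n ⊕ Fin n) K) - η • 1 ≠ vecMulVec u v)
    {δ : K} (hδ : δ ≠ 0)
    (hn : 3 ≤ n ∨ (M * M ≠ 1 ∧ Nat.card K ≠ 3) ∨ (M * M ≠ 1 ∧ δ ≠ 1)) :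
    ∃ A ∈ SympCorner.PC Ω, ¬ SympCorner.IsPrimary A ∧ A.det = δ := by
  classical
  obtain ⟨A, B, D, c, e, h, he, hinv⟩ := exists_sympConj_diagonal h2 M
  have hee : ∀ i, c i = 0 → e i * e i = 1 := fun i hi => by
    rcases (he i hi).1 with h1 | h1 <;> rw [h1] <;> ring
  have hn' : 3 ≤ n ∨ Nat.card K ≠ 3 ∨ δ ≠ 1 := hn.imp_right (Or.imp And.right And.right)
  by_cases hc : c = 0
  · have hMM := hinv hc
    subst hc
    rw [diagonal_zero'] at h
    have hn3 : 3 ≤ n := by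
      rcases hn with h1 | h1 | h1
      · exact h1
      · exact absurd hMM h1.1
      · exact absurd hMM h1.1
    exact exists_corner_of_involution h2 hn3 hM hMs hMM h (fun i => he i rfl) hδ
  obtain ⟨i, hi⟩ := Function.ne_iff.1 hc
  rw [Pi.zero_apply] at hi
  -- the prescribed entries of diagonal corners, and arbitrary ones at the remaining places
  set t : Fin n → K := fun k => if c k = 0 then e k else 1 with ht
  have htc : ∀ k, c k = 0 → t k = e k := fun k hk => by rw [ht]; exact if_pos hk
  have ht0 : ∀ k, t k ≠ 0 := by
    intro k
    by_cases hk : c k = 0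
    · rw [htc k hk]
      intro h0
      have := hee k hk
      rw [h0, zero_mul] at this
      exact zero_ne_one this
    · simp [ht, hk]
  have hdiag : ∀ d : Fin n → K, (∀ k, c k = 0 → d k = t k) → ∏ k, d k = δ →
      (∃ k l, d k ≠ d l) → ∃ A ∈ SympCorner.PC Ω, ¬ SympCorner.IsPrimary A ∧ A.det = δ := by
    rintro d hd hprod ⟨k, l, hkl⟩
    exact ⟨diagonal d, diagonal_mem_PC hM h (fun k hk => (he k hk).2)
      (fun k hk => (hd k hk).trans (htc k hk)),
      not_isPrimary_of_eigenvectors (single_one_ne_zero k) (diagonal_mulVec_single_one d k)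
        (single_one_ne_zero l) (diagonal_mulVec_single_one d l) hkl, by rw [det_diagonal, hprod]⟩
  -- at least two free entries
  by_cases hj : ∃ j, j ≠ i ∧ c j ≠ 0
  · obtain ⟨j, hji, hj⟩ := hj
    obtain ⟨d, hd, hprod, k, -, hk⟩ := exists_prod_eq h2 hji.symm ht0 hδ hn'
    exact hdiag d (fun k hk => hd k (fun h1 => hi (h1 ▸ hk)) fun h1 => hj (h1 ▸ hk)) hprod
      ⟨i, k, hk⟩
  push Not at hj
  -- a single free entry, and two different prescribed ones
  by_cases hjk : ∃ j k, j ≠ i ∧ k ≠ i ∧ e j ≠ e k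
  · obtain ⟨j, k, hji, hki, hjk⟩ := hjk
    have hπ : ∏ l ∈ Finset.univ.erase i, t l ≠ 0 := Finset.prod_ne_zero_iff.2 fun l _ => ht0 l
    refine hdiag (Function.update t i (δ / ∏ l ∈ Finset.univ.erase i, t l)) ?_ ?_ ⟨j, k, ?_⟩
    · intro l hl
      exact Function.update_of_ne (fun h1 => hi (by rw [← h1, hl])) _ _
    · rw [← Finset.mul_prod_erase _ _ (Finset.mem_univ i), Function.update_self,
        Finset.prod_update_of_notMem (Finset.notMem_erase i _), div_mul_cancel₀ _ hπ]
    · rwa [Function.update_of_ne hji, Function.update_of_ne hki, htc j (hj j hji),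
        htc k (hj k hki)]
  -- a single free entry, and equal prescribed ones
  push Not at hjk
  have : Nontrivial (Fin n) := Fin.nontrivial_iff_two_le.2 hn2
  obtain ⟨j, hji⟩ := exists_ne i
  have hcs : c = Pi.single i (c i) := by
    funext k
    by_cases hk : k = i
    · rw [hk, Pi.single_eq_same]
    · rw [hj k hk, Pi.single_eq_of_ne hk]
  obtain ⟨B', D', h1⟩ := exists_sympConj_corner (h.mem M.2) (X := e j • 1) (by
      rw [transpose_smul, transpose_one, Matrix.mul_smul, Matrix.smul_mul, mul_one, one_mul,
        diagonal_transpose]) (fun x hx => mulVec_eq_of_mulVec_single_eq fun k hxk => by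
      have hck : c k = 0 := by
        have := congrFun hx k
        rw [mulVec_diagonal] at this
        exact (mul_eq_zero.1 this).resolve_right hxk
      rw [smul_mulVec, one_mulVec, (he k hck).2, hjk j k hji fun h1 => hi (h1 ▸ hck)])
  rw [hcs] at h h1
  exact exists_corner_of_scalar h2 hn2 hM (h.trans h1) (hee j (hj j hji)) hi (hrk (e j)) hδ hn'

end Corners

/-! ### Corners of conjugacy classes -/

/-- A symplectic matrix `1 + u vᵀ` does not have the eigenvalue `-1`. -/
lemma eq_zero_of_mulVec_eq_neg {n : ℕ} {K : Type*} [Field K] (h2 : (2 : K) ≠ 0)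
    {N : Matrix (Fin n ⊕ Fin n) (Fin n ⊕ Fin n) K} (hN : N ∈ symplecticGroup (Fin n) K)
    {u v x : Fin n ⊕ Fin n → K} (huv : N - (1 : K) • 1 = vecMulVec u v)
    (hx : N *ᵥ x = -x) : x = 0 := by
  have hNv : ∀ y, N *ᵥ y = y + (v ⬝ᵥ y) • u := by
    intro y
    have := congrArg (· *ᵥ y) huv
    simp only [one_smul, sub_mulVec, one_mulVec, vecMulVec_mulVec, op_smul_eq_smul] at this
    rw [← this, add_sub_cancel]
  have h1 : (2 : K) • x = -((v ⬝ᵥ x) • u) := by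
    have := hNv x
    rw [hx] at this
    rw [two_smul]
    nth_rewrite 1 [← neg_neg x]
    rw [this]
    abel
  have h3 : sympForm (Fin n) K x u = 0 := by
    have h4 := congrArg (fun y => sympForm (Fin n) K y u) h1
    simp only [map_smul, map_neg, LinearMap.smul_apply, LinearMap.neg_apply, sympForm_self,
      smul_zero, neg_zero] at h4
    exact (smul_eq_zero.1 h4).resolve_left h2
  refine (sympIsom_toLin' (⟨N, hN⟩ : symplecticGroup (Fin n) K)).nondeg x fun y => ?_
  have h4 := sympForm_mulVec hN x y
  rw [hx, hNv y, map_neg, LinearMap.neg_apply, map_add, map_smul, h3, smul_zero, add_zero] at h4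
  have h5 : (2 : K) * sympForm (Fin n) K x y = 0 := by linear_combination -h4
  exact (mul_eq_zero.1 h5).resolve_left h2

theorem lemma1 {K : Type*} [Field K] (n : ℕ) (hn : 2 ≤ n)
    (Ω : ConjClasses (Matrix.symplecticGroup (Fin n) K))
    (M : Matrix.symplecticGroup (Fin n) K) (hM : M ∈ Ω.carrier)
    (hΩ : ¬ SympCorner.IsScalarMat (M : Matrix (Fin n ⊕ Fin n) (Fin n ⊕ Fin n) K)) :
    -- characteristic 2
    (ringChar K = 2 →
      (1 : Matrix (Fin n) (Fin n) K) ∈ SympCorner.PC Ω ∧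
      ((∃ A ∈ SympCorner.PC Ω, SympCorner.IsTransvection A) ∨
        ∃ ε : K, ε ≠ 0 ∧ ε ≠ 1 ∧
          SympCorner.dsum (show (n - 2) + 2 = n by omega) 1 !![ε, 0; 0, ε⁻¹] ∈
            SympCorner.PC Ω) ∧
      ∀ δ : K, δ ≠ 0 →
        SympCorner.dsum (show 1 + (n - 1) = n by omega) !![δ] 1 ∈ SympCorner.PC Ω ∨
        ∃ Q : Matrix (Fin 2) (Fin 2) K, minpoly K Q = Polynomial.X ^ 2 + Polynomial.C δ ∧
          SympCorner.dsum (show 2 + (n - 2) = n by omega) Q 1 ∈ SympCorner.PC Ω) ∧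
    -- characteristic not 2, second invariant factor `x - 1`
    (ringChar K ≠ 2 →
      SympCorner.invFactor (M : Matrix (Fin n ⊕ Fin n) (Fin n ⊕ Fin n) K) 2 =
        Polynomial.X - 1 →
      (∃ A ∈ SympCorner.PC Ω, SympCorner.IsTransvection A) ∧
      ∀ δ : K, SympCorner.dsum (show (n - 1) + 1 = n by omega) 1 !![δ] ∈ SympCorner.PC Ω) ∧
    -- characteristic not 2, second invariant factor `1`
    (ringChar K ≠ 2 →
      SympCorner.invFactor (M : Matrix (Fin n ⊕ Fin n) (Fin n ⊕ Fin n) K) 2 = 1 →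
      ∀ δ : K, δ ≠ 0 →
        (3 ≤ n ∨ (M * M ≠ 1 ∧ Nat.card K ≠ 3) ∨ (M * M ≠ 1 ∧ δ ≠ 1)) →
        ∃ A ∈ SympCorner.PC Ω, ¬ SympCorner.IsPrimary A ∧ A.det = δ) := by
  have hM1 : M ≠ 1 := by
    rintro rfl
    exact hΩ ⟨1, (one_smul K _).symm⟩
  refine ⟨fun hchar => ?_, fun hchar hfac => ?_, fun hchar hfac δ hδ hcond => ?_⟩
  · have h2 : (2 : K) = 0 := by
      have := ringChar.Nat.cast_ringChar (R := K)
      rw [hchar] at this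
      exact_mod_cast this
    obtain ⟨A, B, C, D, h, hC, hker, -⟩ := exists_sympConj_adapted M
    obtain ⟨N, -, hNs, hN0, hN⟩ := exists_flexible hM hM1 h hC fun x hx => by
      obtain ⟨a, b, rfl, -, -, ha, hb⟩ := hker x hx
      have h3 : -b = b := by
        rw [neg_eq_iff_add_eq_zero, ← two_smul K, h2, zero_smul]
      rw [mulVec_add, ha, hb, h3]
    exact hN.corners_of_two_eq_zero h2 hn _ _ _ hNs hN0
  · have h2 : (2 : K) ≠ 0 := Ring.two_ne_zero hchar
    obtain ⟨u, v, huv⟩ := exists_vecMulVec_of_dvd (a := (1 : K)) hΩ (by rw [hfac, C_1])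
    obtain ⟨A, B, C, D, h, hC, hker, -⟩ := exists_sympConj_adapted M
    obtain ⟨N, hMN, hNs, hN0, hN⟩ := exists_flexible hM hM1 h hC fun x hx => by
      obtain ⟨a, b, rfl, -, hCb, ha, hb⟩ := hker x hx
      obtain ⟨u', v', huv'⟩ := h.symm.exists_vecMulVec huv
      have h3 : (Sum.elim b 0 : Fin n ⊕ Fin n → K) = 0 :=
        eq_zero_of_mulVec_eq_neg h2 (h.mem M.2) huv' (by
          rw [fromBlocks_mulVec]
          funext i
          rcases i with i | i <;> simp [hCb, hb])
      have h4 : b = 0 := funext fun i => congrFun h3 (Sum.inl i)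
      rw [h4, add_zero, ha]
    obtain ⟨u', v', huv'⟩ := hMN.symm.exists_vecMulVec huv
    have hNb : N.toBlocks₂₁ = vecMulVec (u' ∘ Sum.inr) (v' ∘ Sum.inl) := by
      ext i j
      have := congrFun (congrFun huv' (Sum.inr i)) (Sum.inl j)
      simpa [vecMulVec_apply, toBlocks₂₁] using this
    obtain ⟨y, hy, hvy⟩ := exists_dotProduct_eq_zero hn (v' ∘ Sum.inl)
    exact hN.corners_of_degenerate h2 _ hNs hN0 hy (by
      rw [hNb, vecMulVec_mulVec, hvy, op_smul_eq_smul, zero_smul])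
  · exact exists_corner_of_ne_vecMulVec (Ring.two_ne_zero hchar) hn hM hΩ
      (fun η u v huv => invFactor_two_ne_one hΩ huv hfac) hδ hcond
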